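/- Let $\Sigma,\Omega$ be finite alphabets and $\mathcal X$ a finite, linearly ordered set of variables, and let $\Gamma_{\mathcal X}=\{\vdash_x,\dashv_x\mid x\in\mathcal X\}$ be a set of opening and closing brackets. A span of a document $D\in\Sigma^*$ is a pair $[i,j\rangle$ with $1\le i\le j\le |D|+1$; spans $[i,j\rangle$, $[i',j'\rangle$ are disjoint if $j\le i'$ or $j'\le i$. A multispan-tuple over $D$ maps each $x\in\mathcal X$ to a set of pairwise disjoint spans of $D$. A multispanner $E$ maps every $D\in\Sigma^*$ to a set $E(D)$ of multispan-tuples over $D$. A multispanner-expression is built by $R ::= \varepsilon\mid a\mid (R\cdot R)\mid (R+R)\mid R^*\mid x\{R\}$ with $a\in\Sigma$, $x\in\mathcal X$, where $x\{R\}$ is allowed only if $x$ does not appear in $R$; its language $L(R)\subseteq(\Sigma\cup\Gamma_{\mathcal X})^*$ is defined as usual, with $L(x\{R\})=\{\vdash_x\}\cdot L(R)\cdot\{\dashv_x\}$. Each $w\in L(R)$ describes the document $\mathrm{doc}(w)$ obtained by erasing the brackets, and the multispan-tuple over $\mathrm{doc}(w)$ that maps $x$ to the set of spans enclosed by the matching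 pairs $\vdash_x\ldots\dashv_x$ of $w$. $E$ is a regex multispanner if for some $R$ and all $D$, $E(D)$ is the set of tuples described by the words $w\in L(R)$ with $\mathrm{doc}(w)=D$. For a document $D$ and a multispan-tuple $t$ over $D$, let $\mathrm{nref}(t,D)=t[1]\,D[1]\,t[2]\,D[2]\cdots D[|D|]\,t[|D|+1]$, where $t[i]$ is the concatenation, in the order of the variables, of the words $(\dashv_x)^{c}(\vdash_x\dashv_x)^{e}(\vdash_x)^{o}$ with $c,e,o\in\{0,1\}$, $c=1$ iff $[j,i\rangle\in t(x)$ for some $j\ne i$, $e=1$ iff $[i,i\rangle\in t(x)$, and $o=1$ iff $[i,j\rangle\in t(x)$ for some $j\neq i$. A linear ET program is a pair $(E,T)$ of a regex multispanner $E$ over $\Sigma$ and $\mathcal X$ and a linear polyregular function $T:(\Sigma\cup\Gamma_{\mathcal X})^*\rightharpoonup\Omega^*$, that is, a partial function computed by a (copyless) deterministic streaming string transducer. Its output on $D$ is the bag $[\![E\cdot T]\!](D)=\{\!\{T(\mathrm{nref}(t,D))\mid t\in E(D),\ T(\mathrm{nref}(t,D))\text{ defined}\}\!\}$. **Theorem.**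 For every fixed linear ET program $(E,T)$, the problem of enumerating, on input $D\in\Sigma^*$, the bag $[\![E\cdot T]\!](D)$ (with repetitions) admits an algorithm with linear preprocessing and output-linear delay in the model of random access machines with uniform cost measure and with addition and subtraction as arithmetic operations. That is, there are a constant $k$ and two RAM programs, depending only on $(E,T)$ and on the encoding of the letters by nonzero integers, such that for every $D\in\Sigma^*$: the first program, on input $D$, halts after at most $k\cdot(|D|+1)$ steps without writing any output; the second program, started on the memory left behind by the first one and with no other input, writes some sequence $w_1,\ldots,w_\ell$ that contains every element of the bag $[\![E\cdot T]\!](D)$ exactly as often as its multiplicity, each word being followed by an end marker, and then halts; for every $i$, the time from the completion of $w_{i-1}$ (from the start of the second program if $i=1$) to the completion of $w_i$ is at most $k\cdot(|w_i|+1)$, and the time from the completion of the last word (from the start if $\ell=0$) to halting is at most $k$. -/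

import Mathlib

namespace ET

/-! ### Documents, spans and multispanners -/

/-- The meta-symbols: an opening and a closing bracket for every variable. -/
inductive Bracket (X : Type*) where
  | opn (x : X)
  | cls (x : X)

/-- The alphabet of multiref-words: letters of the document alphabet and brackets. -/
abbrev RefSym (A X : Type*) := A ⊕ Bracket X

/-- A span `[i, j⟩` is the pair `(i, j)`; positions start at `1`. -/
abbrev Span := ℕ × ℕ

/-- `s` is a span of the document `D`. -/
def IsSpanOf {A : Type*} (D : List A) (s : Span) : Prop :=
  1 ≤ s.1 ∧ s.1 ≤ s.2 ∧ s.2 ≤ D.length + 1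

/-- Disjointness of two spans. -/
def SpanDisjoint (s s' : Span) : Prop := s.2 ≤ s'.1 ∨ s'.2 ≤ s.1

/-- `t` is a multispan-tuple over the document `D`: every variable is mapped to a set of
pairwise disjoint spans of `D`. -/
def IsMultispanTuple {A X : Type*} (D : List A) (t : X → Set Span) : Prop :=
  ∀ x, (∀ s ∈ t x, IsSpanOf D s) ∧ (t x).Pairwise SpanDisjoint

/-- A multispanner maps every document `D` to a set of multispan-tuples over `D`. -/
structure Multispanner (A X : Type*) where
  rel : List A → Set (X → Set Span)
  valid : ∀ D, ∀ t ∈ rel D, IsMultispanTuple D t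

theorem Multispanner.finite {A X : Type*} [Finite X] (E : Multispanner A X) (D : List A) :
    (E.rel D).Finite := by
  have hS : {s : Span | IsSpanOf D s}.Finite := by
    refine Set.Finite.subset
      ((Set.finite_Iic (D.length + 1)).prod (Set.finite_Iic (D.length + 1))) ?_
    rintro ⟨i, j⟩ ⟨_, h2, h3⟩
    simp only [Set.mem_prod, Set.mem_Iic] at *
    omega
  refine Set.Finite.subset
    (Set.Finite.pi (t := fun _ : X => {U : Set Span | U ⊆ {s | IsSpanOf D s}})
      (fun _ => hS.finite_subsets)) ?_
  intro t ht x _ s hs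
  exact (E.valid D t ht x).1 s hs

/-! ### Multiref-words and regex multispanners -/

/-- The document described by a word with brackets: erase the brackets. -/
def doc {A X : Type*} (w : List (RefSym A X)) : List A := w.filterMap Sum.getLeft?

theorem doc_append {A X : Type*} (u v : List (RefSym A X)) : doc (u ++ v) = doc u ++ doc v :=
  List.filterMap_append

theorem doc_cons_inr {A X : Type*} (b : Bracket X) (u : List (RefSym A X)) :
    doc (Sum.inr b :: u) = doc u :=
  List.filterMap_cons_none rfl

/-- The multispan-tuple described by a word with brackets: the spans of `x` are the ones enclosed
by an occurrence of the opening bracket of `x` and the next bracket of `x`, if that is closing. -/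
def tupleOf {A X : Type*} (w : List (RefSym A X)) (x : X) : Set Span :=
  {s | ∃ u v z : List (RefSym A X),
    w = u ++ Sum.inr (Bracket.opn x) :: (v ++ Sum.inr (Bracket.cls x) :: z) ∧
    Sum.inr (Bracket.opn x) ∉ v ∧ Sum.inr (Bracket.cls x) ∉ v ∧
    s = ((doc u).length + 1, (doc u).length + (doc v).length + 1)}

theorem tupleOf_aux {A X : Type*} {x : X} {u v z u' v' z' : List (RefSym A X)}
    (h : u ++ Sum.inr (Bracket.opn x) :: (v ++ Sum.inr (Bracket.cls x) :: z) =
      u' ++ Sum.inr (Bracket.opn x) :: (v' ++ Sum.inr (Bracket.cls x) :: z'))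
    (hv : Sum.inr (Bracket.opn x) ∉ v) (hv2 : Sum.inr (Bracket.cls x) ∉ v)
    (hv2' : Sum.inr (Bracket.cls x) ∉ v') :
    (doc u).length + (doc v).length ≤ (doc u').length ∨
    ((doc u).length = (doc u').length ∧ (doc v).length = (doc v').length) ∨
    u'.length < u.length := by
  rcases List.append_eq_append_iff.1 h with ⟨a, ha, hb⟩ | ⟨a, ha, hb⟩
  · cases a with
    | nil =>
      right; left
      simp only [List.nil_append, List.cons.injEq, true_and, List.append_nil] at hb ha
      subst ha
      refine ⟨rfl, ?_⟩
      rcases List.append_eq_append_iff.1 hb with ⟨b, hb1, hb2⟩ | ⟨b, hb1, hb2⟩ <;>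
      · cases b with
        | nil => simp at hb1; rw [hb1]
        | cons c b =>
          simp only [List.cons_append, List.cons.injEq] at hb2
          exfalso
          have h1 := hb2.1
          subst h1
          subst hb1
          simp at hv2 hv2'
    | cons c a =>
      left
      simp only [List.cons_append, List.cons.injEq] at hb
      obtain ⟨rfl, hb⟩ := hb
      rcases List.append_eq_append_iff.1 hb with ⟨b, hb1, -⟩ | ⟨b, hb1, hb2⟩
      · rw [ha, hb1]; simp [doc_append, doc_cons_inr]
      · cases b with
        | nil => rw [ha]; simp at hb1; rw [hb1]; simp [doc_append, doc_cons_inr]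
        | cons c b =>
          simp only [List.cons_append, List.cons.injEq] at hb2
          rw [hb1, ← hb2.1] at hv
          simp at hv
  · cases a with
    | nil =>
      right; left
      simp only [List.nil_append, List.cons.injEq, true_and, List.append_nil] at hb ha
      subst ha
      refine ⟨rfl, ?_⟩
      rcases List.append_eq_append_iff.1 hb with ⟨b, hb1, hb2⟩ | ⟨b, hb1, hb2⟩ <;>
      · cases b with
        | nil => simp at hb1; rw [hb1]
        | cons c b =>
          simp only [List.cons_append, List.cons.injEq] at hb2
          exfalso
          have h1 := hb2.1
          subst h1
          subst hb1
          simp at hv2 hv2'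
    | cons c a =>
      right; right
      rw [ha]; simp

theorem isMultispanTuple_tupleOf {A X : Type*} (w : List (RefSym A X)) :
    IsMultispanTuple (doc w) (tupleOf w) := by
  intro x
  refine ⟨?_, ?_⟩
  · rintro s ⟨u, v, z, rfl, -, -, rfl⟩
    refine ⟨by simp, by simp, ?_⟩
    simp [doc_append, doc_cons_inr]
  · rintro s ⟨u, v, z, h, hv, hv2, rfl⟩ s' ⟨u', v', z', h', hv', hv2', rfl⟩ hne
    have e := h.symm.trans h'
    have h1 := tupleOf_aux e hv hv2 hv2'
    have h2 := tupleOf_aux e.symm hv' hv2' hv2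
    simp only [ne_eq, Prod.mk.injEq, not_and] at hne
    simp only [SpanDisjoint]
    omega

/-- The multispanner described by a language of words with brackets. -/
def Multispanner.ofLanguage {A X : Type*} (L : Language (RefSym A X)) : Multispanner A X where
  rel D := {t | ∃ w ∈ L, doc w = D ∧ tupleOf w = t}
  valid := by
    rintro D t ⟨w, -, rfl, rfl⟩
    exact isMultispanTuple_tupleOf w

/-- Raw multispanner-expressions. -/
inductive MExpr (A X : Type*) where
  | eps
  | sym (a : A)
  | cat (R S : MExpr A X)
  | alt (R S : MExpr A X)
  | star (R : MExpr A X)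
  | bind (x : X) (R : MExpr A X)

/-- The set of variables that appear in an expression. -/
def MExpr.vars {A X : Type*} : MExpr A X → Set X
  | .eps => ∅
  | .sym _ => ∅
  | .cat R S => R.vars ∪ S.vars
  | .alt R S => R.vars ∪ S.vars
  | .star R => R.vars
  | .bind x R => insert x R.vars

/-- `x{R}` is allowed only if `x` does not appear in `R`. -/
def MExpr.WellFormed {A X : Type*} : MExpr A X → Prop
  | .eps => True
  | .sym _ => True
  | .cat R S => R.WellFormed ∧ S.WellFormed
  | .alt R S => R.WellFormed ∧ S.WellFormed
  | .star R => R.WellFormed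
  | .bind x R => x ∉ R.vars ∧ R.WellFormed

/-- The language that consists of a single one-letter word. -/
def letterLang {B : Type*} (b : B) : Language B := ({[b]} : Set (List B))

/-- The language of an expression. -/
def MExpr.lang {A X : Type*} : MExpr A X → Language (RefSym A X)
  | .eps => 1
  | .sym a => letterLang (Sum.inl a)
  | .cat R S => R.lang * S.lang
  | .alt R S => R.lang + S.lang
  | .star R => KStar.kstar R.lang
  | .bind x R =>
      letterLang (Sum.inr (Bracket.opn x)) * R.lang * letterLang (Sum.inr (Bracket.cls x))

/-- `E` is a regex multispanner. -/
def Multispanner.IsRegex {A X : Type*} (E : Multispanner A X) : Prop :=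
  ∃ R : MExpr A X, R.WellFormed ∧ E = Multispanner.ofLanguage R.lang

/-! ### The unique multiref-word of a document and a multispan-tuple -/

open Classical in
/-- The brackets of the variable `x` in front of position `i`. -/
noncomputable def blockVar {A X : Type*} (t : X → Set Span) (i : ℕ) (x : X) :
    List (RefSym A X) :=
  (if ∃ j, j ≠ i ∧ (j, i) ∈ t x then [Sum.inr (Bracket.cls x)] else []) ++
  (if (i, i) ∈ t x then [Sum.inr (Bracket.opn x), Sum.inr (Bracket.cls x)] else []) ++
  (if ∃ j, j ≠ i ∧ (i, j) ∈ t x then [Sum.inr (Bracket.opn x)] else [])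

/-- All brackets in front of position `i`, in the order of the variables. -/
noncomputable def block {A X : Type*} [Fintype X] [LinearOrder X] (t : X → Set Span) (i : ℕ) :
    List (RefSym A X) :=
  ((Finset.univ : Finset X).sort (· ≤ ·)).flatMap (blockVar t i)

/-- The encoding of a suffix of a document that starts at position `i`. -/
noncomputable def nrefFrom {A X : Type*} [Fintype X] [LinearOrder X] (t : X → Set Span) :
    ℕ → List A → List (RefSym A X)
  | i, [] => block t i
  | i, a :: D => block t i ++ Sum.inl a :: nrefFrom t (i + 1) D

/-- The multiref-word that encodes the multispan-tuple `t` and the document `D`. -/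
noncomputable def nref {A X : Type*} [Fintype X] [LinearOrder X] (t : X → Set Span)
    (D : List A) : List (RefSym A X) :=
  nrefFrom t 1 D

/-! ### Extract-transform programs -/

/-- The output bag of the ET program `(E, T)` on `D`: one copy of `T (nref t D)` for every tuple
`t` extracted by `E` for which it is defined. -/
noncomputable def outputBag {A X O : Type*} [Fintype X] [LinearOrder X] (E : Multispanner A X)
    (T : List (RefSym A X) → Option (List O)) (D : List A) : Multiset (List O) :=
  (E.finite D).toFinset.val.filterMap (fun t => T (nref t D))

/-- Assignments: partial functions from registers to strings of registers and letters. -/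
abbrev Assignment (R O : Type*) := R → Option (List (R ⊕ O))

/-- Valuations: partial functions from registers to strings of letters. -/
abbrev Valuation (R O : Type*) := R → Option (List O)

/-- The extension of a valuation to strings of registers and letters. -/
def Valuation.eval {R O : Type*} (ν : Valuation R O) : List (R ⊕ O) → Option (List O)
  | [] => some []
  | Sum.inl r :: s => (ν r).bind fun u => (eval ν s).map fun v => u ++ v
  | Sum.inr o :: s => (eval ν s).map fun v => o :: v

/-- The composition `ν ∘ σ`. -/
def Valuation.comp {R O : Type*} (ν : Valuation R O) (σ : Assignment R O) : Valuation R O :=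
  fun r => (σ r).bind ν.eval

open Classical in
/-- Every register occurs at most once in all the strings of the assignment together. -/
def Assignment.Copyless {R O : Type*} [Fintype R] (σ : Assignment R O) : Prop :=
  ∀ r : R, ∑ r' : R, ((σ r').getD []).count (Sum.inl r) ≤ 1

open Classical in
/-- Deterministic streaming string transducers. -/
structure DSST (B O : Type*) where
  Q : Type
  R : Type
  [finQ : Fintype Q]
  [finR : Fintype R]
  /-- the transition function -/
  δ : Q → B → Option (Assignment R O × Q)
  copyless : ∀ q b σ q', δ q b = some (σ, q') → σ.Copyless
  /-- the initial state -/
  q₀ : Q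
  /-- the final function -/
  F : Q → Option (List (R ⊕ O))
  final_copyless : ∀ q s, F q = some s → ∀ r : R, s.count (Sum.inl r) ≤ 1

/-- The configuration reached from `(q, ν)` by the run over a string, if there is one. -/
def DSST.run {B O : Type*} (M : DSST B O) :
    M.Q → Valuation M.R O → List B → Option (M.Q × Valuation M.R O)
  | q, ν, [] => some (q, ν)
  | q, ν, b :: w => (M.δ q b).bind fun p => M.run p.2 (ν.comp p.1) w

/-- The string-to-string function of a DSST. -/
def DSST.fn {B O : Type*} (M : DSST B O) (w : List B) : Option (List O) :=
  (M.run M.q₀ (fun _ => some []) w).bind fun p => (M.F p.1).bind p.2.eval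

/-- The linear polyregular functions, modelled by deterministic streaming string transducers. -/
def IsLinearPolyregular {B O : Type*} (T : List B → Option (List O)) : Prop :=
  ∃ M : DSST B O, ∀ w, T w = M.fn w

/-- `(E, T)` is a linear ET program. -/
def IsLinearET {A X O : Type*} (E : Multispanner A X)
    (T : List (RefSym A X) → Option (List O)) : Prop :=
  E.IsRegex ∧ IsLinearPolyregular T

/-! ### Random access machines

Registers `0, 1, 2, …` hold integers and register `0` is the accumulator; there are a read-only
input tape and a write-only output tape.  Every executed instruction costs one time unit. -/

/-- Operands: a constant, the content of a register, indirect addressing. -/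
inductive Operand where
  | const (z : ℤ)
  | reg (i : ℕ)
  | ind (i : ℕ)

inductive Instr where
  | load (a : Operand)
  | store (a : Operand)
  | add (a : Operand)
  | sub (a : Operand)
  | read (a : Operand)
  | write (a : Operand)
  | jump (l : ℕ)
  | jgtz (l : ℕ)
  | jzero (l : ℕ)
  | halt

abbrev Program := List Instr

structure Config where
  /-- the program counter -/
  pc : ℕ
  /-- the memory -/
  mem : ℕ → ℤ
  /-- the unread part of the input tape -/
  inp : List ℤ
  /-- what has been written on the output tape -/
  out : List ℤ

/-- The address that an operand refers to; a constant has none, and a negative address is an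
error. -/
def Operand.addr (m : ℕ → ℤ) : Operand → Option ℕ
  | .const _ => none
  | .reg i => some i
  | .ind i => if 0 ≤ m i then some (m i).toNat else none

/-- The value of an operand. -/
def Operand.val (m : ℕ → ℤ) : Operand → Option ℤ
  | .const z => some z
  | .reg i => some (m i)
  | .ind i => if 0 ≤ m i then some (m (m i).toNat) else none

/-- The effect of one instruction; `none` for `halt` and for errors. Beyond its end, the input
tape holds the end marker `0`. -/
def Instr.exec (c : Config) : Instr → Option Config
  | .load a => (a.val c.mem).map fun v =>
      { c with pc := c.pc + 1, mem := Function.update c.mem 0 v }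
  | .store a => (a.addr c.mem).map fun i =>
      { c with pc := c.pc + 1, mem := Function.update c.mem i (c.mem 0) }
  | .add a => (a.val c.mem).map fun v =>
      { c with pc := c.pc + 1, mem := Function.update c.mem 0 (c.mem 0 + v) }
  | .sub a => (a.val c.mem).map fun v =>
      { c with pc := c.pc + 1, mem := Function.update c.mem 0 (c.mem 0 - v) }
  | .read a => (a.addr c.mem).map fun i =>
      { c with
        pc := c.pc + 1
        mem := Function.update c.mem i (c.inp.headD 0)
        inp := c.inp.tail }
  | .write a => (a.val c.mem).map fun v =>
      { c with pc := c.pc + 1, out := c.out ++ [v] }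
  | .jump l => some { c with pc := l }
  | .jgtz l => some { c with pc := if 0 < c.mem 0 then l else c.pc + 1 }
  | .jzero l => some { c with pc := if c.mem 0 = 0 then l else c.pc + 1 }
  | .halt => none

/-- One step of the program `P`. -/
def Program.step (P : Program) (c : Config) : Option Config :=
  (P[c.pc]?).bind (Instr.exec c)

/-- `n` steps of the program `P`. -/
def Program.steps (P : Program) : ℕ → Config → Option Config
  | 0, c => some c
  | n + 1, c => (P.step c).bind (P.steps n)

/-- The machine has halted properly. -/
def Program.Halted (P : Program) (c : Config) : Prop := P[c.pc]? = some Instr.halt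

/-- Started in configuration `c`, the program `P` writes the words of the given list in this
order, each followed by the end marker `0`, and then halts. The time from `c`, or from the end
marker of the previous word, to the end marker of a word `w` is at most `k * (|w| + 1)`, and the
time after the last end marker is at most `k`. -/
inductive Program.Enumerates (P : Program) (k : ℕ) : Config → List (List ℤ) → Prop
  | nil {c c' : Config} {n : ℕ} (hn : n ≤ k) (hs : P.steps n c = some c')
      (hout : c'.out = c.out) (hh : P.Halted c') : Enumerates P k c []
  | cons {c c₁ c₂ : Config} {n : ℕ} {w : List ℤ} {ws : List (List ℤ)}
      (hn : n + 1 ≤ k * (w.length + 1))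
      (hs : P.steps n c = some c₁) (hout₁ : c₁.out = c.out ++ w)
      (hs₂ : P.step c₁ = some c₂) (hout₂ : c₂.out = c₁.out ++ [0])
      (hw : Enumerates P k c₂ ws) : Enumerates P k c (w :: ws)

/-- The problem of enumerating the bag `f D` on input `D` admits a RAM algorithm with linear
preprocessing and output-linear delay: whatever nonzero integers encode the letters, there are a
program `pre` that on input `D` halts within `k * (|D| + 1)` steps without any output, and a
program `enum` that, started on the memory content that `pre` has left behind, enumerates the
elements of the bag `f D` with output-linear delay. -/
def AdmitsLinearEnumeration {A O : Type*} (f : List A → Multiset (List O)) : Prop :=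
  ∀ (codeA : A → ℤ) (codeO : O → ℤ),
    Function.Injective codeA → (∀ a, codeA a ≠ 0) →
    Function.Injective codeO → (∀ o, codeO o ≠ 0) →
    ∃ (pre enum : Program) (k : ℕ), ∀ D : List A,
      ∃ (n : ℕ) (c : Config) (ws : List (List O)),
        n ≤ k * (D.length + 1) ∧
        pre.steps n ⟨0, fun _ => 0, D.map codeA, []⟩ = some c ∧
        pre.Halted c ∧ c.out = [] ∧
        (ws : Multiset (List O)) = f D ∧
        enum.Enumerates k ⟨0, c.mem, [], []⟩ (ws.map (List.map codeO))

end ET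

/-!
A tuple `t` over `D` is determined by its flags, i.e. by the brackets of `nref t D` at every
position. A powerset construction decides position by position which sequences of flags come from
a tuple in `E(D)`, so the output bag consists of the outputs of a copyless transducer that chooses
the flags of every position, each sequence of choices contributing at most one output.

To get a delay that is linear in the output, a run should not contain more steps than letters in its
output. Guessing which registers will be used in the rest of the run and postponing assignments that
move registers without adding letters, one obtains a finite automaton that emits a label only for
an assignment with a letter that ends up in the output. The preprocessing builds, from the last
letter to the first, a representation of all runs of this automaton in which common suffixes are
shared and every unlabelled part of a run is skipped. The enumeration traverses this representation
with a stack, and by copylessness, expanding the registers along the labels of a run takes time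
linear in the number of labels and letters.
-/

namespace ET

open Function (update update_self update_of_ne)

/-! ### A list-processing language and its compilation to random access machines -/

/-- The values of the list-processing language: integers and pairs. -/
inductive Val where
  | atom (z : ℤ)
  | cell (a b : Val)

/-- The value can be told apart from the integer `z` by a machine: pairs are represented by
positive addresses, so a pair is only known to differ from `0`. -/
def Val.Differs : Val → ℤ → Prop
  | .atom y, z => y ≠ z
  | .cell _ _, z => z = 0

/-- The commands of the list-processing language over the variables `V`. In `cons`, `car`, `cdr`,
`const`, `move` and `read`, the first argument is the variable assigned to. -/
inductive Cmd (V : Type*) where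
  | skip
  | cons (d a b : V)
  | car (d a : V)
  | cdr (d a : V)
  | const (d : V) (z : ℤ)
  | move (d a : V)
  | read (d : V)
  | write (a : V)
  | seq (c₁ c₂ : Cmd V)
  /-- if the value of `a` is the integer `z`, then `c₁`, else `c₂` -/
  | ite (a : V) (z : ℤ) (c₁ c₂ : Cmd V)
  /-- while the value of `a` is not `0` -/
  | loop (a : V) (c : Cmd V)

/-- The states of the list-processing language: the values of the variables and the unread
input. -/
abbrev CState (V : Type*) := (V → Val) × List ℤ

/-- The big-step semantics of commands: `Exec c s w t s'` says that `c` turns the state `s` into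
`s'` in time `t` and writes `w`. -/
inductive Exec {V : Type*} [DecidableEq V] : Cmd V → CState V → List ℤ → ℕ → CState V → Prop
  | skip (s) : Exec .skip s [] 0 s
  | cons (d a b σ i) : Exec (.cons d a b) (σ, i) [] 1 (update σ d (.cell (σ a) (σ b)), i)
  | car {d a σ x y} (i) (h : σ a = .cell x y) : Exec (.car d a) (σ, i) [] 1 (update σ d x, i)
  | cdr {d a σ x y} (i) (h : σ a = .cell x y) : Exec (.cdr d a) (σ, i) [] 1 (update σ d y, i)
  | const (d z σ i) : Exec (.const d z) (σ, i) [] 1 (update σ d (.atom z), i)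
  | move (d a σ i) : Exec (.move d a) (σ, i) [] 1 (update σ d (σ a), i)
  | read (d σ i) : Exec (.read d) (σ, i) [] 1 (update σ d (.atom (i.headD 0)), i.tail)
  | write {a σ z} (i) (h : σ a = .atom z) : Exec (.write a) (σ, i) [z] 1 (σ, i)
  | seq {c₁ c₂ s w t s' w' t' s''} (h₁ : Exec c₁ s w t s') (h₂ : Exec c₂ s' w' t' s'') :
      Exec (.seq c₁ c₂) s (w ++ w') (t + t') s''
  | ite_eq {a z c₁ c₂ w t s'} {s : CState V} (h : s.1 a = .atom z) (h₁ : Exec c₁ s w t s') :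
      Exec (.ite a z c₁ c₂) s w (t + 1) s'
  | ite_ne {a z c₁ c₂ w t s'} {s : CState V} (h : (s.1 a).Differs z) (h₂ : Exec c₂ s w t s') :
      Exec (.ite a z c₁ c₂) s w (t + 1) s'
  | loop_done {a c} {s : CState V} (h : s.1 a = .atom 0) : Exec (.loop a c) s [] 1 s
  | loop_step {a c w t s' w' t' s''} {s : CState V} (h : (s.1 a).Differs 0)
      (h₁ : Exec c s w t s') (h₂ : Exec (.loop a c) s' w' t' s'') :
      Exec (.loop a c) s (w ++ w') (t + t' + 1) s''

/-- The length of the machine code of a command. -/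
def Cmd.len {V : Type*} : Cmd V → ℕ
  | .skip => 0
  | .cons _ _ _ => 12
  | .car _ _ => 2
  | .cdr _ _ => 5
  | .const _ _ => 2
  | .move _ _ => 2
  | .read _ => 1
  | .write _ => 1
  | .seq c₁ c₂ => c₁.len + c₂.len
  | .ite _ _ c₁ c₂ => c₁.len + c₂.len + 4
  | .loop _ c => c.len + 3

/-- The machine code of a command, placed at address `l`. The variable `v` lives in register
`2 * κ v + 5`, the `k`-th cell of the heap (`0 < k`) in the registers `4 * k` and `4 * k + 2`;
register `1` points to the last allocated cell and register `3` is used for address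
computations. -/
def Cmd.code {V : Type*} (κ : V → ℕ) : Cmd V → ℕ → Program
  | .skip, _ => []
  | .cons d a b, _ =>
      [.load (.reg 1), .add (.const 4), .store (.reg 1), .load (.reg (2 * κ a + 5)),
       .store (.ind 1), .load (.reg 1), .add (.const 2), .store (.reg 3),
       .load (.reg (2 * κ b + 5)), .store (.ind 3), .load (.reg 1), .store (.reg (2 * κ d + 5))]
  | .car d a, _ => [.load (.ind (2 * κ a + 5)), .store (.reg (2 * κ d + 5))]
  | .cdr d a, _ =>
      [.load (.reg (2 * κ a + 5)), .add (.const 2), .store (.reg 3), .load (.ind 3),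
       .store (.reg (2 * κ d + 5))]
  | .const d z, _ => [.load (.const z), .store (.reg (2 * κ d + 5))]
  | .move d a, _ => [.load (.reg (2 * κ a + 5)), .store (.reg (2 * κ d + 5))]
  | .read d, _ => [.read (.reg (2 * κ d + 5))]
  | .write a, _ => [.write (.reg (2 * κ a + 5))]
  | .seq c₁ c₂, l => c₁.code κ l ++ c₂.code κ (l + c₁.len)
  | .ite a z c₁ c₂, l =>
      [.load (.reg (2 * κ a + 5)), .sub (.const z), .jzero (l + 3 + c₂.len + 1)] ++
      (c₂.code κ (l + 3) ++ ([.jump (l + 3 + c₂.len + 1 + c₁.len)] ++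
        c₁.code κ (l + 3 + c₂.len + 1)))
  | .loop a c, l =>
      [.load (.reg (2 * κ a + 5)), .jzero (l + 3 + c.len)] ++
      (c.code κ (l + 2) ++ [.jump l])

@[simp]
theorem Cmd.length_code {V : Type*} (κ : V → ℕ) (c : Cmd V) (l : ℕ) :
    (c.code κ l).length = c.len := by
  induction c generalizing l with
  | skip | cons | car | cdr | const | move | read | write => rfl
  | seq c₁ c₂ ih₁ ih₂ => simp [Cmd.code, Cmd.len, ih₁, ih₂]
  | ite a z c₁ c₂ ih₁ ih₂ =>
    simp only [Cmd.code, Cmd.len, List.length_append, List.length_cons, List.length_nil, ih₁, ih₂]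
    omega
  | loop a c ih =>
    simp only [Cmd.code, Cmd.len, List.length_append, List.length_cons, List.length_nil, ih]
    omega

/-- The instructions `is` are found in the program `P` at address `l`. -/
def Program.At (P : Program) (l : ℕ) (is : List Instr) : Prop :=
  ∃ p q, P = p ++ is ++ q ∧ p.length = l

section Steps

variable {P : Program} {l : ℕ} {is is' : List Instr} {x : Instr}

theorem Program.At.left (h : P.At l (is ++ is')) : P.At l is := by
  obtain ⟨p, q, rfl, rfl⟩ := h
  exact ⟨p, is' ++ q, by simp, rfl⟩

theorem Program.At.right (h : P.At l (is ++ is')) : P.At (l + is.length) is' := by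
  obtain ⟨p, q, rfl, rfl⟩ := h
  exact ⟨p ++ is, q, by simp, by simp⟩

theorem Program.At.head (h : P.At l (x :: is)) : P[l]? = some x := by
  obtain ⟨p, q, rfl, rfl⟩ := h
  simp

theorem Program.At.tail (h : P.At l (x :: is)) : P.At (l + 1) is :=
  Program.At.right (is := [x]) h

theorem Program.steps_trans {m n : ℕ} {c d e : Config} (h₁ : P.steps m c = some d)
    (h₂ : P.steps n d = some e) : P.steps (m + n) c = some e := by
  induction m generalizing c with
  | zero =>
    obtain rfl : c = d := Option.some.inj h₁
    rwa [Nat.zero_add]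
  | succ m ih =>
    obtain ⟨b, hb, h₁⟩ := Option.bind_eq_some_iff.1 h₁
    rw [Nat.succ_add, Program.steps, hb]
    exact ih h₁

variable {m : ℕ → ℤ} {inp out : List ℤ} {n r k : ℕ} {v z : ℤ} {c d : Config}

theorem Program.steps_succ (h : P.At l (x :: is)) (hx : x.exec ⟨l, m, inp, out⟩ = some d)
    (hd : P.At (l + 1) is → P.steps n d = some c) :
    P.steps (n + 1) ⟨l, m, inp, out⟩ = some c := by
  rw [Program.steps, Program.step, h.head, Option.bind_some, hx, Option.bind_some, hd h.tail]

theorem Program.steps_load_const (h : P.At l (.load (.const z) :: is))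
    (hc : P.At (l + 1) is → P.steps n ⟨l + 1, update m 0 z, inp, out⟩ = some c) :
    P.steps (n + 1) ⟨l, m, inp, out⟩ = some c :=
  Program.steps_succ h rfl hc

theorem Program.steps_load_reg (h : P.At l (.load (.reg r) :: is)) (hv : m r = v)
    (hc : P.At (l + 1) is → P.steps n ⟨l + 1, update m 0 v, inp, out⟩ = some c) :
    P.steps (n + 1) ⟨l, m, inp, out⟩ = some c :=
  Program.steps_succ h (by simp [Instr.exec, Operand.val, hv]) hc

theorem Program.steps_load_ind (h : P.At l (.load (.ind r) :: is)) (hk : m r = k)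
    (hc : P.At (l + 1) is → P.steps n ⟨l + 1, update m 0 (m k), inp, out⟩ = some c) :
    P.steps (n + 1) ⟨l, m, inp, out⟩ = some c :=
  Program.steps_succ h (by simp [Instr.exec, Operand.val, hk]) hc

theorem Program.steps_add_const (h : P.At l (.add (.const z) :: is)) (hv : m 0 + z = v)
    (hc : P.At (l + 1) is → P.steps n ⟨l + 1, update m 0 v, inp, out⟩ = some c) :
    P.steps (n + 1) ⟨l, m, inp, out⟩ = some c :=
  Program.steps_succ h (by simp [Instr.exec, Operand.val, hv]) hc

theorem Program.steps_sub_const (h : P.At l (.sub (.const z) :: is)) (hv : m 0 - z = v)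
    (hc : P.At (l + 1) is → P.steps n ⟨l + 1, update m 0 v, inp, out⟩ = some c) :
    P.steps (n + 1) ⟨l, m, inp, out⟩ = some c :=
  Program.steps_succ h (by simp [Instr.exec, Operand.val, hv]) hc

theorem Program.steps_store_reg (h : P.At l (.store (.reg r) :: is)) (hv : m 0 = v)
    (hc : P.At (l + 1) is → P.steps n ⟨l + 1, update m r v, inp, out⟩ = some c) :
    P.steps (n + 1) ⟨l, m, inp, out⟩ = some c :=
  Program.steps_succ h (by simp [Instr.exec, Operand.addr, hv]) hc

theorem Program.steps_store_ind (h : P.At l (.store (.ind r) :: is)) (hk : m r = k) (hv : m 0 = v)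
    (hc : P.At (l + 1) is → P.steps n ⟨l + 1, update m k v, inp, out⟩ = some c) :
    P.steps (n + 1) ⟨l, m, inp, out⟩ = some c :=
  Program.steps_succ h (by simp [Instr.exec, Operand.addr, hk, hv]) hc

theorem Instr.exec_write_reg (hv : m r = v) :
    Instr.exec ⟨l, m, inp, out⟩ (.write (.reg r)) = some ⟨l + 1, m, inp, out ++ [v]⟩ := by
  simp [Instr.exec, Operand.val, hv]

theorem Program.steps_jump (h : P.At l (.jump r :: is)) :
    P.steps 1 ⟨l, m, inp, out⟩ = some ⟨r, m, inp, out⟩ :=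
  Program.steps_succ h rfl fun _ => rfl

theorem Program.steps_jzero (h : P.At l (.jzero r :: is)) :
    P.steps 1 ⟨l, m, inp, out⟩ = some ⟨if m 0 = 0 then r else l + 1, m, inp, out⟩ :=
  Program.steps_succ h rfl fun _ => rfl

end Steps

/-- The integer `z` represents the value in a memory with `h` allocated cells. -/
def Val.Rep (m : ℕ → ℤ) (h : ℕ) : Val → ℤ → Prop
  | .atom y, z => z = y
  | .cell a b, z => ∃ k : ℕ, 0 < k ∧ k ≤ h ∧ z = (4 * k : ℕ) ∧
      a.Rep m h (m (4 * k)) ∧ b.Rep m h (m (4 * k + 2))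

theorem Val.Rep.mono {m m' : ℕ → ℤ} {h h' : ℕ} {v : Val} {z : ℤ} (hv : v.Rep m h z)
    (hm : ∀ k, 0 < k → k ≤ h → m' (4 * k) = m (4 * k) ∧ m' (4 * k + 2) = m (4 * k + 2))
    (hh : h ≤ h') : v.Rep m' h' z := by
  induction v generalizing z with
  | atom y => exact hv
  | cell a b iha ihb =>
    obtain ⟨k, hk, hkh, hz, ha, hb⟩ := hv
    obtain ⟨hma, hmb⟩ := hm k hk hkh
    exact ⟨k, hk, hkh.trans hh, hz, hma ▸ iha ha, hmb ▸ ihb hb⟩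

theorem Val.Rep.ne {m : ℕ → ℤ} {h : ℕ} {v : Val} {y z : ℤ} (hv : v.Rep m h y)
    (hz : v.Differs z) : y ≠ z := by
  cases v with
  | atom x =>
    rw [show y = x from hv]
    exact hz
  | cell a b =>
    obtain ⟨k, hk, -, rfl, -⟩ := hv
    rw [show z = 0 from hz]
    omega

/-- The memory `m` represents the values `σ` of the variables. -/
def Simulates {V : Type*} (κ : V → ℕ) (σ : V → Val) (m : ℕ → ℤ) : Prop :=
  ∃ h : ℕ, m 1 = (4 * h : ℕ) ∧ ∀ v, (σ v).Rep m h (m (2 * κ v + 5))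

section Simulation

variable {V : Type*} {κ : V → ℕ} {σ : V → Val} {m m' : ℕ → ℤ} {h : ℕ} {a b d : V} {z : ℤ}

theorem Simulates.eq_of_atom (hs : Simulates κ σ m) (ha : σ a = .atom z) :
    m (2 * κ a + 5) = z := by
  obtain ⟨h, -, hs⟩ := hs
  have hrep := hs a
  rwa [ha] at hrep

theorem Simulates.ne_of_differs (hs : Simulates κ σ m) (ha : (σ a).Differs z) :
    m (2 * κ a + 5) ≠ z := by
  obtain ⟨h, -, hs⟩ := hs
  exact (hs a).ne ha

theorem Simulates.of_eq_of_ne_zero (hs : Simulates κ σ m) (hm : ∀ k, k ≠ 0 → m' k = m k) :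
    Simulates κ σ m' := by
  obtain ⟨h, h1, h2⟩ := hs
  refine ⟨h, by rw [hm _ one_ne_zero, h1], fun v => ?_⟩
  rw [hm _ (by omega)]
  exact (h2 v).mono (fun k hk _ => ⟨hm _ (by omega), hm _ (by omega)⟩) le_rfl

variable [DecidableEq V]

theorem Simulates.update (hκ : κ.Injective) {h' : ℕ} (hh : h ≤ h') (h1 : m' 1 = (4 * h' : ℕ))
    (hs : ∀ v, (σ v).Rep m h (m (2 * κ v + 5)))
    (hm : ∀ k, 0 < k → k ≤ h → m' (4 * k) = m (4 * k) ∧ m' (4 * k + 2) = m (4 * k + 2))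
    (hd : ∀ k, k ≠ κ d → m' (2 * k + 5) = m (2 * k + 5)) {x : Val}
    (hx : x.Rep m' h' (m' (2 * κ d + 5))) : Simulates κ (update σ d x) m' := by
  refine ⟨h', h1, fun v => ?_⟩
  by_cases hvd : v = d
  · subst hvd
    rwa [update_self]
  · rw [update_of_ne hvd, hd _ (hκ.ne hvd)]
    exact (hs v).mono hm hh

theorem Simulates.store (hκ : κ.Injective) (h1 : m 1 = (4 * h : ℕ))
    (hs : ∀ v, (σ v).Rep m h (m (2 * κ v + 5))) {x : Val} (hx : x.Rep m h z)
    (hz : m' (2 * κ d + 5) = z) (hm : ∀ k, k ≠ 0 → k ≠ 3 → k ≠ 2 * κ d + 5 → m' k = m k) :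
    Simulates κ (Function.update σ d x) m' := by
  have hm' : ∀ k, 0 < k → k ≤ h → m' (4 * k) = m (4 * k) ∧ m' (4 * k + 2) = m (4 * k + 2) :=
    fun k hk _ => ⟨hm _ (by omega) (by omega) (by omega), hm _ (by omega) (by omega) (by omega)⟩
  refine Simulates.update hκ le_rfl ?_ hs hm' ?_ ?_
  · rw [hm _ (by omega) (by omega) (by omega), h1]
  · exact fun k hk => hm _ (by omega) (by omega) (by omega)
  · rw [hz]
    exact hx.mono hm' le_rfl

theorem Simulates.alloc (hκ : κ.Injective) (hs : ∀ v, (σ v).Rep m h (m (2 * κ v + 5)))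
    (h1 : m' 1 = (4 * (h + 1) : ℕ)) (hd : m' (2 * κ d + 5) = (4 * (h + 1) : ℕ))
    (ha : m' (4 * (h + 1)) = m (2 * κ a + 5)) (hb : m' (4 * (h + 1) + 2) = m (2 * κ b + 5))
    (hm : ∀ k, k ≠ 0 → k ≠ 1 → k ≠ 3 → k ≠ 4 * (h + 1) → k ≠ 4 * (h + 1) + 2 →
      k ≠ 2 * κ d + 5 → m' k = m k) :
    Simulates κ (Function.update σ d (.cell (σ a) (σ b))) m' := by
  have hm' : ∀ k, 0 < k → k ≤ h → m' (4 * k) = m (4 * k) ∧ m' (4 * k + 2) = m (4 * k + 2) :=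
    fun k _ _ => ⟨by apply hm <;> omega, by apply hm <;> omega⟩
  refine Simulates.update hκ (Nat.le_succ h) h1 hs hm' (fun k hk => by apply hm <;> omega) ?_
  refine ⟨h + 1, by omega, le_rfl, hd, ?_, ?_⟩
  · rw [ha]
    exact (hs a).mono hm' (Nat.le_succ h)
  · rw [hb]
    exact (hs b).mono hm' (Nat.le_succ h)

end Simulation

/-- In at most `N` steps and writing `w`, the program `P` gets from address `l`, in any memory that
represents the state `s`, to address `l'`, in a memory that represents `s'`. -/
def Program.Reaches (P : Program) {V : Type*} (κ : V → ℕ) (N l : ℕ) (s : CState V) (w : List ℤ)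
    (l' : ℕ) (s' : CState V) : Prop :=
  ∀ m out, Simulates κ s.1 m → ∃ n m', n ≤ N ∧
    P.steps n ⟨l, m, s.2, out⟩ = some ⟨l', m', s'.2, out ++ w⟩ ∧ Simulates κ s'.1 m'

namespace Program.Reaches

variable {V : Type*} {κ : V → ℕ} {P : Program} {N N' l l' l'' r : ℕ} {s s' s'' : CState V}
  {w w' : List ℤ} {is : List Instr} {a b d : V} {z : ℤ} {σ : V → Val} {i : List ℤ}

theorem refl (l : ℕ) (s : CState V) : P.Reaches κ 0 l s [] l s := fun m out hs =>
  ⟨0, m, le_rfl, by rw [List.append_nil, Program.steps], hs⟩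

theorem mono (h : P.Reaches κ N l s w l' s') (hN : N ≤ N') : P.Reaches κ N' l s w l' s' :=
  fun m out hs =>
    let ⟨n, m', hn, e, hs'⟩ := h m out hs
    ⟨n, m', hn.trans hN, e, hs'⟩

theorem trans (h : P.Reaches κ N l s w l' s') (h' : P.Reaches κ N' l' s' w' l'' s'') :
    P.Reaches κ (N + N') l s (w ++ w') l'' s'' := by
  intro m out hs
  obtain ⟨n, m', hn, e, hs'⟩ := h m out hs
  obtain ⟨n', m'', hn', e', hs''⟩ := h' m' (out ++ w) hs'
  exact ⟨n + n', m'', Nat.add_le_add hn hn', List.append_assoc out w w' ▸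
    Program.steps_trans e e', hs''⟩

theorem jump (hP : P.At l (.jump r :: is)) : P.Reaches κ 1 l s [] r s := fun m out hs =>
  ⟨1, m, le_rfl, by rw [List.append_nil, Program.steps_jump hP], hs⟩

theorem write (h : σ a = .atom z) (hP : P.At l (.write (.reg (2 * κ a + 5)) :: is)) :
    P.Reaches κ 1 l (σ, i) [z] (l + 1) (σ, i) := fun m _ hs =>
  ⟨1, m, le_rfl, Program.steps_succ hP (Instr.exec_write_reg (hs.eq_of_atom h)) fun _ => rfl, hs⟩

theorem jump_of_eq_zero (h : s.1 a = .atom 0)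
    (hP : P.At l (.load (.reg (2 * κ a + 5)) :: .jzero r :: is)) :
    P.Reaches κ 2 l s [] r s := fun m out hs => by
  refine ⟨2, Function.update m 0 0, le_rfl, ?_, hs.of_eq_of_ne_zero fun k hk => update_of_ne hk ..⟩
  refine Program.steps_load_reg hP (hs.eq_of_atom h) fun hP => ?_
  rw [Program.steps_jzero hP, update_self, if_pos rfl, List.append_nil]

theorem next_of_ne_zero (h : (s.1 a).Differs 0)
    (hP : P.At l (.load (.reg (2 * κ a + 5)) :: .jzero r :: is)) :
    P.Reaches κ 2 l s [] (l + 2) s := fun m out hs => by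
  refine ⟨2, update m 0 (m (2 * κ a + 5)), le_rfl, Program.steps_load_reg hP rfl fun hP => ?_,
    hs.of_eq_of_ne_zero fun k hk => update_of_ne hk ..⟩
  rw [Program.steps_jzero hP, update_self, if_neg (hs.ne_of_differs h), List.append_nil]

theorem jump_of_eq (h : s.1 a = .atom z)
    (hP : P.At l (.load (.reg (2 * κ a + 5)) :: .sub (.const z) :: .jzero r :: is)) :
    P.Reaches κ 3 l s [] r s := fun m out hs => by
  refine ⟨3, update (update m 0 z) 0 0, le_rfl, ?_, hs.of_eq_of_ne_zero fun k hk => by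
    rw [update_of_ne hk, update_of_ne hk]⟩
  refine Program.steps_load_reg hP (hs.eq_of_atom h) fun hP => ?_
  refine Program.steps_sub_const hP (by rw [update_self, sub_self]) fun hP => ?_
  rw [Program.steps_jzero hP, update_self, if_pos rfl, List.append_nil]

theorem next_of_ne (h : (s.1 a).Differs z)
    (hP : P.At l (.load (.reg (2 * κ a + 5)) :: .sub (.const z) :: .jzero r :: is)) :
    P.Reaches κ 3 l s [] (l + 3) s := fun m out hs => by
  have hne : m (2 * κ a + 5) - z ≠ 0 := sub_ne_zero.2 (hs.ne_of_differs h)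
  refine ⟨3, update (update m 0 (m (2 * κ a + 5))) 0 (m (2 * κ a + 5) - z), le_rfl, ?_,
    hs.of_eq_of_ne_zero fun k hk => by rw [update_of_ne hk, update_of_ne hk]⟩
  refine Program.steps_load_reg hP rfl fun hP => ?_
  refine Program.steps_sub_const hP (by rw [update_self]) fun hP => ?_
  rw [Program.steps_jzero hP, update_self, if_neg hne, List.append_nil]

variable [DecidableEq V]

theorem cons (hκ : κ.Injective) (hP : P.At l (Cmd.code κ (.cons d a b) l)) :
    P.Reaches κ 12 l (σ, i) [] (l + 12) (update σ d (.cell (σ a) (σ b)), i) := by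
  rintro m out ⟨h, h1, hs⟩
  refine ⟨12, ?m', le_rfl, ?steps, ?sim⟩
  case steps =>
    refine Program.steps_load_reg hP h1 fun hP => ?_
    refine Program.steps_add_const (v := (4 * (h + 1) : ℕ)) hP
      (by rw [update_self]; push_cast; ring) fun hP => ?_
    refine Program.steps_store_reg hP (update_self ..) fun hP => ?_
    refine Program.steps_load_reg (v := m (2 * κ a + 5)) hP
      (by simp (disch := omega) only [update_of_ne]) fun hP => ?_
    refine Program.steps_store_ind (k := 4 * (h + 1)) hP
      (by simp (disch := omega) only [update_of_ne, update_self]) (update_self ..) fun hP => ?_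
    refine Program.steps_load_reg (v := (4 * (h + 1) : ℕ)) hP
      (by simp (disch := omega) only [update_of_ne, update_self]) fun hP => ?_
    refine Program.steps_add_const (v := (4 * (h + 1) + 2 : ℕ)) hP (by simp) fun hP => ?_
    refine Program.steps_store_reg hP (update_self ..) fun hP => ?_
    refine Program.steps_load_reg (v := m (2 * κ b + 5)) hP
      (by simp (disch := omega) only [update_of_ne]) fun hP => ?_
    refine Program.steps_store_ind (k := 4 * (h + 1) + 2) hP
      (by simp (disch := omega) only [update_of_ne, update_self]) (update_self ..) fun hP => ?_
    refine Program.steps_load_reg (v := (4 * (h + 1) : ℕ)) hP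
      (by simp (disch := omega) only [update_of_ne, update_self]) fun hP => ?_
    refine Program.steps_store_reg hP (update_self ..) fun _ => ?_
    rw [Program.steps, List.append_nil]
  case sim =>
    apply Simulates.alloc hκ hs
    case hm =>
      intros
      simp (disch := assumption) only [update_of_ne]
    all_goals simp (disch := omega) only [update_of_ne, update_self]

theorem car (hκ : κ.Injective) {x y : Val} (h : σ a = .cell x y)
    (hP : P.At l (Cmd.code κ (.car d a) l)) :
    P.Reaches κ 2 l (σ, i) [] (l + 2) (update σ d x, i) := by
  rintro m out ⟨_, h1, hs⟩
  have hrep := hs a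
  simp only [h] at hrep
  obtain ⟨k, -, -, hz, hx, -⟩ := hrep
  refine ⟨2, update (update m 0 (m (4 * k))) (2 * κ d + 5) (m (4 * k)), le_rfl, ?_,
    Simulates.store hκ h1 hs hx (update_self ..) fun j h0 _ h5 => by
      rw [update_of_ne h5, update_of_ne h0]⟩
  refine Program.steps_load_ind hP hz fun hP => ?_
  refine Program.steps_store_reg hP (update_self ..) fun _ => ?_
  rw [Program.steps, List.append_nil]

theorem cdr (hκ : κ.Injective) {x y : Val} (h : σ a = .cell x y)
    (hP : P.At l (Cmd.code κ (.cdr d a) l)) :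
    P.Reaches κ 5 l (σ, i) [] (l + 5) (update σ d y, i) := by
  rintro m out ⟨_, h1, hs⟩
  have hrep := hs a
  simp only [h] at hrep
  obtain ⟨k, -, -, hz, -, hy⟩ := hrep
  refine ⟨5, ?m', le_rfl, ?steps, ?sim⟩
  case steps =>
    refine Program.steps_load_reg hP hz fun hP => ?_
    refine Program.steps_add_const (v := (4 * k + 2 : ℕ)) hP (by simp) fun hP => ?_
    refine Program.steps_store_reg hP (update_self ..) fun hP => ?_
    refine Program.steps_load_ind (k := 4 * k + 2) hP (update_self ..) fun hP => ?_
    refine Program.steps_store_reg hP (update_self ..) fun _ => ?_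
    rw [Program.steps, List.append_nil]
  case sim =>
    refine Simulates.store hκ h1 hs hy ?_ fun j _ _ _ => ?_
    · simp (disch := omega) only [update_of_ne, update_self]
    · simp (disch := assumption) only [update_of_ne]

theorem const (hκ : κ.Injective) (hP : P.At l (Cmd.code κ (.const d z) l)) :
    P.Reaches κ 2 l (σ, i) [] (l + 2) (update σ d (.atom z), i) := by
  rintro m out ⟨_, h1, hs⟩
  refine ⟨2, update (update m 0 z) (2 * κ d + 5) z, le_rfl, ?_,
    Simulates.store hκ h1 hs rfl (update_self ..) fun j h0 _ h5 => by
      rw [update_of_ne h5, update_of_ne h0]⟩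
  refine Program.steps_load_const hP fun hP => ?_
  refine Program.steps_store_reg hP (update_self ..) fun _ => ?_
  rw [Program.steps, List.append_nil]

theorem move (hκ : κ.Injective) (hP : P.At l (Cmd.code κ (.move d a) l)) :
    P.Reaches κ 2 l (σ, i) [] (l + 2) (update σ d (σ a), i) := by
  rintro m out ⟨_, h1, hs⟩
  refine ⟨2, update (update m 0 (m (2 * κ a + 5))) (2 * κ d + 5) (m (2 * κ a + 5)), le_rfl, ?_,
    Simulates.store hκ h1 hs (hs a) (update_self ..) fun j h0 _ h5 => by
      rw [update_of_ne h5, update_of_ne h0]⟩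
  refine Program.steps_load_reg hP rfl fun hP => ?_
  refine Program.steps_store_reg hP (update_self ..) fun _ => ?_
  rw [Program.steps, List.append_nil]

theorem read (hκ : κ.Injective) (hP : P.At l (Cmd.code κ (.read d) l)) :
    P.Reaches κ 1 l (σ, i) [] (l + 1) (update σ d (.atom (i.headD 0)), i.tail) := by
  rintro m out ⟨_, h1, hs⟩
  refine ⟨1, update m (2 * κ d + 5) (i.headD 0), le_rfl, ?_,
    Simulates.store hκ h1 hs rfl (update_self ..) fun j _ _ h5 => update_of_ne h5 ..⟩
  refine Program.steps_succ hP rfl fun _ => ?_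
  rw [Program.steps, List.append_nil]

end Program.Reaches

section Compilation

variable {V : Type*} [DecidableEq V] {κ : V → ℕ} {P : Program} {l : ℕ}

theorem Exec.reaches (hκ : κ.Injective) {c : Cmd V} {s s' : CState V} {w : List ℤ} {t : ℕ}
    (h : Exec c s w t s') :
    ∀ {l}, P.At l (c.code κ l) → P.Reaches κ (12 * t) l s w (l + c.len) s' := by
  induction h with
  | skip s => exact fun _ => .refl _ s
  | cons d a b σ i => exact fun hP => .cons hκ hP
  | car i h => exact fun hP => (Program.Reaches.car hκ h hP).mono (by omega)
  | cdr i h => exact fun hP => (Program.Reaches.cdr hκ h hP).mono (by omega)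
  | const d z σ i => exact fun hP => (Program.Reaches.const hκ hP).mono (by omega)
  | move d a σ i => exact fun hP => (Program.Reaches.move hκ hP).mono (by omega)
  | read d σ i => exact fun hP => (Program.Reaches.read hκ hP).mono (by omega)
  | write i h => exact fun hP => (Program.Reaches.write h hP).mono (by omega)
  | @seq c₁ c₂ s w t s' w' t' s'' _ _ ih₁ ih₂ =>
    intro l hP
    have hP₂ := hP.right
    rw [Cmd.length_code] at hP₂
    rw [mul_add, Cmd.len, ← add_assoc]
    exact (ih₁ hP.left).trans (ih₂ hP₂)
  | @ite_eq a z c₁ c₂ w t s' s h _ ih =>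
    intro l hP
    have hP₁ := hP.right.right.right
    simp only [Cmd.length_code, List.length_cons, List.length_nil, zero_add] at hP₁
    rw [show l + (Cmd.ite a z c₁ c₂).len = l + 3 + c₂.len + 1 + c₁.len by rw [Cmd.len]; omega]
    exact ((Program.Reaches.jump_of_eq h hP).trans (ih hP₁)).mono (by omega)
  | @ite_ne a z c₁ c₂ w t s' s h _ ih =>
    intro l hP
    have hP₂ := hP.right.left
    have hjump := hP.right.right.left
    simp only [Cmd.length_code, List.length_cons, List.length_nil, zero_add] at hP₂ hjump
    rw [show l + (Cmd.ite a z c₁ c₂).len = l + 3 + c₂.len + 1 + c₁.len by rw [Cmd.len]; omega,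
      ← List.append_nil w]
    exact (((Program.Reaches.next_of_ne h hP).trans (ih hP₂)).trans (.jump hjump)).mono
      (by omega)
  | @loop_done a c s h =>
    intro l hP
    rw [show l + (Cmd.loop a c).len = l + 3 + c.len by rw [Cmd.len]; omega]
    exact (Program.Reaches.jump_of_eq_zero h hP).mono (by omega)
  | @loop_step a c w t s' w' t' s'' s h _ _ ih₁ ih₂ =>
    intro l hP
    have hbody := hP.right.left
    have hjump := hP.right.right
    simp only [Cmd.length_code, List.length_cons, List.length_nil, zero_add] at hbody hjump
    rw [← List.append_nil w]
    exact ((((Program.Reaches.next_of_ne_zero h hP).trans (ih₁ hbody)).trans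
      (.jump hjump)).trans (ih₂ hP)).mono (by omega)

/-- Started in the given state, the loop with control variable `a` and body `seq c (write z)` writes
the words of the list, each followed by `0`, where `c` takes time linear in the length of the
word. -/
inductive EnumLoop (a : V) (c : Cmd V) (z : V) (k : ℕ) : CState V → List (List ℤ) → Prop
  | done {s : CState V} (h : s.1 a = .atom 0) : EnumLoop a c z k s []
  | step {s s' : CState V} {w : List ℤ} {ws : List (List ℤ)} {t : ℕ} (h : (s.1 a).Differs 0)
      (hc : Exec c s w t s') (ht : t ≤ k * (w.length + 1)) (hz : s'.1 z = .atom 0)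
      (hs : EnumLoop a c z k s' ws) : EnumLoop a c z k s (w :: ws)

/- The first word is also charged with the `j` steps that lead from `d` to the loop; in the
induction they are the jump back after the previous end marker. -/
theorem EnumLoop.enumerates (hκ : κ.Injective) {a z : V} {c : Cmd V} {k : ℕ} {s : CState V}
    {ws : List (List ℤ)} (h : EnumLoop a c z k s ws) {J : ℕ} (hJ : 1 ≤ J)
    (hP : P.At l (Cmd.code κ (.loop a (.seq c (.write z))) l ++ [.halt])) {d : Config} {j : ℕ}
    {m : ℕ → ℤ} (hj : j ≤ J) (hd : P.steps j d = some ⟨l, m, s.2, d.out⟩)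
    (hm : Simulates κ s.1 m) : P.Enumerates (12 * k + J + 12) d ws := by
  have hhalt := hP.right.head
  rw [Cmd.length_code] at hhalt
  have hloop := hP.left
  have hbody := hloop.right.left.left
  have hwrite := hloop.right.left.right
  have hback := hloop.right.right
  simp only [Cmd.length_code, List.length_cons, List.length_nil, zero_add] at hbody hwrite hback
  induction h generalizing d j m with
  | @done s h =>
    obtain ⟨n, m', hn, e, hm'⟩ :=
      (Exec.loop_done (c := .seq c (.write z)) h).reaches hκ hloop m d.out hm
    rw [List.append_nil] at e
    exact .nil (by omega) (Program.steps_trans hd e) rfl hhalt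
  | @step s s' w ws t h hc ht hz _ ih =>
    obtain ⟨n, m', hn, e, hm'⟩ :=
      ((Program.Reaches.next_of_ne_zero h hloop).trans (hc.reaches hκ hbody)) m d.out hm
    have hmark : P.step ⟨l + 2 + c.len, m', s'.2, d.out ++ w⟩ =
        some ⟨l + 2 + c.len + 1, m', s'.2, d.out ++ w ++ [0]⟩ := by
      rw [Program.step, hwrite.head, Option.bind_some,
        Instr.exec_write_reg (hm'.eq_of_atom hz)]
    refine .cons ?_ (Program.steps_trans hd e) rfl hmark rfl
      (ih hJ (Program.steps_jump hback) hm')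
    calc j + n + 1 ≤ 12 * (k * (w.length + 1)) + (J + 12) := by omega
      _ ≤ 12 * (k * (w.length + 1)) + (J + 12) * (w.length + 1) :=
        Nat.add_le_add_left (Nat.le_mul_of_pos_right _ (Nat.succ_pos _)) _
      _ = (12 * k + J + 12) * (w.length + 1) := by ring

/-- An enumeration algorithm in the list-processing language: a preprocessing command, an
initialization of the enumeration phase, and a loop, controlled by `flag`, whose body writes one
word; the variable `zero` supplies the end marker. -/
structure EnumScheme (V : Type*) where
  pre : Cmd V
  setup : Cmd V
  body : Cmd V
  flag : V
  zero : V

/-- On the given input, the scheme enumerates the given words with linear preprocessing and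
output-linear delay, with the constant `k`. -/
def EnumScheme.Enumerates (S : EnumScheme V) (k : ℕ) (inp : List ℤ) (ws : List (List ℤ)) : Prop :=
  ∃ (t t' : ℕ) (σ : V → Val) (i : List ℤ) (s : CState V),
    t ≤ k * (inp.length + 1) ∧ t' ≤ k ∧ Exec S.pre (fun _ => .atom 0, inp) [] t (σ, i) ∧
      Exec S.setup (σ, []) [] t' s ∧ EnumLoop S.flag S.body S.zero k s ws

end Compilation

theorem admitsLinearEnumeration_of_enumScheme {A O : Type*} {f : List A → Multiset (List O)}
    (H : ∀ (codeA : A → ℤ) (codeO : O → ℤ), codeA.Injective → (∀ a, codeA a ≠ 0) →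
      (∀ o, codeO o ≠ 0) →
      ∃ (V : Type*) (_ : DecidableEq V) (_ : Countable V) (S : EnumScheme V) (k : ℕ),
        ∀ D, ∃ ws : List (List O), (ws : Multiset (List O)) = f D ∧
          S.Enumerates k (D.map codeA) (ws.map (List.map codeO))) :
    AdmitsLinearEnumeration f := by
  intro codeA codeO hA hA0 _ hO0
  obtain ⟨V, _, _, S, k, H⟩ := H codeA codeO hA hA0 hO0
  obtain ⟨κ, hκ⟩ := exists_injective_nat V
  let loop : Cmd V := .loop S.flag (.seq S.body (.write S.zero))
  let pre : Program := S.pre.code κ 0 ++ [.halt]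
  let enum : Program := S.setup.code κ 0 ++ (loop.code κ S.setup.len ++ [.halt])
  have hpre : pre.At 0 pre := ⟨[], [], by simp, rfl⟩
  have henum : enum.At 0 enum := ⟨[], [], by simp, rfl⟩
  have hloop : enum.At S.setup.len (loop.code κ S.setup.len ++ [.halt]) := by
    simpa only [Cmd.length_code, zero_add] using henum.right
  have hzero : Simulates κ (fun _ => .atom 0) (fun _ => 0) := ⟨0, rfl, fun v => rfl⟩
  refine ⟨pre, enum, 12 * k + (12 * k + 1) + 12, fun D => ?_⟩
  obtain ⟨ws, hws, t, t', σ, i, s, ht, ht', epre, einit, hL⟩ := H D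
  obtain ⟨n, m, hn, e, hm⟩ := epre.reaches hκ hpre.left _ [] hzero
  obtain ⟨n', m', hn', e', hm'⟩ := einit.reaches hκ henum.left m [] hm
  rw [zero_add] at e e'
  refine ⟨n, _, ws, ?_, e, ?_, rfl, hws,
    hL.enumerates hκ (Nat.le_add_left 1 (12 * k)) hloop (by omega) e' hm'⟩
  · rw [List.length_map] at ht
    calc n ≤ 12 * t := hn
      _ ≤ 12 * (k * (D.length + 1)) := Nat.mul_le_mul_left 12 ht
      _ = 12 * k * (D.length + 1) := by ring
      _ ≤ _ := Nat.mul_le_mul_right _ (by omega)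
  · have hhalt := hpre.right.head
    rwa [Cmd.length_code, zero_add] at hhalt

section Ensures

variable {V : Type*} {α : Type*}

/-- The command `f x` for every `x` in the list. -/
def Cmd.forEach (f : α → Cmd V) : List α → Cmd V
  | [] => .skip
  | x :: l => .seq (f x) (forEach f l)

/-- The command `f x` for the `x` in the list whose code is the value of the variable `a`. -/
def Cmd.switch (a : V) (code : α → ℤ) (f : α → Cmd V) : List α → Cmd V
  | [] => .skip
  | x :: l => .ite a (code x) (f x) (switch a code f l)

/-- Commands without loops, whose running time is bounded independently of the state. -/
def Cmd.LoopFree : Cmd V → Prop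
  | .seq c₁ c₂ => c₁.LoopFree ∧ c₂.LoopFree
  | .ite _ _ c₁ c₂ => c₁.LoopFree ∧ c₂.LoopFree
  | .loop _ _ => False
  | _ => True

theorem Cmd.loopFree_forEach {f : α → Cmd V} {l : List α} (hf : ∀ x, (f x).LoopFree) :
    (Cmd.forEach f l).LoopFree := by
  induction l with
  | nil => trivial
  | cons x l ih => exact ⟨hf x, ih⟩

theorem Cmd.loopFree_switch {a : V} {code : α → ℤ} {f : α → Cmd V} {l : List α}
    (hf : ∀ x, (f x).LoopFree) : (Cmd.switch a code f l).LoopFree := by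
  induction l with
  | nil => trivial
  | cons x l ih => exact ⟨hf x, ih⟩

/-- A bound for the running time of a loop-free command. -/
def Cmd.bound : Cmd V → ℕ
  | .seq c₁ c₂ => c₁.bound + c₂.bound
  | .ite _ _ c₁ c₂ => c₁.bound + c₂.bound + 1
  | _ => 1

variable [DecidableEq V]

theorem Exec.le_bound {c : Cmd V} {s s' : CState V} {w : List ℤ} {t : ℕ} (h : Exec c s w t s')
    (hc : c.LoopFree) : t ≤ c.bound := by
  induction h with
  | seq _ _ ih₁ ih₂ => exact Nat.add_le_add (ih₁ hc.1) (ih₂ hc.2)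
  | ite_eq _ _ ih => exact Nat.succ_le_succ ((ih hc.1).trans (Nat.le_add_right ..))
  | ite_ne _ _ ih => exact Nat.succ_le_succ ((ih hc.2).trans (Nat.le_add_left ..))
  | loop_done => exact hc.elim
  | loop_step => exact hc.elim
  | skip => exact zero_le_one
  | _ => exact le_rfl

theorem Exec.andThen {c₁ c₂ : Cmd V} {s s' s'' : CState V} {w : List ℤ} {t t' : ℕ}
    (h₁ : Exec c₁ s [] t s') (h₂ : Exec c₂ s' w t' s'') : Exec (.seq c₁ c₂) s w (t + t') s'' :=
  Exec.seq h₁ h₂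

/-- Started with the values `σ` of the variables and without input, the command halts after writing
`w`, and the final values of the variables satisfy `Q`. -/
def Cmd.Ensures (c : Cmd V) (σ : V → Val) (w : List ℤ) (Q : (V → Val) → Prop) : Prop :=
  ∃ t σ', Exec c (σ, []) w t (σ', []) ∧ Q σ'

namespace Cmd.Ensures

variable {c c₁ c₂ : Cmd V} {σ : V → Val} {w : List ℤ} {Q Q' : (V → Val) → Prop} {a b d : V}
  {x y : Val} {z : ℤ}

theorem mono (h : c.Ensures σ w Q) (hQ : ∀ σ', Q σ' → Q' σ') : c.Ensures σ w Q' :=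
  let ⟨t, σ', e, h⟩ := h
  ⟨t, σ', e, hQ σ' h⟩

theorem skip (h : Q σ) : Cmd.skip.Ensures σ [] Q :=
  ⟨_, σ, .skip _, h⟩

theorem cons (h : Q (update σ d (.cell (σ a) (σ b)))) : (Cmd.cons d a b).Ensures σ [] Q :=
  ⟨_, _, .cons .., h⟩

theorem car (ha : σ a = .cell x y) (h : Q (update σ d x)) : (Cmd.car d a).Ensures σ [] Q :=
  ⟨_, _, .car _ ha, h⟩

theorem cdr (ha : σ a = .cell x y) (h : Q (update σ d y)) : (Cmd.cdr d a).Ensures σ [] Q :=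
  ⟨_, _, .cdr _ ha, h⟩

theorem const (h : Q (update σ d (.atom z))) : (Cmd.const d z).Ensures σ [] Q :=
  ⟨_, _, .const .., h⟩

theorem move (h : Q (update σ d (σ a))) : (Cmd.move d a).Ensures σ [] Q :=
  ⟨_, _, .move .., h⟩

theorem write (ha : σ a = .atom z) (h : Q σ) : (Cmd.write a).Ensures σ [z] Q :=
  ⟨_, _, .write _ ha, h⟩

theorem seq (h : c₁.Ensures σ [] fun σ' => c₂.Ensures σ' w Q) : (Cmd.seq c₁ c₂).Ensures σ w Q :=
  let ⟨_, _, e₁, _, σ', e₂, hQ⟩ := h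
  ⟨_, σ', e₁.andThen e₂, hQ⟩

theorem ite_eq (ha : σ a = .atom z) (h : c₁.Ensures σ w Q) : (Cmd.ite a z c₁ c₂).Ensures σ w Q :=
  let ⟨_, σ', e, hQ⟩ := h
  ⟨_, σ', .ite_eq ha e, hQ⟩

theorem ite_ne (ha : (σ a).Differs z) (h : c₂.Ensures σ w Q) :
    (Cmd.ite a z c₁ c₂).Ensures σ w Q :=
  let ⟨_, σ', e, hQ⟩ := h
  ⟨_, σ', .ite_ne ha e, hQ⟩

theorem forEach {f : α → Cmd V} {I : List α → (V → Val) → Prop}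
    (hf : ∀ l x σ, I l σ → (f x).Ensures σ [] (I (l ++ [x]))) (l : List α) (h : I [] σ) :
    (Cmd.forEach f l).Ensures σ [] (I l) := by
  suffices ∀ l₀ σ, I l₀ σ → (Cmd.forEach f l).Ensures σ [] (I (l₀ ++ l)) from this [] σ h
  induction l with
  | nil => exact fun l₀ σ h => .skip (by rwa [List.append_nil])
  | cons x l ih =>
    refine fun l₀ σ h => .seq ((hf l₀ x σ h).mono fun σ' h' => ?_)
    simpa only [List.append_assoc, List.singleton_append] using ih (l₀ ++ [x]) σ' h'

theorem switch {code : α → ℤ} (hcode : code.Injective) {f : α → Cmd V} {l : List α} {x : α}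
    (hx : x ∈ l) (ha : σ a = .atom (code x)) (h : (f x).Ensures σ w Q) :
    (Cmd.switch a code f l).Ensures σ w Q := by
  induction l with
  | nil => exact (List.not_mem_nil hx).elim
  | cons y l ih =>
    by_cases hxy : x = y
    · subst hxy
      exact .ite_eq ha h
    · refine .ite_ne ?_ (ih ((List.mem_cons.1 hx).resolve_left hxy))
      rw [ha]
      exact hcode.ne hxy

end Cmd.Ensures

end Ensures

/-- The list with the given entries. -/
def Val.ofList : List Val → Val
  | [] => .atom 0
  | v :: l => .cell v (ofList l)

/-- The positive number that represents an element of a finite type in the memory. -/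
noncomputable def symbolCode {α : Type*} [Fintype α] (x : α) : ℤ :=
  (Fintype.equivFin α x : ℕ) + 1

theorem symbolCode_injective {α : Type*} [Fintype α] :
    (symbolCode : α → ℤ).Injective := fun _ _ h =>
  (Fintype.equivFin α).injective (Fin.ext (Int.ofNat.inj (add_right_cancel h)))

theorem symbolCode_ne_zero {α : Type*} [Fintype α] (x : α) : symbolCode x ≠ 0 := by
  unfold symbolCode
  omega

/-! ### Runs of labelled automata and their representation in memory -/

/-- The variables of the enumeration algorithm for an automaton with states `S`: the bags of runs
from every state, over the suffix of the document that has been processed and over the suffix that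
is one letter longer; registers, and variables for intermediate results. -/
inductive Var (S : Type*) where
  | bag (s : S)
  | newBag (s : S)
  | reg (i : Fin 7)
  | temp (i : Fin 5)

namespace Var

variable {S : Type*}

open Classical in
noncomputable instance : DecidableEq (Var S) := fun _ _ => inferInstance

instance [Countable S] : Countable (Var S) := by
  let f : Var S → (S ⊕ S) ⊕ (Fin 7 ⊕ Fin 5)
    | bag s => .inl (.inl s)
    | newBag s => .inl (.inr s)
    | reg i => .inr (.inl i)
    | temp i => .inr (.inr i)
  refine Function.Injective.countable (f := f) fun v v' h => ?_
  cases v <;> cases v' <;> simp_all [f]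

/-- The register whose value is always `0`. -/
abbrev nil : Var S := reg 0
/-- The list of the unprocessed letters of the document, last letter first. -/
abbrev doc : Var S := reg 1
/-- The stack of pending alternatives. -/
abbrev stack : Var S := reg 2
/-- The labels of the current run, last label first. -/
abbrev hist : Var S := reg 3
/-- The event at which the current run continues. -/
abbrev event : Var S := reg 4
/-- The symbol that the next case distinction is about. -/
abbrev tag : Var S := reg 5
/-- The stack of symbols to be written or expanded. -/
abbrev todo : Var S := reg 6

end Var

/-- Only temporary variables and variables in `X` may have changed their value. -/
def AgreeOff {S : Type*} (X : Set (Var S)) (σ σ' : Var S → Val) : Prop :=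
  ∀ v, v ∉ X → (∀ i, v ≠ .temp i) → σ' v = σ v

namespace AgreeOff

variable {S : Type*} {X Y : Set (Var S)} {σ σ' σ'' : Var S → Val}

theorem refl (X : Set (Var S)) (σ : Var S → Val) : AgreeOff X σ σ := fun _ _ _ => rfl

theorem trans (h : AgreeOff X σ σ') (h' : AgreeOff X σ' σ'') : AgreeOff X σ σ'' :=
  fun v hv hv' => (h' v hv hv').trans (h v hv hv')

theorem mono (h : AgreeOff X σ σ') (hXY : X ⊆ Y) : AgreeOff Y σ σ' :=
  fun v hv => h v fun hX => hv (hXY hX)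

theorem update {v : Var S} (hv : v ∈ X) (x : Val) : AgreeOff X σ (update σ v x) :=
  fun _ hv' _ => update_of_ne (by rintro rfl; exact hv' hv) ..

theorem update_temp (i : Fin 5) (x : Val) : AgreeOff X σ (Function.update σ (.temp i) x) :=
  fun _ _ hv' => update_of_ne (hv' i) ..

theorem reg (h : AgreeOff X σ σ') {i : Fin 7} (hi : .reg i ∉ X) : σ' (.reg i) = σ (.reg i) :=
  h _ hi fun _ => nofun

end AgreeOff

/-- Nondeterministic automata whose transitions may carry a label in `Λ` and that accept with a
final symbol in `F`. A run yields the list of its labels and its final symbol. -/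
structure LabelledAutomaton (A S Λ F : Type*) where
  step : S → A → List (Option Λ × S)
  final : S → List F

/-- The bag of the runs from a state over a word. -/
def LabelledAutomaton.runs {A S Λ F : Type*} (M : LabelledAutomaton A S Λ F) :
    S → List A → Multiset (List Λ × F)
  | s, [] => ((M.final s).map fun f => (([] : List Λ), f) : List (List Λ × F))
  | s, a :: D =>
    ((M.step s a).map fun p => (M.runs p.2 D).map fun q => (p.1.toList ++ q.1, q.2)).sum

/-- The two kinds of values that represent nonempty resp. arbitrary lists of runs. -/
inductive Kind where
  | event
  | forest

section Representation

variable {A S Λ F : Type*} [Fintype Λ] [Fintype F]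

/-- The representation of lists of runs. Common suffixes are shared, and the time to reach the first
label of the first run is bounded: an event consists of the common first label of some runs, or of
the final symbol of a run without labels, and a forest is a binary tree of events. -/
inductive Enc : Kind → Val → List (List Λ × F) → Prop
  | leaf (f : F) : Enc .event (.cell (.atom 0) (.atom (symbolCode f))) [([], f)]
  | label {e c : Val} {M N : List (List Λ × F)} (l : Λ) (he : Enc .event e M)
      (hc : Enc .forest c N) :
      Enc .event (.cell (.atom (symbolCode l)) (.cell e c)) ((M ++ N).map fun q => (l :: q.1, q.2))
  | nil : Enc .forest (.atom 0) []
  | node {e c d : Val} {M N K : List (List Λ × F)} (he : Enc .event e M) (hc : Enc .forest c N)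
      (hd : Enc .forest d K) : Enc .forest (.cell e (.cell c d)) (M ++ N ++ K)

/-- A bag of runs is represented by `0`, if it is empty, or else by an event and a forest. -/
inductive EncBag : Val → Multiset (List Λ × F) → Prop
  | zero : EncBag (.atom 0) 0
  | cell {e c : Val} {M N : List (List Λ × F)} (he : Enc .event e M) (hc : Enc .forest c N) :
      EncBag (.cell e c) ((M ++ N : List (List Λ × F)) : Multiset (List Λ × F))

/-- Add the bag in `g` to the bag in `acc`. -/
def Cmd.addBag (acc g : Var S) : Cmd (Var S) :=
  .ite g 0 .skip <| .ite acc 0 (.move acc g) <|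
    .seq (.car (.temp 0) acc) <| .seq (.cdr (.temp 1) acc) <| .seq (.car (.temp 2) g) <|
    .seq (.cdr (.temp 3) g) <| .seq (.cons (.temp 3) (.temp 3) (.temp 1)) <|
    .seq (.cons (.temp 3) (.temp 2) (.temp 3)) <| .cons acc (.temp 0) (.temp 3)

theorem Cmd.loopFree_addBag (acc g : Var S) : (Cmd.addBag acc g).LoopFree := by
  simp [Cmd.addBag, Cmd.LoopFree]

theorem Cmd.ensures_addBag {acc g : Var S} (hacc : ∀ i, acc ≠ .temp i)
    (hg : ∀ i, i ≠ 4 → g ≠ .temp i) {σ : Var S → Val} {M N : Multiset (List Λ × F)}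
    (hM : EncBag (σ acc) M) (hN : EncBag (σ g) N) :
    (Cmd.addBag acc g).Ensures σ [] fun σ' => EncBag (σ' acc) (M + N) ∧ AgreeOff {acc} σ σ' := by
  generalize hv : σ acc = v at hM
  generalize hu : σ g = u at hN
  cases hN with
  | zero => exact .ite_eq hu <| .skip ⟨by rwa [add_zero, hv], .refl _ _⟩
  | @cell e₂ c₂ N₁ N₂ he₂ hc₂ =>
    have hbag : EncBag (.cell e₂ c₂) ((N₁ ++ N₂ : List (List Λ × F)) : Multiset (List Λ × F)) :=
      .cell he₂ hc₂
    refine .ite_ne (by rw [hu]; rfl) ?_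
    cases hM with
    | zero =>
      refine .ite_eq hv <| .move ⟨?_, .update (Set.mem_singleton _) _⟩
      rwa [update_self, zero_add, hu]
    | @cell e₁ c₁ M₁ M₂ he₁ hc₁ =>
      refine .ite_ne (by rw [hv]; rfl) <| .seq <| .car hv <| .seq <|
        .cdr (x := e₁) (y := c₁) (by simp [hacc, hv]) <| .seq <|
        .car (x := e₂) (y := c₂) (by simp [hg, hu]) <| .seq <|
        .cdr (x := e₂) (y := c₂) (by simp [hg, hu]) <| .seq <| .cons <| .seq <| .cons <|
        .cons ⟨?_, ?_⟩
      · have hsum : ((M₁ ++ M₂ : List _) : Multiset (List Λ × F)) + (N₁ ++ N₂ : List _) =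
            (M₁ ++ (N₁ ++ N₂ ++ M₂) : List _) := by
          simp only [← Multiset.coe_add]
          abel
        simpa [hsum] using EncBag.cell he₁ (.node he₂ hc₂ hc₁)
      · intro v hv hv'
        have : v ≠ acc := hv
        simp [*]

variable (M : LabelledAutomaton A S Λ F)

/-- Add the runs that start with the given transition to the bag in `acc`. -/
noncomputable def Cmd.addTransition (acc : Var S) : Option Λ × S → Cmd (Var S)
  | (none, s) => .addBag acc (.bag s)
  | (some l, s) => .ite (.bag s) 0 .skip <| .seq (.const (.temp 4) (symbolCode l)) <|
      .seq (.cons (.temp 4) (.temp 4) (.bag s)) <| .seq (.cons (.temp 4) (.temp 4) .nil) <|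
      .addBag acc (.temp 4)

theorem Cmd.loopFree_addTransition (acc : Var S) (p : Option Λ × S) :
    (Cmd.addTransition acc p).LoopFree := by
  obtain ⟨_ | l, s⟩ := p <;> simp [Cmd.addTransition, Cmd.LoopFree, Cmd.loopFree_addBag]

/-- The bags of the runs over `D` are stored in the memory. -/
def LabelledAutomaton.Stored (σ : Var S → Val) (D : List A) : Prop :=
  σ .nil = .atom 0 ∧ ∀ s, EncBag (σ (.bag s)) (M.runs s D)

variable {M}

theorem LabelledAutomaton.Stored.congr {σ σ' : Var S → Val} {D : List A} (h : M.Stored σ D)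
    {X : Set (Var S)} (hσ : AgreeOff X σ σ') (h0 : Var.nil ∉ X) (hX : ∀ s, .bag s ∉ X) :
    M.Stored σ' D :=
  ⟨(hσ.reg h0).trans h.1, fun s => by rw [hσ _ (hX s) nofun]; exact h.2 s⟩

theorem Cmd.ensures_addTransition {s : S} {σ : Var S → Val} {D : List A} (hσ : M.Stored σ D)
    {N : Multiset (List Λ × F)} (hN : EncBag (σ (.newBag s)) N) (p : Option Λ × S) :
    (Cmd.addTransition (.newBag s) p).Ensures σ [] fun σ' =>
      EncBag (σ' (.newBag s)) (N + (M.runs p.2 D).map fun q => (p.1.toList ++ q.1, q.2)) ∧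
        AgreeOff {.newBag s} σ σ' := by
  obtain ⟨_ | l, s'⟩ := p
  · simpa [Cmd.addTransition] using Cmd.ensures_addBag (by simp) (by simp) hN (hσ.2 s')
  have hbag := hσ.2 s'
  generalize hv : σ (.bag s') = v at hbag
  generalize hR : M.runs s' D = R at hbag
  cases hbag with
  | zero => exact .ite_eq hv <| .skip ⟨by simpa using hN, .refl _ _⟩
  | cell he hc =>
    refine .ite_ne (by rw [hv]; rfl) <| .seq <| .const <| .seq <| .cons <| .seq <| .cons ?_
    refine (Cmd.ensures_addBag (M := N) (by simp) (fun i hi => by simpa using hi.symm)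
      (by simpa using hN) ?_).mono fun σ' h => ⟨h.1, .trans ?_ h.2⟩
    · simpa [hσ.1, hv] using EncBag.cell (Enc.label l he hc) .nil
    · exact ((AgreeOff.update_temp 4 _).trans (.update_temp 4 _)).trans (.update_temp 4 _)

variable (M)

/-- Compute the bag of the runs that start in a state and read a letter before the processed suffix
of the document. -/
noncomputable def Cmd.computeBag (a : A) (s : S) : Cmd (Var S) :=
  .seq (.const (.newBag s) 0) (.forEach (.addTransition (.newBag s)) (M.step s a))

variable {M}

omit [Fintype F] in
theorem Cmd.loopFree_computeBag (a : A) (s : S) : (Cmd.computeBag M a s).LoopFree :=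
  ⟨trivial, Cmd.loopFree_forEach (Cmd.loopFree_addTransition _)⟩

theorem Cmd.ensures_computeBag {σ : Var S → Val} {D : List A} (hσ : M.Stored σ D) (a : A) (s : S) :
    (Cmd.computeBag M a s).Ensures σ [] fun σ' =>
      EncBag (σ' (.newBag s)) (M.runs s (a :: D)) ∧ AgreeOff {.newBag s} σ σ' := by
  refine .seq <| .const <| .forEach (I := fun (l : List (Option Λ × S)) σ' =>
    EncBag (σ' (.newBag s))
    (l.map fun p => (M.runs p.2 D).map fun q => (p.1.toList ++ q.1, q.2)).sum ∧
    AgreeOff {.newBag s} σ σ') ?_ _ ⟨by simpa using EncBag.zero, .update (Set.mem_singleton _) _⟩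
  rintro l p σ' ⟨hl, hagree⟩
  refine (Cmd.ensures_addTransition (hσ.congr hagree (by simp) (by simp)) hl p).mono
    fun σ'' h => ⟨?_, hagree.trans h.2⟩
  simpa using h.1

variable [Fintype S]

variable (M) in
/-- Prepend a letter to the processed suffix of the document. -/
noncomputable def Cmd.prependLetter (a : A) : Cmd (Var S) :=
  .seq (.forEach (.computeBag M a) Finset.univ.toList)
    (.forEach (fun s => .move (.bag s) (.newBag s)) Finset.univ.toList)

omit [Fintype F] in
theorem Cmd.loopFree_prependLetter (a : A) : (Cmd.prependLetter M a).LoopFree := by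
  constructor <;> apply Cmd.loopFree_forEach
  exacts [Cmd.loopFree_computeBag a, fun _ => trivial]

theorem Cmd.ensures_prependLetter {σ : Var S → Val} {D : List A} (hσ : M.Stored σ D) (a : A) :
    (Cmd.prependLetter M a).Ensures σ [] fun σ' => M.Stored σ' (a :: D) ∧
      AgreeOff (Set.range .bag ∪ Set.range .newBag) σ σ' := by
  refine .seq <| (Cmd.Ensures.forEach (I := fun (l : List S) σ' => (∀ s ∈ l,
    EncBag (σ' (.newBag s)) (M.runs s (a :: D))) ∧ AgreeOff (Set.range .newBag) σ σ')
    ?_ Finset.univ.toList ⟨by simp, .refl _ _⟩).mono fun σ₁ h₁ => ?_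
  · rintro l s σ' ⟨hl, hagree⟩
    refine (Cmd.ensures_computeBag (hσ.congr hagree (by simp) (by simp)) a s).mono
      fun σ'' h => ⟨fun s' hs' => ?_, hagree.trans (h.2.mono (by simp))⟩
    by_cases hss' : s' = s
    · exact hss' ▸ h.1
    · rw [h.2 (Var.newBag s') (by simpa using hss') nofun]
      exact hl s' (by simpa [hss'] using hs')
  refine (Cmd.Ensures.forEach (I := fun (l : List S) σ' =>
    (∀ s ∈ l, σ' (.bag s) = σ₁ (.newBag s)) ∧ AgreeOff (Set.range .bag) σ₁ σ')
    ?_ _ ⟨by simp, .refl _ _⟩).mono fun σ₂ h₂ => ?_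
  · rintro l s σ' ⟨hl, hagree⟩
    refine .move ⟨fun s' hs' => ?_, hagree.trans (.update (Set.mem_range_self s) _)⟩
    by_cases hss' : s' = s
    · rw [hss', update_self, hagree (.newBag s) (by simp) nofun]
    · rw [update_of_ne (by simpa using hss')]
      exact hl s' (by simpa [hss'] using hs')
  · have hagree : AgreeOff (Set.range .bag ∪ Set.range .newBag) σ σ₂ :=
      (h₁.2.mono Set.subset_union_right).trans (h₂.2.mono Set.subset_union_left)
    refine ⟨⟨(hagree.reg (by simp)).trans hσ.1, fun s => ?_⟩, hagree⟩
    rw [h₂.1 s (by simp)]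
    exact h₁.1 s (by simp)

/-! ### Preprocessing -/

/-- Add the run without labels and with the given final symbol to the bag in `acc`. -/
noncomputable def Cmd.addFinal (acc : Var S) (f : F) : Cmd (Var S) :=
  .seq (.const (.temp 4) (symbolCode f)) <| .seq (.cons (.temp 4) .nil (.temp 4)) <|
    .seq (.cons (.temp 4) (.temp 4) .nil) <| .addBag acc (.temp 4)

omit [Fintype S] in
theorem Cmd.ensures_addFinal {s : S} {σ : Var S → Val} (h0 : σ .nil = .atom 0)
    {N : Multiset (List Λ × F)} (hN : EncBag (σ (.bag s)) N) (f : F) :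
    (Cmd.addFinal (.bag s) f).Ensures σ [] fun σ' =>
      EncBag (σ' (.bag s)) (N + {(([] : List Λ), f)}) ∧ AgreeOff {.bag s} σ σ' := by
  refine .seq <| .const <| .seq <| .cons <| .seq <| .cons ?_
  refine (Cmd.ensures_addBag (M := N) (by simp) (fun i hi => by simpa using hi.symm)
    (by simpa using hN) ?_).mono fun σ' h => ⟨h.1, .trans ?_ h.2⟩
  · simpa [h0] using EncBag.cell (Enc.leaf (Λ := Λ) f) .nil
  · exact ((AgreeOff.update_temp 4 _).trans (.update_temp 4 _)).trans (.update_temp 4 _)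

omit [Fintype S] in
theorem Cmd.ensures_addFinals {s : S} {σ : Var S → Val} (h0 : σ .nil = .atom 0)
    (hs : EncBag (σ (.bag s)) (0 : Multiset (List Λ × F))) (l : List F) :
    (Cmd.forEach (.addFinal (.bag s)) l).Ensures σ [] fun σ' =>
      EncBag (σ' (.bag s)) ((l.map fun f => ([], f) : List (List Λ × F)) : Multiset (List Λ × F)) ∧
        AgreeOff {.bag s} σ σ' := by
  refine .forEach (I := fun (l : List F) σ' =>
    EncBag (σ' (.bag s)) ((l.map fun f => ([], f) : List (List Λ × F)) : Multiset (List Λ × F)) ∧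
      AgreeOff {.bag s} σ σ') ?_ l ⟨by simpa using hs, .refl _ _⟩
  rintro l f σ' ⟨hl, hagree⟩
  refine (Cmd.ensures_addFinal ((hagree.reg (by simp)).trans h0) hl f).mono
    fun σ'' h => ⟨?_, hagree.trans h.2⟩
  simpa [← Multiset.coe_add] using h.1

variable (M)

/-- Compute the bags of the runs over the empty suffix of the document. -/
noncomputable def Cmd.computeFinals : Cmd (Var S) :=
  .forEach (fun s => .seq (.const (.bag s) 0) (.forEach (.addFinal (.bag s)) (M.final s)))
    Finset.univ.toList

omit [Fintype Λ] in
theorem Cmd.loopFree_computeFinals : (Cmd.computeFinals M).LoopFree := by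
  refine Cmd.loopFree_forEach fun s => ?_
  refine ⟨trivial, Cmd.loopFree_forEach fun f => ?_⟩
  exact ⟨trivial, trivial, trivial, Cmd.loopFree_addBag ..⟩

theorem Cmd.ensures_computeFinals {σ : Var S → Val} (h0 : σ .nil = .atom 0) :
    (Cmd.computeFinals M).Ensures σ [] fun σ' =>
      M.Stored σ' [] ∧ AgreeOff (Set.range .bag) σ σ' := by
  refine (Cmd.Ensures.forEach (I := fun (l : List S) σ' =>
    (∀ s ∈ l, EncBag (σ' (.bag s)) (M.runs s [])) ∧ AgreeOff (Set.range .bag) σ σ')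
    ?_ Finset.univ.toList ⟨by simp, .refl _ _⟩).mono fun σ' h =>
    ⟨⟨(h.2.reg (by simp)).trans h0, fun s => h.1 s (by simp)⟩, h.2⟩
  rintro l s σ₁ ⟨hl, hagree⟩
  refine .seq <| Cmd.Ensures.const <| (Cmd.ensures_addFinals (Λ := Λ) ?_ ?_ (M.final s)).mono
    fun σ' h => ?_
  · rw [update_of_ne (by simp), hagree.reg (by simp), h0]
  · simpa using EncBag.zero
  · have hagree' : AgreeOff {.bag s} σ₁ σ' := .trans (.update (Set.mem_singleton _) _) h.2
    refine ⟨fun s' hs' => ?_, hagree.trans (hagree'.mono (by simp))⟩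
    by_cases hss' : s' = s
    · exact hss' ▸ h.1
    · rw [hagree' (Var.bag s') (by simpa using hss') nofun]
      exact hl s' (by simpa [hss'] using hs')

/-- Read the document to a list. -/
def Cmd.readDoc : Cmd (Var S) :=
  .seq (.read .tag) (.loop .tag (.seq (.cons .doc .tag .doc) (.read .tag)))

omit [Fintype S] in
theorem Exec.readDoc_loop (D : List ℤ) (hD : ∀ z ∈ D, z ≠ 0) {σ : Var S → Val} {l : List ℤ}
    (hdoc : σ .doc = .ofList (l.map .atom)) (htag : σ .tag = .atom (D.headD 0)) :
    ∃ t σ', Exec (.loop .tag (.seq (.cons .doc .tag .doc) (.read .tag))) (σ, D.tail) [] t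
        (σ', []) ∧ t ≤ 3 * D.length + 1 ∧ σ' .doc = .ofList ((D.reverse ++ l).map .atom) ∧
      σ' .nil = σ .nil := by
  induction D generalizing σ l with
  | nil => exact ⟨_, σ, .loop_done htag, by simp, hdoc, rfl⟩
  | cons z D ih =>
    obtain ⟨t, σ', e, ht, hdoc', hnil⟩ := ih (fun z hz => hD z (List.mem_cons_of_mem _ hz))
      (σ := update (update σ .doc (.cell (σ .tag) (σ .doc))) .tag (.atom (D.headD 0)))
      (l := z :: l) (by simp [hdoc, htag, Val.ofList]) (by simp)
    refine ⟨_, σ', .loop_step ?_ (.andThen (.cons ..) (.read ..)) e, ?_, by simpa using hdoc',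
      by simpa using hnil⟩
    · simpa [htag, Val.Differs] using hD z List.mem_cons_self
    · rw [List.length_cons]
      omega

omit [Fintype S] in
theorem Exec.readDoc (D : List ℤ) (hD : ∀ z ∈ D, z ≠ 0) :
    ∃ t σ, Exec (.readDoc : Cmd (Var S)) (fun _ => .atom 0, D) [] t (σ, []) ∧
      t ≤ 3 * D.length + 2 ∧ σ .doc = .ofList (D.reverse.map .atom) ∧ σ .nil = .atom 0 := by
  obtain ⟨t, σ, e, ht, hdoc, hnil⟩ := Exec.readDoc_loop (S := S) D hD
    (σ := update (fun _ => .atom 0) .tag (.atom (D.headD 0))) (l := []) (by simp [Val.ofList])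
    (by simp)
  exact ⟨_, σ, .andThen (.read ..) e, by omega, by simpa using hdoc, by simpa using hnil⟩

variable [Fintype A] (codeA : A → ℤ)

/-- Process the last unprocessed letter of the document. -/
noncomputable def Cmd.processLetter : Cmd (Var S) :=
  .seq (.car .tag .doc) <| .seq (.cdr .doc .doc) <|
    .switch .tag codeA (.prependLetter M) Finset.univ.toList

omit [Fintype F] in
theorem Cmd.loopFree_processLetter : (Cmd.processLetter M codeA).LoopFree :=
  ⟨trivial, trivial, Cmd.loopFree_switch Cmd.loopFree_prependLetter⟩

variable {M codeA}

theorem Cmd.ensures_processLetter (hA : codeA.Injective) {a : A} {l : Val} {σ : Var S → Val}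
    {D : List A} (hσ : M.Stored σ D) (hdoc : σ .doc = .cell (.atom (codeA a)) l) :
    (Cmd.processLetter M codeA).Ensures σ [] fun σ' =>
      M.Stored σ' (a :: D) ∧ σ' .doc = l := by
  refine .seq <| .car hdoc <| .seq <| .cdr (x := .atom (codeA a)) (y := l) (by simpa using hdoc) <|
    .switch hA (Finset.mem_toList.2 (Finset.mem_univ a)) (by simp) ?_
  refine (Cmd.ensures_prependLetter (D := D) (hσ.congr (X := {.tag, .doc})
    (.trans (.update (by simp) _) (.update (by simp) _)) (by simp) (by simp)) a).mono
    fun σ' h => ⟨h.1, ?_⟩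
  rw [h.2.reg (by simp), update_self]

theorem Exec.processLetter_loop (hA : codeA.Injective) (l : List A) {σ : Var S → Val}
    {D : List A} (hσ : M.Stored σ D)
    (hdoc : σ .doc = .ofList (l.map fun a => .atom (codeA a))) :
    ∃ t σ', Exec (.loop .doc (.processLetter M codeA)) (σ, []) [] t (σ', []) ∧
      t ≤ ((Cmd.processLetter M codeA).bound + 1) * l.length + 1 ∧
      M.Stored σ' (l.reverse ++ D) := by
  induction l generalizing σ D with
  | nil => exact ⟨_, σ, .loop_done hdoc, by simp, by simpa using hσ⟩
  | cons a l ih =>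
    rw [List.map_cons, Val.ofList] at hdoc
    obtain ⟨t₁, σ₁, e₁, hσ₁, hdoc₁⟩ := Cmd.ensures_processLetter hA hσ hdoc
    obtain ⟨t₂, σ₂, e₂, ht₂, hσ₂⟩ := ih hσ₁ hdoc₁
    refine ⟨_, σ₂, .loop_step (show (σ .doc).Differs 0 by rw [hdoc]; rfl) e₁ e₂, ?_,
      by simpa using hσ₂⟩
    have ht₁ := e₁.le_bound (Cmd.loopFree_processLetter M codeA)
    rw [List.length_cons, mul_add]
    omega

variable (M codeA) in
/-- Compute the bags of the runs over the document. -/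
noncomputable def Cmd.preprocess : Cmd (Var S) :=
  .seq .readDoc <| .seq (.computeFinals M) <| .loop .doc (.processLetter M codeA)

variable (M) in
theorem Exec.preprocess (hA : codeA.Injective) (hA0 : ∀ a, codeA a ≠ 0) :
    ∃ k, ∀ D : List A, ∃ t σ,
      Exec (.preprocess M codeA) (fun _ => .atom 0, D.map codeA) [] t (σ, []) ∧
      t ≤ k * (D.length + 1) ∧ M.Stored σ D := by
  set b := (Cmd.processLetter M codeA).bound
  set b' := (Cmd.computeFinals M).bound
  refine ⟨b + 4 + b', fun D => ?_⟩
  obtain ⟨t₁, σ₁, e₁, ht₁, hdoc, h0⟩ := Exec.readDoc (S := S) (D.map codeA) (by simp [hA0])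
  obtain ⟨t₂, σ₂, e₂, hσ₂, hagree⟩ := Cmd.ensures_computeFinals M h0
  obtain ⟨t₃, σ₃, e₃, ht₃, hσ₃⟩ := Exec.processLetter_loop hA D.reverse hσ₂
    (by rw [hagree.reg (by simp), hdoc]; simp [← List.map_reverse, Function.comp_def])
  refine ⟨_, σ₃, .andThen e₁ (.andThen e₂ e₃), ?_, by simpa using hσ₃⟩
  have ht₂ : t₂ ≤ b' := e₂.le_bound (Cmd.loopFree_computeFinals M)
  rw [List.length_map] at ht₁
  rw [List.length_reverse] at ht₃
  calc t₁ + (t₂ + t₃)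
      ≤ 3 * D.length + 2 + (b' + ((b + 1) * D.length + 1)) := by gcongr
    _ ≤ (b + 4 + b') * (D.length + 1) := by nlinarith [Nat.zero_le (b' * D.length)]

end Representation

/-! ### Enumeration of the runs -/

section EnumerateRuns

variable {S Λ F : Type*} [Fintype Λ]

/-- The value that represents the labels of a part of a run. -/
noncomputable def Val.ofHist (h : List Λ) : Val :=
  .ofList (h.map fun l => .atom (symbolCode l))

/-- The run `q` preceded by the labels in `h`; all labels are listed in reverse order. -/
def afterHist (h : List Λ) (q : List Λ × F) : List Λ × F :=
  (q.1.reverse ++ h, q.2)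

omit [Fintype Λ] in
theorem afterHist_cons (h : List Λ) (l : Λ) (q : List Λ × F) :
    afterHist h (l :: q.1, q.2) = afterHist (l :: h) q := by
  simp [afterHist]

variable [Fintype F]

/-- The representation of the runs that are still to be enumerated by a stack of nonempty forests,
each with the labels that precede its runs. -/
inductive EncStack : Val → List (List Λ × F) → Prop
  | nil : EncStack (.atom 0) []
  | cons {c v : Val} {M L : List (List Λ × F)} (h : List Λ) (hc : Enc .forest c M)
      (hne : c.Differs 0) (hv : EncStack v L) :
      EncStack (.cell (.cell c (.ofHist h)) v) (M.map (afterHist h) ++ L)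

theorem Enc.exists_cell {v : Val} {M : List (List Λ × F)} (h : Enc .event v M) :
    ∃ x y, v = .cell x y := by
  cases h <;> exact ⟨_, _, rfl⟩

theorem Enc.eq_zero_or_differs {v : Val} {M : List (List Λ × F)} (h : Enc .forest v M) :
    (v = .atom 0 ∧ M = []) ∨ v.Differs 0 := by
  cases h with
  | nil => exact .inl ⟨rfl, rfl⟩
  | node => exact .inr rfl

/-- Push the forest in `a` on the stack of pending alternatives. -/
def Cmd.push (a : Var S) : Cmd (Var S) :=
  .ite a 0 .skip <| .seq (.cons a a .hist) (.cons .stack a .stack)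

theorem Cmd.ensures_push {i : Fin 5} {σ : Var S → Val} {M L : List (List Λ × F)} {h : List Λ}
    (hM : Enc .forest (σ (.temp i)) M) (hL : EncStack (σ .stack) L)
    (hh : σ .hist = .ofHist h) :
    (Cmd.push (.temp i)).Ensures σ [] fun σ' =>
      EncStack (σ' .stack) (M.map (afterHist h) ++ L) ∧ AgreeOff {.stack} σ σ' := by
  rcases hM.eq_zero_or_differs with ⟨h0, rfl⟩ | hne
  · exact .ite_eq h0 <| .skip ⟨hL, .refl _ _⟩
  · refine .ite_ne hne <| .seq <| .cons <| .cons
      ⟨?_, .trans (.update_temp i _) (.update (Set.mem_singleton _) _)⟩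
    simpa [hh] using EncStack.cons h hM hne hL

/-- Read the first label of an event and proceed to the first event that follows it. -/
def Cmd.descendBody : Cmd (Var S) :=
  .seq (.cons .hist .tag .hist) <| .seq (.cdr .event .event) <| .seq (.cdr (.temp 0) .event) <|
    .seq (.car .event .event) <| .seq (.push (.temp 0)) <| .car .tag .event

theorem Cmd.loopFree_descendBody : (Cmd.descendBody : Cmd (Var S)).LoopFree := by
  simp [Cmd.descendBody, Cmd.push, Cmd.LoopFree]

theorem Cmd.ensures_descendBody {σ : Var S → Val} {l : Λ} {x y c : Val} {h : List Λ}
    {N L : List (List Λ × F)}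
    (hevent : σ .event = .cell (.atom (symbolCode l)) (.cell (.cell x y) c))
    (htag : σ .tag = .atom (symbolCode l)) (hh : σ .hist = .ofHist h) (hc : Enc .forest c N)
    (hL : EncStack (σ .stack) L) :
    Cmd.descendBody.Ensures σ [] fun σ' => σ' .event = .cell x y ∧ σ' .tag = x ∧
      σ' .hist = .ofHist (l :: h) ∧ EncStack (σ' .stack) (N.map (afterHist (l :: h)) ++ L) ∧
      AgreeOff {.event, .tag, .hist, .stack} σ σ' := by
  refine .seq <| .cons <| .seq <|
    .cdr (x := .atom (symbolCode l)) (y := .cell (.cell x y) c) (by simpa using hevent) <|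
    .seq <| .cdr (x := .cell x y) (y := c) (by simp) <| .seq <|
    .car (x := .cell x y) (y := c) (by simp) <| .seq <| (Cmd.ensures_push (M := N) (L := L)
      (h := l :: h) (by simpa using hc) (by simpa using hL) ?_).mono fun σ' ⟨hstack, hagree⟩ => ?_
  · simp [htag, hh, Val.ofHist, Val.ofList]
  · have hevent' : σ' .event = .cell x y := by simp [hagree.reg (i := 4)]
    refine .car (x := x) (y := y) hevent' ⟨by simpa using hevent', by simp, ?_,
      by simpa using hstack, .trans ?_ (.update (by simp) _)⟩
    · simp [hagree.reg (i := 3), htag, hh, Val.ofHist, Val.ofList]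
    · exact .trans (.trans (.trans (.trans (.update (by simp) _) (.update (by simp) _))
        (.update_temp 0 _)) (.update (by simp) _)) (hagree.mono (by simp))

theorem Exec.descend {x y : Val} {M : List (List Λ × F)} (he : Enc .event (.cell x y) M)
    {σ : Var S → Val} {L : List (List Λ × F)} {h : List Λ} (hevent : σ .event = .cell x y)
    (htag : σ .tag = x) (hh : σ .hist = .ofHist h) (hL : EncStack (σ .stack) L) :
    ∃ t σ' ls f M', M = (ls, f) :: M' ∧
      Exec (.loop .tag .descendBody) (σ, []) [] t (σ', []) ∧
      t ≤ ((Cmd.descendBody : Cmd (Var S)).bound + 1) * ls.length + 1 ∧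
      σ' .event = .cell (.atom 0) (.atom (symbolCode f)) ∧
      σ' .hist = .ofHist (ls.reverse ++ h) ∧
      EncStack (σ' .stack) (M'.map (afterHist h) ++ L) ∧
      AgreeOff {.event, .tag, .hist, .stack} σ σ' := by
  generalize hk : Kind.event = k at he
  generalize hv : Val.cell x y = v at he
  induction he generalizing x y σ L h with
  | leaf f =>
    obtain ⟨rfl, rfl⟩ := Val.cell.inj hv
    exact ⟨_, σ, [], f, [], rfl, .loop_done htag, by simp, hevent, hh, hL, .refl _ _⟩
  | @label e c M N l he hc ihe _ =>
    obtain ⟨rfl, rfl⟩ := Val.cell.inj hv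
    obtain ⟨x', y', rfl⟩ := he.exists_cell
    obtain ⟨t₁, σ₁, e₁, hevent₁, htag₁, hh₁, hL₁, hagree₁⟩ :=
      Cmd.ensures_descendBody hevent htag hh hc hL
    obtain ⟨t₂, σ₂, ls, f, M', rfl, e₂, ht₂, hevent₂, hh₂, hL₂, hagree₂⟩ :=
      ihe hevent₁ htag₁ hh₁ hL₁ rfl rfl
    refine ⟨_, σ₂, l :: ls, f, (M' ++ N).map fun q => (l :: q.1, q.2), by simp,
      .loop_step (show (σ .tag).Differs 0 by rw [htag]; exact symbolCode_ne_zero l) e₁ e₂, ?_,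
      hevent₂, by simpa using hh₂, ?_, hagree₁.trans hagree₂⟩
    · have := e₁.le_bound Cmd.loopFree_descendBody
      rw [List.length_cons, mul_add]
      omega
    · simpa [Function.comp_def, afterHist_cons] using hL₂
  | nil => cases hk
  | node => cases hk

end EnumerateRuns

/-! ### Expansion of registers -/

section Expand

variable {Λ R O : Type*} (τ : Λ → R → List (R ⊕ O))

/-- The word that a register or letter stands for after the assignments `τ l` for the `l` in the
given list, last assignment first, have been applied to empty registers. -/
def expand : List Λ → R ⊕ O → List O
  | _, .inr o => [o]
  | [], .inl _ => []
  | l :: h, .inl r => (τ l r).flatMap (expand h)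

/-- The word that a string of registers and letters stands for. -/
def expandAll (h : List Λ) (s : List (R ⊕ O)) : List O :=
  s.flatMap (expand τ h)

/-- The number of symbols that have to be processed in order to expand a register or letter. -/
def expandCost : List Λ → R ⊕ O → ℕ
  | _, .inr _ => 1
  | [], .inl _ => 1
  | l :: h, .inl r => 1 + ((τ l r).map (expandCost h)).sum

/-- The registers that occur in a string of registers and letters. -/
def regs (s : List (R ⊕ O)) : List R := s.filterMap Sum.getLeft?

@[simp] theorem regs_nil : regs ([] : List (R ⊕ O)) = [] := rfl

@[simp] theorem regs_cons_inl (r : R) (s : List (R ⊕ O)) :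
    regs (Sum.inl r :: s) = r :: regs s := rfl

@[simp] theorem regs_cons_inr (o : O) (s : List (R ⊕ O)) : regs (Sum.inr o :: s) = regs s := rfl

variable {τ} [Fintype R]

open Classical in
/-- Every register occurs at most once in all the strings of a total assignment together. -/
def CopylessTotal (σ : R → List (R ⊕ O)) : Prop :=
  ∀ r, ∑ r', (regs (σ r')).count r ≤ 1

open Classical in
theorem sum_map_expandCost_le (h : List Λ) (s : List (R ⊕ O)) :
    (s.map (expandCost τ h)).sum ≤
      s.length + ∑ r, (regs s).count r * expandCost τ h (.inl r) := by
  induction s with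
  | nil => simp
  | cons x s ih =>
    cases x with
    | inl r =>
      simp only [List.map_cons, List.sum_cons, List.length_cons, regs_cons_inl, List.count_cons,
        beq_iff_eq, add_mul, Finset.sum_add_distrib, ite_mul, one_mul, zero_mul,
        Finset.sum_ite_eq, Finset.mem_univ, if_true]
      omega
    | inr o =>
      simp only [List.map_cons, List.sum_cons, List.length_cons, regs_cons_inr, expandCost]
      omega

theorem sum_expandCost_cons_le {l : Λ} (hτ : CopylessTotal (τ l)) (h : List Λ) :
    ∑ r, expandCost τ (l :: h) (.inl r) ≤
      Fintype.card R + ∑ r, (τ l r).length + ∑ r, expandCost τ h (.inl r) := by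
  classical
  calc ∑ r, expandCost τ (l :: h) (.inl r)
      ≤ ∑ r, (1 + ((τ l r).length + ∑ r', (regs (τ l r)).count r' * expandCost τ h (.inl r'))) :=
        Finset.sum_le_sum fun r _ => Nat.add_le_add_left (sum_map_expandCost_le h _) 1
    _ = Fintype.card R + ∑ r, (τ l r).length +
          ∑ r', (∑ r, (regs (τ l r)).count r') * expandCost τ h (.inl r') := by
        simp only [Finset.sum_add_distrib, Finset.sum_mul]
        rw [Finset.sum_comm (f := fun r r' => (regs (τ l r)).count r' * expandCost τ h (.inl r'))]
        simp [add_assoc]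
    _ ≤ _ := by
        gcongr with r
        exact mul_le_of_le_one_left (Nat.zero_le _) (by convert hτ r)

theorem exists_sum_expandCost_le [Finite Λ] (hτ : ∀ l, CopylessTotal (τ l)) :
    ∃ C, ∀ h : List Λ, ∑ r, expandCost τ h (.inl r) ≤ C * (h.length + 1) := by
  have := Fintype.ofFinite Λ
  refine ⟨Fintype.card R + ∑ l, ∑ r, (τ l r).length, fun h => ?_⟩
  induction h with
  | nil => simp [expandCost]
  | cons l h ih =>
    have hl : ∑ r, (τ l r).length ≤ ∑ l, ∑ r, (τ l r).length :=
      Finset.single_le_sum (f := fun l => ∑ r, (τ l r).length) (fun _ _ => Nat.zero_le _)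
        (Finset.mem_univ l)
    have := sum_expandCost_cons_le (hτ l) h
    rw [List.length_cons, mul_add _ (h.length + 1)]
    omega

theorem exists_sum_map_expandCost_le {F : Type*} [Finite Λ] [Finite F]
    (hτ : ∀ l, CopylessTotal (τ l)) (φ : F → List (R ⊕ O)) :
    ∃ C, ∀ f (h : List Λ), ((φ f).map (expandCost τ h)).sum ≤ C * (h.length + 1) := by
  classical
  have := Fintype.ofFinite F
  obtain ⟨C, hC⟩ := exists_sum_expandCost_le hτ
  refine ⟨∑ f, (φ f).length * (1 + C), fun f h => ?_⟩
  have hf : (φ f).length * (1 + C) ≤ ∑ f, (φ f).length * (1 + C) :=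
    Finset.single_le_sum (f := fun f => (φ f).length * (1 + C)) (fun _ _ => Nat.zero_le _)
      (Finset.mem_univ f)
  calc ((φ f).map (expandCost τ h)).sum
      ≤ (φ f).length + ∑ r, (regs (φ f)).count r * expandCost τ h (.inl r) :=
        sum_map_expandCost_le h _
    _ ≤ (φ f).length + ∑ r, (φ f).length * expandCost τ h (.inl r) := by
        gcongr
        exact List.count_le_length.trans (List.length_filterMap_le _ _)
    _ ≤ (φ f).length + (φ f).length * (C * (h.length + 1)) := by
        rw [← Finset.mul_sum]
        gcongr
        exact hC h
    _ ≤ (φ f).length * (1 + C) * (h.length + 1) := by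
        nlinarith [Nat.zero_le ((φ f).length * h.length)]
    _ ≤ _ := by gcongr

end Expand

/-! ### Writing the output of a run -/

section WriteOutput

variable {S Λ R O F : Type*} [Fintype Λ] [Fintype R] (codeO : O → ℤ)

/-- The value that represents a register or letter to be expanded after the given labels. -/
noncomputable def Val.ofItem : (R ⊕ O) × List Λ → Val
  | (.inl r, h) => .cell (.atom (symbolCode r)) (.ofHist h)
  | (.inr o, _) => .cell (.atom 0) (.atom (codeO o))

/-- The value that represents a stack of registers and letters to be expanded. -/
noncomputable def Val.ofItems (l : List ((R ⊕ O) × List Λ)) : Val :=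
  .ofList (l.map (.ofItem codeO))

/-- Push a register or letter, together with the labels in `a`, on the stack of symbols to be
expanded. -/
noncomputable def Cmd.pushSymbol (a : Var S) : R ⊕ O → Cmd (Var S)
  | .inl r => .seq (.const (.temp 2) (symbolCode r)) <| .seq (.cons (.temp 2) (.temp 2) a) <|
      .cons .todo (.temp 2) .todo
  | .inr o => .seq (.const (.temp 2) (codeO o)) <| .seq (.cons (.temp 2) .nil (.temp 2)) <|
      .cons .todo (.temp 2) .todo

/-- Push a string, together with the labels in `a`, on the stack of symbols to be expanded. -/
noncomputable def Cmd.pushString (a : Var S) (s : List (R ⊕ O)) : Cmd (Var S) :=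
  .forEach (.pushSymbol codeO a) s.reverse

theorem Cmd.loopFree_pushString (a : Var S) (s : List (R ⊕ O)) :
    (Cmd.pushString codeO a s).LoopFree := by
  refine Cmd.loopFree_forEach fun x => ?_
  cases x <;> simp [Cmd.pushSymbol, Cmd.LoopFree]

variable {codeO}

theorem Cmd.ensures_pushSymbol {a : Var S} (ha : a ≠ .todo) (ha' : a ≠ .temp 2)
    {σ : Var S → Val} {h : List Λ} {l : List ((R ⊕ O) × List Λ)} (h0 : σ .nil = .atom 0)
    (hh : σ a = .ofHist h) (hl : σ .todo = .ofItems codeO l) (x : R ⊕ O) :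
    (Cmd.pushSymbol codeO a x).Ensures σ [] fun σ' => σ' .todo = .ofItems codeO ((x, h) :: l) ∧
      σ' a = .ofHist h ∧ AgreeOff {.todo} σ σ' := by
  have hagree (x y z : Val) : AgreeOff {.todo} σ
      (update (update (update σ (.temp 2) x) (.temp 2) y) .todo z) :=
    .trans (.trans (.update_temp 2 x) (.update_temp 2 y)) (.update (Set.mem_singleton _) z)
  cases x with
  | inl r =>
    refine .seq <| .const <| .seq <| .cons <| .cons ⟨?_, by simp [ha, ha', hh], hagree _ _ _⟩
    simp [ha', hh, hl, Val.ofItems, Val.ofItem, Val.ofList]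
  | inr o =>
    refine .seq <| .const <| .seq <| .cons <| .cons ⟨?_, by simp [ha, ha', hh], hagree _ _ _⟩
    simp [h0, hl, Val.ofItems, Val.ofItem, Val.ofList]

theorem Cmd.ensures_pushString {a : Var S} (ha : a ≠ .todo) (ha' : a ≠ .temp 2)
    {σ : Var S → Val} {h : List Λ} {l : List ((R ⊕ O) × List Λ)} (h0 : σ .nil = .atom 0)
    (hh : σ a = .ofHist h) (hl : σ .todo = .ofItems codeO l) (s : List (R ⊕ O)) :
    (Cmd.pushString codeO a s).Ensures σ [] fun σ' =>
      σ' .todo = .ofItems codeO (s.map (·, h) ++ l) ∧ AgreeOff {.todo} σ σ' := by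
  refine (Cmd.Ensures.forEach (I := fun (s : List (R ⊕ O)) σ' =>
    σ' .todo = .ofItems codeO (s.reverse.map (·, h) ++ l) ∧ σ' a = .ofHist h ∧
    AgreeOff {.todo} σ σ') ?_ _ ⟨hl, hh, .refl _ _⟩).mono fun σ' h' =>
    ⟨by simpa using h'.1, h'.2.2⟩
  rintro s x σ' ⟨hl', hh', hagree⟩
  refine (Cmd.ensures_pushSymbol ha ha' ((hagree.reg (by simp)).trans h0) hh' hl' x).mono
    fun σ'' h' => ⟨by simpa using h'.1, h'.2.1, hagree.trans h'.2.2⟩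

variable (codeO) (τ : Λ → R → List (R ⊕ O))

/-- Process the topmost symbol to be expanded: write it, if it is a letter, or else replace it by
the string of the last assignment. -/
noncomputable def Cmd.writeBody : Cmd (Var S) :=
  .seq (.car (.temp 0) .todo) <| .seq (.cdr .todo .todo) <| .seq (.car .tag (.temp 0)) <|
    .seq (.cdr (.temp 0) (.temp 0)) <| .ite .tag 0 (.write (.temp 0)) <|
    .ite (.temp 0) 0 .skip <| .seq (.car (.temp 1) (.temp 0)) <|
    .seq (.cdr (.temp 0) (.temp 0)) <|
    .switch .tag symbolCode (fun r => .switch (.temp 1) symbolCode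
      (fun l => .pushString codeO (.temp 0) (τ l r)) Finset.univ.toList) Finset.univ.toList

theorem Cmd.loopFree_writeBody : (Cmd.writeBody codeO τ : Cmd (Var S)).LoopFree := by
  refine ⟨trivial, trivial, trivial, trivial, trivial, trivial, trivial, trivial, ?_⟩
  exact Cmd.loopFree_switch fun r => Cmd.loopFree_switch fun l => Cmd.loopFree_pushString ..

/-- The word that a stack of symbols to be expanded stands for. -/
def itemsWord (l : List ((R ⊕ O) × List Λ)) : List O :=
  l.flatMap fun p => expand τ p.2 p.1

/-- The number of symbols that have to be processed for a stack of symbols to be expanded. -/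
def itemsCost (l : List ((R ⊕ O) × List Λ)) : ℕ :=
  (l.map fun p => expandCost τ p.2 p.1).sum

variable {codeO}

theorem Cmd.ensures_writeBody_inr {σ : Var S → Val} {o : O} {h : List Λ}
    {l : List ((R ⊕ O) × List Λ)} (hl : σ .todo = .ofItems codeO ((.inr o, h) :: l)) :
    (Cmd.writeBody codeO τ).Ensures σ [codeO o] fun σ' => σ' .todo = .ofItems codeO l ∧
      AgreeOff {.todo, .tag} σ σ' := by
  refine .seq <| .car hl <| .seq <| .cdr (x := .ofItem codeO (.inr o, h)) (y := .ofItems codeO l)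
    (by simpa using! hl) <| .seq <|
    .car (x := .atom 0) (y := .atom (codeO o)) (by simp [Val.ofItem]) <| .seq <|
    .cdr (x := .atom 0) (y := .atom (codeO o)) (by simp [Val.ofItem]) <|
    .ite_eq (by simp) <| .write (by simp) ⟨by simp, ?_⟩
  exact .trans (.trans (.trans (.update_temp 0 _) (.update (by simp) _)) (.update (by simp) _))
    (.update_temp 0 _)

theorem Cmd.ensures_writeBody_inl {σ : Var S → Val} {r : R} {h : List Λ}
    {l : List ((R ⊕ O) × List Λ)} (h0 : σ .nil = .atom 0)
    (hl : σ .todo = .ofItems codeO ((.inl r, h) :: l)) :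
    (Cmd.writeBody codeO τ).Ensures σ [] fun σ' => σ' .todo = .ofItems codeO
      (h.casesOn [] (fun b h => (τ b r).map (·, h)) ++ l) ∧ AgreeOff {.todo, .tag} σ σ' := by
  refine .seq <| .car hl <| .seq <| .cdr (x := .ofItem codeO (.inl r, h)) (y := .ofItems codeO l)
    (by simpa using! hl) <| .seq <| .car (x := .atom (symbolCode r)) (y := .ofHist h)
    (by simp [Val.ofItem]) <| .seq <| .cdr (x := .atom (symbolCode r)) (y := .ofHist h)
    (by simp [Val.ofItem]) <| .ite_ne (by simpa using! symbolCode_ne_zero r) ?_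
  set σ₁ := update (update (update (update σ (.temp 0) (.ofItem codeO (.inl r, h))) .todo
    (.ofItems codeO l)) .tag (.atom (symbolCode r))) (.temp 0) (.ofHist h)
  have hagree : AgreeOff {.todo, .tag} σ σ₁ :=
    .trans (.trans (.trans (.update_temp 0 _) (.update (by simp) _)) (.update (by simp) _))
      (.update_temp 0 _)
  cases h with
  | nil => exact .ite_eq (by simp [σ₁, Val.ofHist, Val.ofList]) <| .skip ⟨by simp [σ₁], hagree⟩
  | cons b h =>
    have hb : σ₁ (.temp 0) = .cell (.atom (symbolCode b)) (.ofHist h) := by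
      simp [σ₁, Val.ofHist, Val.ofList]
    refine .ite_ne (by rw [hb]; rfl) <| .seq <| .car hb <| .seq <|
      .cdr (x := .atom (symbolCode b)) (y := .ofHist h) (by simp [hb]) <|
      .switch symbolCode_injective (Finset.mem_toList.2 (Finset.mem_univ r)) (by simp [σ₁]) <|
      .switch symbolCode_injective (Finset.mem_toList.2 (Finset.mem_univ b)) (by simp) <|
      (Cmd.ensures_pushString (l := l) (h := h) (by simp) (by simp) (by simp [σ₁, h0]) (by simp)
        (by simp [σ₁]) (τ b r)).mono fun σ' h' => ⟨h'.1, ?_⟩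
    exact (hagree.trans (.trans (.update_temp 1 _) (.update_temp 0 _))).trans
      (h'.2.mono (by simp))

theorem Cmd.ensures_writeBody {σ : Var S → Val} {p : (R ⊕ O) × List Λ}
    {l : List ((R ⊕ O) × List Λ)} (h0 : σ .nil = .atom 0)
    (hl : σ .todo = .ofItems codeO (p :: l)) :
    ∃ w l', itemsWord τ (p :: l) = w ++ itemsWord τ l' ∧
      itemsCost τ (p :: l) = itemsCost τ l' + 1 ∧
      (Cmd.writeBody codeO τ).Ensures σ (w.map codeO) fun σ' => σ' .todo = .ofItems codeO l' ∧
        AgreeOff {.todo, .tag} σ σ' := by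
  obtain ⟨r | o, h⟩ := p
  · refine ⟨[], _, ?_, ?_, Cmd.ensures_writeBody_inl τ h0 hl⟩
    · cases h <;> simp [itemsWord, expand, List.flatMap_map]
    · cases h <;>
        simp [itemsCost, expandCost, Function.comp_def, add_comm, add_left_comm, add_assoc]
  · refine ⟨[o], l, ?_, ?_, Cmd.ensures_writeBody_inr τ hl⟩
    · simp [itemsWord, expand]
    · simp [itemsCost, expandCost, add_comm]

theorem Exec.writeLoop {σ : Var S → Val} {l : List ((R ⊕ O) × List Λ)} (h0 : σ .nil = .atom 0)
    (hl : σ .todo = .ofItems codeO l) :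
    ∃ t σ', Exec (.loop .todo (.writeBody codeO τ)) (σ, []) ((itemsWord τ l).map codeO) t
        (σ', []) ∧ t ≤ ((Cmd.writeBody codeO τ : Cmd (Var S)).bound + 1) * itemsCost τ l + 1 ∧
      AgreeOff {.todo, .tag} σ σ' := by
  induction hn : itemsCost τ l generalizing σ l with
  | zero =>
    cases l with
    | nil => exact ⟨_, σ, .loop_done hl, by simp, .refl _ _⟩
    | cons p l =>
      obtain ⟨_, _, _, hcost, _⟩ := Cmd.ensures_writeBody τ h0 hl
      omega
  | succ n ih =>
    cases l with
    | nil => simp [itemsCost] at hn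
    | cons p l =>
      obtain ⟨w, l', hw, hcost, t, σ₁, e, hl', hagree⟩ := Cmd.ensures_writeBody τ h0 hl
      obtain ⟨t', σ₂, e', ht', hagree'⟩ := ih ((hagree.reg (by simp)).trans h0) hl' (by omega)
      rw [hw, List.map_append]
      refine ⟨_, σ₂, .loop_step (show (σ .todo).Differs 0 by rw [hl]; rfl) e e', ?_,
        hagree.trans hagree'⟩
      have ht := e.le_bound (Cmd.loopFree_writeBody codeO τ)
      rw [mul_add]
      omega

end WriteOutput

/-! ### The main loop -/

section MainLoop

variable {A S Λ F R O : Type*} [Fintype Λ] [Fintype F]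

theorem Enc.event_ne_nil {v : Val} {M : List (List Λ × F)} (h : Enc .event v M) : M ≠ [] := by
  generalize hk : Kind.event = k at h
  induction h with
  | leaf => exact List.cons_ne_nil _ _
  | label _ _ _ ihe _ => simp [ihe rfl]
  | nil => cases hk
  | node => cases hk

theorem EncStack.eq_zero_of_nil {v : Val} (h : EncStack v ([] : List (List Λ × F))) :
    v = .atom 0 := by
  generalize hL : ([] : List (List Λ × F)) = L at h
  cases h with
  | nil => rfl
  | cons h hc hne hv =>
    cases hc with
    | nil => exact absurd rfl hne
    | node he => simp [he.event_ne_nil] at hL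

theorem EncStack.differs {v : Val} {q : List Λ × F} {L : List (List Λ × F)}
    (h : EncStack v (q :: L)) : v.Differs 0 := by
  generalize hL : q :: L = L' at h
  cases h with
  | nil => cases hL
  | cons => rfl

/-- Pop a forest from the stack, proceed to its event and push its two subforests. -/
def Cmd.popForest : Cmd (Var S) :=
  .seq (.car (.temp 0) .stack) <| .seq (.cdr .stack .stack) <| .seq (.cdr .hist (.temp 0)) <|
  .seq (.car (.temp 0) (.temp 0)) <| .seq (.car .event (.temp 0)) <|
  .seq (.cdr (.temp 0) (.temp 0)) <| .seq (.car .tag (.temp 0)) <|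
  .seq (.cdr (.temp 0) (.temp 0)) <| .seq (.push (.temp 0)) <|
  .seq (.move (.temp 0) .tag) <| .seq (.push (.temp 0)) <| .car .tag .event

theorem Cmd.loopFree_popForest : (Cmd.popForest : Cmd (Var S)).LoopFree := by
  simp [Cmd.popForest, Cmd.push, Cmd.LoopFree]

theorem Cmd.ensures_popForest_cell {σ : Var S → Val} {x y c d v : Val} {h : List Λ}
    {N K L : List (List Λ × F)}
    (hstack : σ .stack = .cell (.cell (.cell (.cell x y) (.cell c d)) (.ofHist h)) v)
    (hc : Enc .forest c N) (hd : Enc .forest d K) (hv : EncStack v L) :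
    Cmd.popForest.Ensures σ [] fun σ' => σ' .event = .cell x y ∧ σ' .tag = x ∧
      σ' .hist = .ofHist h ∧
      EncStack (σ' .stack) (N.map (afterHist h) ++ (K.map (afterHist h) ++ L)) ∧
      AgreeOff {.event, .tag, .hist, .stack} σ σ' := by
  refine .seq <| .car hstack <| .seq <| .cdr (by simpa using hstack) <| .seq <|
    .cdr (x := .cell (.cell x y) (.cell c d)) (y := .ofHist h) (by simp) <| .seq <|
    .car (x := .cell (.cell x y) (.cell c d)) (y := .ofHist h) (by simp) <| .seq <|
    .car (x := .cell x y) (y := .cell c d) (by simp) <| .seq <|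
    .cdr (x := .cell x y) (y := .cell c d) (by simp) <| .seq <|
    .car (x := c) (y := d) (by simp) <| .seq <| .cdr (x := c) (y := d) (by simp) ?_
  set σ₁ := update (update (update (update (update (update (update (update σ
    (.temp 0) (.cell (.cell (.cell x y) (.cell c d)) (.ofHist h))) .stack v) .hist (.ofHist h))
    (.temp 0) (.cell (.cell x y) (.cell c d))) .event (.cell x y)) (.temp 0) (.cell c d))
    .tag c) (.temp 0) d
  have hagree₁ : AgreeOff {.event, .tag, .hist, .stack} σ σ₁ :=
    .trans (.trans (.trans (.trans (.trans (.trans (.trans (.update_temp 0 _)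
      (.update (by simp) _)) (.update (by simp) _)) (.update_temp 0 _)) (.update (by simp) _))
      (.update_temp 0 _)) (.update (by simp) _)) (.update_temp 0 _)
  refine .seq <| (Cmd.ensures_push (i := 0) (M := K) (L := L) (h := h)
    (by simpa [σ₁] using hd) (by simpa [σ₁] using hv) (by simp [σ₁])).mono
    fun σ₂ ⟨hstack₂, hagree₂⟩ => .seq <| .move ?_
  have hagree₂' : AgreeOff {.stack} σ₁ (update σ₂ (.temp 0) (σ₂ .tag)) :=
    hagree₂.trans (.update_temp 0 _)
  refine .seq <| (Cmd.ensures_push (i := 0) (M := N) (h := h)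
    (L := K.map (afterHist h) ++ L) ?_ (by simpa using hstack₂) ?_).mono
    fun σ₃ ⟨hstack₃, hagree₃⟩ => ?_
  · simpa [hagree₂.reg (i := 5), σ₁] using hc
  · rw [hagree₂'.reg (by simp)]
    simp [σ₁]
  have hagree : AgreeOff {.stack} σ₁ σ₃ := hagree₂'.trans hagree₃
  have hevent : σ₃ .event = .cell x y := by simp [hagree.reg (i := 4), σ₁]
  refine .car hevent ⟨by simpa using hevent, by simp, ?_, by simpa using hstack₃, ?_⟩
  · simp [hagree.reg (i := 3), σ₁]
  · exact .trans (hagree₁.trans (hagree.mono (by simp))) (.update (by simp) _)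

theorem Cmd.ensures_popForest {σ : Var S → Val} {q : List Λ × F} {L : List (List Λ × F)}
    (hL : EncStack (σ .stack) (q :: L)) :
    ∃ x y M h L', q :: L = M.map (afterHist h) ++ L' ∧ Enc .event (.cell x y) M ∧
      Cmd.popForest.Ensures σ [] fun σ' => σ' .event = .cell x y ∧ σ' .tag = x ∧
        σ' .hist = .ofHist h ∧ EncStack (σ' .stack) L' ∧
        AgreeOff {.event, .tag, .hist, .stack} σ σ' := by
  generalize hv : σ .stack = v at hL
  generalize hL' : q :: L = L' at hL
  cases hL with
  | nil => cases hL'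
  | cons h hc hne hv' =>
    cases hc with
    | nil => exact absurd rfl hne
    | node he hc hd =>
      obtain ⟨x, y, rfl⟩ := he.exists_cell
      exact ⟨x, y, _, h, _, by simp, he, Cmd.ensures_popForest_cell hv hc hd hv'⟩

variable (codeO : O → ℤ) (φ : F → List (R ⊕ O)) [Fintype R]

/-- Initialize the stack of symbols with the string for the final symbol of the current run. -/
noncomputable def Cmd.startWrite : Cmd (Var S) :=
  .seq (.cdr .event .event) <| .seq (.const .todo 0) <|
    .switch .event symbolCode (fun f => .pushString codeO .hist (φ f)) Finset.univ.toList

theorem Cmd.loopFree_startWrite : (Cmd.startWrite codeO φ : Cmd (Var S)).LoopFree :=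
  ⟨trivial, trivial, Cmd.loopFree_switch fun _ => Cmd.loopFree_pushString ..⟩

variable {codeO φ}

theorem Cmd.ensures_startWrite {σ : Var S → Val} {f : F} {h : List Λ} (h0 : σ .nil = .atom 0)
    (hevent : σ .event = .cell (.atom 0) (.atom (symbolCode f))) (hh : σ .hist = .ofHist h) :
    (Cmd.startWrite codeO φ).Ensures σ [] fun σ' => σ' .todo = .ofItems codeO ((φ f).map (·, h)) ∧
      AgreeOff {.event, .todo} σ σ' := by
  refine .seq <| .cdr hevent <| .seq <| .const <| .switch symbolCode_injective
    (Finset.mem_toList.2 (Finset.mem_univ f)) (by simp) <|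
    (Cmd.ensures_pushString (h := h) (l := []) (by simp) (by simp) (by simpa using h0)
      (by simpa using hh) (by simp [Val.ofItems, Val.ofList]) (φ f)).mono
    fun σ' ⟨htodo, hagree⟩ => ⟨by simpa using htodo, ?_⟩
  exact .trans (.trans (.update (by simp) _) (.update (by simp) _)) (hagree.mono (by simp))

variable (codeO φ) (τ : Λ → R → List (R ⊕ O))

/-- The body of the main loop, which writes the output of one run. -/
noncomputable def Cmd.enumBody : Cmd (Var S) :=
  .seq .popForest <| .seq (.loop .tag .descendBody) <| .seq (.startWrite codeO φ) <|
    .loop .todo (.writeBody codeO τ)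

omit [Fintype Λ] [Fintype F] [Fintype R] in
theorem itemsWord_map (s : List (R ⊕ O)) (h : List Λ) :
    itemsWord τ (s.map (·, h)) = expandAll τ h s := by
  simp [itemsWord, expandAll, List.flatMap_map]

variable {τ}

theorem Exec.enumBody (hτ : ∀ l, CopylessTotal (τ l)) :
    ∃ k, ∀ {σ : Var S → Val} {q : List Λ × F} {L : List (List Λ × F)},
      EncStack (σ .stack) (q :: L) → σ .nil = .atom 0 →
      ∃ t σ', Exec (.enumBody codeO φ τ) (σ, []) ((expandAll τ q.1 (φ q.2)).map codeO) t (σ', []) ∧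
        t ≤ k * (q.1.length + 1) ∧ EncStack (σ' .stack) L ∧ σ' .nil = .atom 0 := by
  obtain ⟨C, hC⟩ := exists_sum_map_expandCost_le hτ φ
  let b₁ := (Cmd.popForest : Cmd (Var S)).bound
  let b₂ := (Cmd.descendBody : Cmd (Var S)).bound
  let b₃ := (Cmd.startWrite codeO φ : Cmd (Var S)).bound
  let b₄ := (Cmd.writeBody codeO τ : Cmd (Var S)).bound
  refine ⟨b₁ + (b₂ + 1) + b₃ + (b₄ + 1) * C + 2, fun {σ q L} hL h0 => ?_⟩
  obtain ⟨x, y, M, h, L', hL', he, t₁, σ₁, e₁, hevent₁, htag₁, hh₁, hstack₁, hagree₁⟩ :=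
    Cmd.ensures_popForest hL
  obtain ⟨t₂, σ₂, ls, f, M', rfl, e₂, ht₂, hevent₂, hh₂, hstack₂, hagree₂⟩ :=
    Exec.descend he hevent₁ htag₁ hh₁ hstack₁
  obtain ⟨rfl, rfl⟩ : q = afterHist h (ls, f) ∧ L = M'.map (afterHist h) ++ L' := by
    simpa using hL'
  have h0₂ : σ₂ .nil = .atom 0 := by
    rw [hagree₂.reg (by simp), hagree₁.reg (by simp), h0]
  obtain ⟨t₃, σ₃, e₃, htodo₃, hagree₃⟩ := Cmd.ensures_startWrite (codeO := codeO) (φ := φ) h0₂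
    hevent₂ hh₂
  have h0₃ : σ₃ .nil = .atom 0 := by rw [hagree₃.reg (by simp), h0₂]
  obtain ⟨t₄, σ₄, e₄, ht₄, hagree₄⟩ := Exec.writeLoop τ h0₃ htodo₃
  rw [itemsWord_map] at e₄
  refine ⟨_, σ₄, e₁.andThen <| e₂.andThen <| e₃.andThen e₄, ?_, ?_, ?_⟩
  · have ht₁ : t₁ ≤ b₁ := e₁.le_bound Cmd.loopFree_popForest
    have ht₃ : t₃ ≤ b₃ := e₃.le_bound (Cmd.loopFree_startWrite codeO φ)
    have hcost : itemsCost τ ((φ f).map (·, ls.reverse ++ h)) ≤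
        C * ((ls.reverse ++ h).length + 1) := by
      simpa [itemsCost, Function.comp_def] using hC f (ls.reverse ++ h)
    have ht₄' := ht₄.trans (Nat.add_le_add_right (Nat.mul_le_mul_left (b₄ + 1) hcost) 1)
    have hls : ls.length ≤ (ls.reverse ++ h).length := by simp
    have ht₂' := ht₂.trans (Nat.add_le_add_right (Nat.mul_le_mul_left (b₂ + 1) hls) 1)
    simp only [afterHist]
    generalize (ls.reverse ++ h).length = n at *
    nlinarith
  · rw [hagree₄.reg (by simp), hagree₃.reg (by simp)]
    exact hstack₂
  · rw [hagree₄.reg (by simp), h0₃]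

theorem EnumLoop.mono {V : Type*} [DecidableEq V] {a z : V} {c : Cmd V} {k k' : ℕ} (hk : k ≤ k')
    {s : CState V} {ws : List (List ℤ)} (h : EnumLoop a c z k s ws) : EnumLoop a c z k' s ws := by
  induction h with
  | done h => exact .done h
  | step h hc ht hz _ ih => exact .step h hc (ht.trans (Nat.mul_le_mul_right _ hk)) hz ih

theorem EnumLoop.of_encStack (hτ : ∀ l, CopylessTotal (τ l)) :
    ∃ k, ∀ {L : List (List Λ × F)} {σ : Var S → Val},
      (∀ q ∈ L, q.1.length ≤ (expandAll τ q.1 (φ q.2)).length) →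
      EncStack (σ .stack) L → σ .nil = .atom 0 →
      EnumLoop .stack (.enumBody codeO φ τ) .nil k (σ, [])
        (L.map fun q => (expandAll τ q.1 (φ q.2)).map codeO) := by
  obtain ⟨k, hk⟩ := Exec.enumBody codeO φ hτ (S := S)
  refine ⟨k, fun {L} => ?_⟩
  induction L with
  | nil => exact fun _ hL _ => .done hL.eq_zero_of_nil
  | cons q L ih =>
    intro σ hlen hL h0
    obtain ⟨t, σ', e, ht, hL', h0'⟩ := hk hL h0
    refine .step hL.differs e (ht.trans (Nat.mul_le_mul_left _ ?_)) h0'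
      (ih (fun q hq => hlen q (List.mem_cons_of_mem _ hq)) hL' h0')
    rw [List.length_map]
    exact Nat.add_le_add_right (hlen q List.mem_cons_self) 1

/-- Push the bag of the runs from the state `s`. -/
def Cmd.pushBag (s : S) : Cmd (Var S) :=
  .ite (.bag s) 0 .skip <| .seq (.car (.temp 0) (.bag s)) <| .seq (.cdr (.temp 1) (.bag s)) <|
    .seq (.cons (.temp 1) (.temp 1) .nil) <| .seq (.cons (.temp 0) (.temp 0) (.temp 1)) <|
    .seq (.cons (.temp 0) (.temp 0) .nil) <| .cons .stack (.temp 0) .stack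

/-- Push the bags of the runs from the given states on an empty stack. -/
def Cmd.initStack (inits : List S) : Cmd (Var S) :=
  .seq (.const .stack 0) (.forEach .pushBag inits)

theorem Cmd.loopFree_initStack (inits : List S) : (Cmd.initStack inits).LoopFree :=
  ⟨trivial, Cmd.loopFree_forEach fun s => by simp [Cmd.pushBag, Cmd.LoopFree]⟩

variable {M : LabelledAutomaton A S Λ F}

theorem Cmd.ensures_pushBag {σ : Var S → Val} {D : List A} (hσ : M.Stored σ D)
    {L : List (List Λ × F)} (hL : EncStack (σ .stack) L) (s : S) :
    (Cmd.pushBag s).Ensures σ [] fun σ' => AgreeOff {.stack} σ σ' ∧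
      ∃ N : List (List Λ × F), (N : Multiset (List Λ × F)) = M.runs s D ∧
        EncStack (σ' .stack) (N.map (afterHist []) ++ L) := by
  have hbag := hσ.2 s
  generalize hv : σ (.bag s) = v at hbag
  generalize hR : M.runs s D = R at hbag
  cases hbag with
  | zero => exact .ite_eq hv <| .skip ⟨.refl _ _, [], rfl, hL⟩
  | cell he hc =>
    refine .ite_ne (by rw [hv]; rfl) <| .seq <| .car hv <| .seq <| .cdr (by simpa using hv) <|
      .seq <| .cons <| .seq <| .cons <| .seq <| .cons <| .cons ⟨?_, _, rfl, ?_⟩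
    · exact .trans (.trans (.trans (.trans (.trans (.update_temp 0 _) (.update_temp 1 _))
        (.update_temp 1 _)) (.update_temp 0 _)) (.update_temp 0 _))
        (.update (Set.mem_singleton _) _)
    · simpa [hσ.1, Val.ofHist, Val.ofList] using
        EncStack.cons ([] : List Λ) (.node he hc .nil) rfl hL

theorem Cmd.ensures_initStack {σ : Var S → Val} {D : List A} (hσ : M.Stored σ D)
    (inits : List S) :
    (Cmd.initStack inits).Ensures σ [] fun σ' => σ' .nil = .atom 0 ∧
      ∃ N : List (List Λ × F),
        (N : Multiset (List Λ × F)) = (inits.map fun s => M.runs s D).sum ∧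
          EncStack (σ' .stack) (N.map (afterHist [])) := by
  refine .seq <| .const <| (Cmd.Ensures.forEach (I := fun (l : List S) σ' =>
    AgreeOff {.stack} σ σ' ∧ ∃ N : List (List Λ × F),
      (N : Multiset (List Λ × F)) = (l.map fun s => M.runs s D).sum ∧
        EncStack (σ' .stack) (N.map (afterHist []))) ?_ inits
    ⟨.update (Set.mem_singleton _) _, [], rfl, by simpa using EncStack.nil⟩).mono
    fun σ' h => ⟨(h.1.reg (by simp)).trans hσ.1, h.2⟩
  rintro l s σ' ⟨hagree, N, hN, hstack⟩
  refine (Cmd.ensures_pushBag (hσ.congr hagree (by simp) (by simp)) hstack s).mono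
    fun σ'' ⟨hagree', N', hN', hstack'⟩ =>
      ⟨hagree.trans hagree', N' ++ N, ?_, by simpa using hstack'⟩
  rw [← Multiset.coe_add, hN, hN', List.map_append, List.sum_append, List.map_singleton,
    List.sum_singleton, add_comm]

end MainLoop

theorem admitsLinearEnumeration_runs {A S Λ F R O : Type*} [Finite A] [Finite S] [Finite Λ]
    [Finite F] [Fintype R] {τ : Λ → R → List (R ⊕ O)} {φ : F → List (R ⊕ O)}
    (M : LabelledAutomaton A S Λ F) (inits : List S) (hτ : ∀ l, CopylessTotal (τ l))
    (hlen : ∀ D, ∀ q ∈ (inits.map fun s => M.runs s D).sum,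
      q.1.length ≤ (expandAll τ q.1.reverse (φ q.2)).length) :
    AdmitsLinearEnumeration fun D => (inits.map fun s => M.runs s D).sum.map
      fun q => expandAll τ q.1.reverse (φ q.2) := by
  have := Fintype.ofFinite A
  have := Fintype.ofFinite S
  have := Fintype.ofFinite Λ
  have := Fintype.ofFinite F
  refine admitsLinearEnumeration_of_enumScheme fun codeA codeO hA hA0 _ => ?_
  obtain ⟨k₁, h₁⟩ := Exec.preprocess M hA hA0
  obtain ⟨k₂, h₂⟩ := EnumLoop.of_encStack codeO φ hτ (S := S)
  refine ⟨Var S, inferInstance, inferInstance, ⟨.preprocess M codeA, .initStack inits,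
    .enumBody codeO φ τ, .stack, .nil⟩, k₁ + (Cmd.initStack inits).bound + k₂, fun D => ?_⟩
  obtain ⟨t, σ, e, ht, hσ⟩ := h₁ D
  obtain ⟨t', σ', e', h0, N, hN, hstack⟩ := Cmd.ensures_initStack hσ inits
  refine ⟨N.map fun q => expandAll τ q.1.reverse (φ q.2), ?_, t, t', σ, [], (σ', []), ?_, ?_, e,
    e', ?_⟩
  · rw [← hN, Multiset.map_coe]
  · rw [List.length_map]
    exact ht.trans (Nat.mul_le_mul_right _ (by omega))
  · exact (e'.le_bound (Cmd.loopFree_initStack inits)).trans (by omega)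
  · have hloop := h₂ (fun q hq => ?_) hstack h0
    · simpa [Function.comp_def, afterHist] using hloop.mono (by omega)
    · obtain ⟨q, hq', rfl⟩ := List.mem_map.1 hq
      simpa [afterHist] using hlen D q (hN ▸ Multiset.mem_coe.2 hq')

/-! ### From sequences of choices to runs -/

section Substitution

variable {R O : Type*}

/-- Substitution of words for the registers of a string, which yields a word. -/
def instantiate (ν : R → List O) (s : List (R ⊕ O)) : List O :=
  s.flatMap (Sum.elim ν fun o => [o])

/-- Substitution of strings for the registers of a string, which yields a string. -/
def substitute (σ : R → List (R ⊕ O)) (s : List (R ⊕ O)) : List (R ⊕ O) :=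
  s.flatMap (Sum.elim σ fun o => [.inr o])

/-- The letters of a string of registers and letters. -/
def letters (s : List (R ⊕ O)) : List O := s.filterMap Sum.getRight?

@[simp] theorem instantiate_nil (ν : R → List O) : instantiate ν [] = [] := rfl

@[simp] theorem instantiate_cons_inl (ν : R → List O) (r : R) (s : List (R ⊕ O)) :
    instantiate ν (.inl r :: s) = ν r ++ instantiate ν s := rfl

@[simp] theorem instantiate_cons_inr (ν : R → List O) (o : O) (s : List (R ⊕ O)) :
    instantiate ν (.inr o :: s) = o :: instantiate ν s := rfl

@[simp] theorem instantiate_append (ν : R → List O) (s s' : List (R ⊕ O)) :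
    instantiate ν (s ++ s') = instantiate ν s ++ instantiate ν s' := List.flatMap_append

@[simp] theorem substitute_nil (σ : R → List (R ⊕ O)) : substitute σ [] = [] := rfl

@[simp] theorem substitute_cons_inl (σ : R → List (R ⊕ O)) (r : R) (s : List (R ⊕ O)) :
    substitute σ (.inl r :: s) = σ r ++ substitute σ s := rfl

@[simp] theorem substitute_cons_inr (σ : R → List (R ⊕ O)) (o : O) (s : List (R ⊕ O)) :
    substitute σ (.inr o :: s) = .inr o :: substitute σ s := rfl

@[simp] theorem letters_nil : letters ([] : List (R ⊕ O)) = [] := rfl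

@[simp] theorem letters_cons_inl (r : R) (s : List (R ⊕ O)) :
    letters (.inl r :: s) = letters s := rfl

@[simp] theorem letters_cons_inr (o : O) (s : List (R ⊕ O)) :
    letters (.inr o :: s) = o :: letters s := rfl

@[simp] theorem letters_append (s s' : List (R ⊕ O)) :
    letters (s ++ s') = letters s ++ letters s' := List.filterMap_append

@[simp] theorem letters_map_inl (l : List R) : letters (l.map (.inl : R → R ⊕ O)) = [] := by
  simp [letters]

@[simp] theorem regs_append (s s' : List (R ⊕ O)) : regs (s ++ s') = regs s ++ regs s' :=
  List.filterMap_append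

@[simp] theorem regs_map_inl (l : List R) : regs (l.map (.inl : R → R ⊕ O)) = l := by
  simp [regs, List.filterMap_map, Function.comp_def]

theorem instantiate_substitute (ν : R → List O) (σ : R → List (R ⊕ O)) (s : List (R ⊕ O)) :
    instantiate ν (substitute σ s) = instantiate (fun r => instantiate ν (σ r)) s := by
  induction s with
  | nil => rfl
  | cons x s ih => cases x <;> simp [ih]

theorem instantiate_congr {ν ν' : R → List O} {s : List (R ⊕ O)}
    (h : ∀ r ∈ regs s, ν r = ν' r) : instantiate ν s = instantiate ν' s := by
  induction s with
  | nil => rfl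
  | cons x s ih => cases x <;> simp_all

theorem map_inl_regs {s : List (R ⊕ O)} (h : letters s = []) : (regs s).map .inl = s := by
  induction s with
  | nil => rfl
  | cons x s ih => cases x <;> simp_all

theorem letters_substitute {σ : R → List (R ⊕ O)} (h : ∀ r, letters (σ r) = [])
    (s : List (R ⊕ O)) : letters (substitute σ s) = letters s := by
  induction s with
  | nil => rfl
  | cons x s ih => cases x <;> simp [ih, h]

theorem length_instantiate (ν : R → List O) (s : List (R ⊕ O)) :
    (instantiate ν s).length =
      ((regs s).map fun r => (ν r).length).sum + (letters s).length := by
  induction s with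
  | nil => rfl
  | cons x s ih => cases x <;> simp [ih] <;> omega

theorem expandAll_eq_instantiate {Λ : Type*} (τ : Λ → R → List (R ⊕ O)) (h : List Λ)
    (s : List (R ⊕ O)) :
    expandAll τ h s = instantiate (fun r => expand τ h (.inl r)) s := by
  refine congrArg s.flatMap (funext fun x => ?_)
  rcases x with r | o
  · rfl
  · cases h <;> rfl

end Substitution

theorem sum_toFinset_le {R : Type*} [DecidableEq R] (f : R → ℕ) (l : List R) :
    ∑ r ∈ l.toFinset, f r ≤ (l.map f).sum := by
  rw [Finset.sum_list_map_count]
  refine Finset.sum_le_sum fun r hr => Nat.le_mul_of_pos_left _ ?_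
  exact List.count_pos_iff.2 (List.mem_toFinset.1 hr)

theorem sum_biUnion_le {R ι : Type*} [DecidableEq R] (f : R → ℕ) (U : Finset ι)
    (t : ι → Finset R) : ∑ r ∈ U.biUnion t, f r ≤ ∑ i ∈ U, ∑ r ∈ t i, f r := by
  classical
  induction U using Finset.induction_on with
  | empty => simp
  | insert i U h ih =>
    rw [Finset.biUnion_insert, Finset.sum_insert h]
    have := Finset.sum_union_inter (s₁ := t i) (s₂ := U.biUnion t) (f := f)
    omega

section Choices

attribute [local instance] Classical.propDecidable

section Demand

variable {R O : Type*}

theorem sum_regs_add_letters_le (ν : R → List O) (s : List (R ⊕ O)) :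
    ∑ r ∈ (regs s).toFinset, (ν r).length + (letters s).length ≤ (instantiate ν s).length := by
  rw [length_instantiate]
  exact Nat.add_le_add_right (sum_toFinset_le _ _) _

/-- The registers that are used by an assignment to the registers in `U`. -/
noncomputable def demand (σ : R → List (R ⊕ O)) (U : Finset R) : Finset R :=
  U.biUnion fun r => (regs (σ r)).toFinset

theorem mem_demand {σ : R → List (R ⊕ O)} {U : Finset R} {r r' : R} (hr : r ∈ U)
    (hr' : r' ∈ regs (σ r)) : r' ∈ demand σ U :=
  Finset.mem_biUnion.2 ⟨r, hr, List.mem_toFinset.2 hr'⟩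

theorem sum_demand_add_letters_le (ν : R → List O) (σ : R → List (R ⊕ O)) (U : Finset R) :
    ∑ r ∈ demand σ U, (ν r).length + ∑ r ∈ U, (letters (σ r)).length ≤
      ∑ r ∈ U, (instantiate ν (σ r)).length := by
  calc
    _ ≤ ∑ r ∈ U, ∑ r' ∈ (regs (σ r)).toFinset, (ν r').length + ∑ r ∈ U, (letters (σ r)).length :=
      Nat.add_le_add_right (sum_biUnion_le ..) _
    _ ≤ _ := by
      rw [← Finset.sum_add_distrib]
      exact Finset.sum_le_sum fun r _ => sum_regs_add_letters_le ν (σ r)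

variable [Fintype R]

theorem count_regs_substitute (σ : R → List (R ⊕ O)) (s : List (R ⊕ O)) (r : R) :
    (regs (substitute σ s)).count r = ∑ r', (regs s).count r' * (regs (σ r')).count r := by
  induction s with
  | nil => simp
  | cons x s ih =>
    cases x <;> simp [ih, List.count_cons, add_mul, Finset.sum_add_distrib, add_comm]

theorem CopylessTotal.substitute {σ σ' : R → List (R ⊕ O)} (h : CopylessTotal σ)
    (h' : CopylessTotal σ') : CopylessTotal fun r => substitute σ (σ' r) := by
  intro r
  simp only [count_regs_substitute]
  rw [Finset.sum_comm]
  refine le_trans (Finset.sum_le_sum fun r' _ => ?_) (h r)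
  rw [← Finset.sum_mul]
  exact (Nat.mul_le_mul_right _ (h' r')).trans_eq (one_mul _)

theorem CopylessTotal.of_eq_or_eq_nil {σ σ' : R → List (R ⊕ O)} (h : CopylessTotal σ)
    (h' : ∀ r, σ' r = σ r ∨ σ' r = []) : CopylessTotal σ' := by
  intro r
  refine le_trans (Finset.sum_le_sum fun r' _ => ?_) (h r)
  rcases h' r' with h | h <;> simp [h]

end Demand

/-- A deterministic streaming string transducer whose moves depend, besides the letter that is
read, on a choice from `B`. -/
structure ChoiceTransducer (P A B R O : Type*) where
  step : P → B → A → Option ((R → List (R ⊕ O)) × P)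
  final : P → B → Option (List (R ⊕ O))

namespace ChoiceTransducer

variable {P A B R O : Type*} [Fintype B] (N : ChoiceTransducer P A B R O)

/-- The bag of the outputs for all sequences of choices, from a state and register contents. -/
noncomputable def outputs (N : ChoiceTransducer P A B R O) :
    P → (R → List O) → List A → Multiset (List O)
  | p, ν, [] => ∑ b, (N.final p b).elim 0 fun s => {instantiate ν s}
  | p, ν, a :: D => ∑ b, (N.step p b a).elim 0 fun q =>
      N.outputs q.2 (fun r => instantiate ν (q.1 r)) D

variable [Fintype R]

omit [Fintype B] in
/-- Every assignment of the transducer is copyless. -/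
def Copyless : Prop := ∀ p b a q, N.step p b a = some q → CopylessTotal q.1

/-- The part of `N.outputs` for which `U` is the set of registers whose contents are used. -/
noncomputable def liveOutputs (N : ChoiceTransducer P A B R O) :
    P → Finset R → (R → List O) → List A → Multiset (List O)
  | p, U, ν, [] => ∑ b, (N.final p b).elim 0 fun s =>
      if (regs s).toFinset = U then {instantiate ν s} else 0
  | p, U, ν, a :: D => ∑ b, (N.step p b a).elim 0 fun q =>
      ∑ U', if demand q.1 U' = U then
        N.liveOutputs q.2 U' (fun r => instantiate ν (q.1 r)) D else 0

theorem outputs_eq_sum_liveOutputs (D : List A) (p : P) (ν : R → List O) :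
    N.outputs p ν D = ∑ U, N.liveOutputs p U ν D := by
  induction D generalizing p ν with
  | nil =>
    simp only [outputs, liveOutputs]
    rw [Finset.sum_comm]
    refine Finset.sum_congr rfl fun b _ => ?_
    cases N.final p b <;> simp
  | cons a D ih =>
    simp only [outputs, liveOutputs]
    rw [Finset.sum_comm]
    refine Finset.sum_congr rfl fun b _ => ?_
    cases N.step p b a with
    | none => simp
    | some q =>
      simp only [Option.elim_some]
      rw [Finset.sum_comm, ih]
      simp

theorem liveOutputs_congr (D : List A) {p : P} {U : Finset R} {ν ν' : R → List O}
    (h : ∀ r ∈ U, ν r = ν' r) : N.liveOutputs p U ν D = N.liveOutputs p U ν' D := by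
  induction D generalizing p U ν ν' with
  | nil =>
    refine Finset.sum_congr rfl fun b _ => ?_
    cases N.final p b with
    | none => rfl
    | some s =>
      simp only [Option.elim_some]
      split_ifs with hU
      · rw [instantiate_congr fun r hr => h r (hU ▸ List.mem_toFinset.2 hr)]
      · rfl
  | cons a D ih =>
    refine Finset.sum_congr rfl fun b _ => ?_
    cases N.step p b a with
    | none => rfl
    | some q =>
      refine Finset.sum_congr rfl fun U' _ => ?_
      split_ifs with hU
      · exact ih fun r hr => instantiate_congr fun r' hr' => h r' (hU ▸ mem_demand hr hr')
      · rfl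

end ChoiceTransducer

/-- Copyless assignments without letters. There are finitely many of them, so that a finite
automaton can postpone their execution. -/
def Pending (R : Type*) [Fintype R] : Type _ :=
  {κ : R → List R // ∀ r, ∑ r', (κ r').count r ≤ 1}

namespace Pending

variable {R O Λ : Type*} [Fintype R]

instance : Finite (Pending R) := by
  have nodup (κ : Pending R) (r : R) : (κ.1 r).Nodup :=
    List.nodup_iff_count_le_one.2 fun r' => (Finset.single_le_sum
      (f := fun r => (κ.1 r).count r') (fun _ _ => Nat.zero_le _) (Finset.mem_univ r)).trans
      (κ.2 r')
  refine Finite.of_injective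
    (fun (κ : Pending R) (r : R) => (⟨κ.1 r, nodup κ r⟩ : {l : List R // l.Nodup})) ?_
  intro κ κ' h
  exact Subtype.ext (funext fun r => congrArg Subtype.val (congrFun h r))

/-- The assignment that leaves all registers unchanged. -/
def one : Pending R := ⟨fun r => [r], fun r => by simp [List.count_cons]⟩

/-- A pending assignment as an assignment of strings of registers and letters. -/
def toTotal (κ : Pending R) (r : R) : List (R ⊕ O) := (κ.1 r).map .inl

theorem copylessTotal_toTotal (κ : Pending R) :
    CopylessTotal (κ.toTotal : R → List (R ⊕ O)) := fun r => by
  simpa [toTotal] using κ.2 r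

/-- The inverse of `Pending.toTotal`, with the junk value `Pending.one` on assignments that are
not copyless. -/
noncomputable def ofTotal (ρ : R → List (R ⊕ O)) : Pending R :=
  if h : CopylessTotal ρ then ⟨fun r => regs (ρ r), h⟩ else one

theorem toTotal_ofTotal {ρ : R → List (R ⊕ O)} (h : CopylessTotal ρ)
    (hl : ∀ r, letters (ρ r) = []) : (ofTotal ρ).toTotal = ρ := by
  have e : ofTotal ρ = ⟨fun r => regs (ρ r), h⟩ := dif_pos h
  funext r
  rw [toTotal, e]
  exact map_inl_regs (hl r)

/-- The composition of a pending assignment with an assignment that is applied after it and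
restricted to the registers in `U`. -/
noncomputable def comp (κ : Pending R) (σ : R → List (R ⊕ O)) (U : Finset R) (r : R) :
    List (R ⊕ O) :=
  if r ∈ U then substitute κ.toTotal (σ r) else []

theorem copylessTotal_comp (κ : Pending R) {σ : R → List (R ⊕ O)} (hσ : CopylessTotal σ)
    (U : Finset R) : CopylessTotal (κ.comp σ U) :=
  (κ.copylessTotal_toTotal.substitute hσ).of_eq_or_eq_nil fun r => by
    by_cases h : r ∈ U <;> simp [comp, h]

/-- The register contents after a history and a pending assignment. -/
noncomputable def val (τ : Λ → R → List (R ⊕ O)) (κ : Pending R) (h : List Λ) (r : R) : List O :=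
  expandAll τ h (κ.toTotal r)

theorem expandAll_substitute_toTotal (τ : Λ → R → List (R ⊕ O)) (κ : Pending R) (h : List Λ)
    (s : List (R ⊕ O)) : expandAll τ h (substitute κ.toTotal s) = instantiate (κ.val τ h) s := by
  rw [expandAll_eq_instantiate, instantiate_substitute]
  exact congrArg (instantiate · s) (funext fun r => (expandAll_eq_instantiate ..).symm)

theorem expandAll_comp {τ : Λ → R → List (R ⊕ O)} (κ : Pending R) (h : List Λ)
    (σ : R → List (R ⊕ O)) {U : Finset R} {r : R} (hr : r ∈ U) :
    expandAll τ h (κ.comp σ U r) = instantiate (κ.val τ h) (σ r) := by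
  rw [comp, if_pos hr, expandAll_substitute_toTotal]

@[simp] theorem val_one (τ : Λ → R → List (R ⊕ O)) (h : List Λ) (r : R) :
    one.val τ h r = expand τ h (.inl r) := by
  simp [val, one, toTotal, expandAll]

/-- The effect of an assignment `ρ` with label `l`: an assignment without letters stays pending,
any other one is executed by emitting its label. -/
noncomputable def advance (ρ : R → List (R ⊕ O)) (l : Λ) : Option Λ × Pending R :=
  if ∀ r, letters (ρ r) = [] then (none, .ofTotal ρ) else (some l, .one)

theorem val_advance {τ : Λ → R → List (R ⊕ O)} {l : Λ} (hl : CopylessTotal (τ l)) (h : List Λ)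
    (r : R) : (advance (τ l) l).2.val τ ((advance (τ l) l).1.toList ++ h) r =
      expandAll τ h (τ l r) := by
  unfold advance
  split_ifs with hnil
  · simp only [Option.toList_none, List.nil_append, val, toTotal_ofTotal hl hnil]
  · simp [expand, expandAll]

theorem length_advance_comp_le (κ : Pending R) (σ : R → List (R ⊕ O)) (U : Finset R) (l : Λ) :
    (advance (κ.comp σ U) l).1.toList.length ≤ ∑ r ∈ U, (letters (σ r)).length := by
  unfold advance
  split_ifs with hnil
  · simp
  · obtain ⟨r, hr⟩ := not_forall.1 hnil
    have hrU : r ∈ U := by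
      by_contra hrU
      simp [comp, hrU] at hr
    rw [comp, if_pos hrU, letters_substitute fun r => by simp [toTotal]] at hr
    exact (List.length_pos_iff.2 hr).trans_le <|
      Finset.single_le_sum (f := fun r => (letters (σ r)).length) (fun _ _ => Nat.zero_le _) hrU

end Pending

theorem sum_map_toList_flatMap {ι α M : Type*} [AddCommMonoid M] (s : Finset ι) (f : ι → List α)
    (g : α → M) : ((s.toList.flatMap f).map g).sum = ∑ i ∈ s, ((f i).map g).sum := by
  rw [← Finset.sum_map_toList]
  generalize s.toList = l
  induction l with
  | nil => simp
  | cons x l ih => simp [ih]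

/-- The labels of `ChoiceTransducer.layered`: a state, a choice, and a letter, which determine an
assignment, with the registers that are live after it and the assignment that is pending
before it. -/
abbrev ChoiceLabel (P A B R : Type*) [Fintype R] := P × B × A × Finset R × Pending R

namespace ChoiceTransducer

variable {P A B R O : Type*} [Fintype R] (N : ChoiceTransducer P A B R O)

/-- The assignment that is executed when a label is emitted. -/
noncomputable def labelAssignment : ChoiceLabel P A B R → R → List (R ⊕ O)
  | (p, b, a, U, κ) => (N.step p b a).elim (fun _ => []) fun q => κ.comp q.1 U

/-- The output string of a final symbol. -/
noncomputable def finalString : P × B × Pending R → List (R ⊕ O)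
  | (p, b, κ) => (N.final p b).elim [] (substitute κ.toTotal)

variable {N} in
theorem Copyless.labelAssignment (hN : N.Copyless) (l : ChoiceLabel P A B R) :
    CopylessTotal (N.labelAssignment l) := by
  obtain ⟨p, b, a, U, κ⟩ := l
  cases h : N.step p b a with
  | none => intro r; simp [ChoiceTransducer.labelAssignment, h]
  | some q => simpa [ChoiceTransducer.labelAssignment, h] using
      κ.copylessTotal_comp (hN _ _ _ _ h) U

variable [Fintype B]

/-- The automaton whose runs are the sequences of choices, grouped by what they do to the output.
A state guesses the set of registers that will be used, and a label is emitted only when the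
assignment that has accumulated puts a letter into such a register. Hence every label of a run
contributes a letter to the output. -/
noncomputable def layered :
    LabelledAutomaton A (P × Finset R × Pending R) (ChoiceLabel P A B R) (P × B × Pending R) where
  step := fun (p, U, κ) a => (Finset.univ : Finset B).toList.flatMap fun b =>
    (N.step p b a).elim [] fun q =>
      (Finset.univ : Finset (Finset R)).toList.flatMap fun U' =>
        if demand q.1 U' = U then
          let t := Pending.advance (κ.comp q.1 U') (p, b, a, U', κ)
          [(t.1, (q.2, U', t.2))]
        else []
  final := fun (p, U, κ) => (Finset.univ : Finset B).toList.flatMap fun b =>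
    (N.final p b).elim [] fun s => if (regs s).toFinset = U then [(p, b, κ)] else []

theorem runs_layered_nil (p : P) (U : Finset R) (κ : Pending R) :
    N.layered.runs (p, U, κ) [] = ∑ b, (N.final p b).elim 0 fun s =>
      if (regs s).toFinset = U then {([], (p, b, κ))} else 0 := by
  rw [LabelledAutomaton.runs, ← Multiset.sum_map_singleton (Multiset.ofList _), Multiset.map_coe,
    Multiset.sum_coe, List.map_map, layered, sum_map_toList_flatMap]
  refine Finset.sum_congr rfl fun b _ => ?_
  cases N.final p b with
  | none => rfl
  | some s => by_cases h : (regs s).toFinset = U <;> simp [h]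

theorem runs_layered_cons (p : P) (U : Finset R) (κ : Pending R) (a : A) (D : List A) :
    N.layered.runs (p, U, κ) (a :: D) = ∑ b, (N.step p b a).elim 0 fun q => ∑ U',
      if demand q.1 U' = U then
        let t := Pending.advance (κ.comp q.1 U') (p, b, a, U', κ)
        (N.layered.runs (q.2, U', t.2) D).map fun x => (t.1.toList ++ x.1, x.2)
      else 0 := by
  rw [LabelledAutomaton.runs]
  conv_lhs => enter [1, 2]; rw [layered]
  rw [sum_map_toList_flatMap]
  refine Finset.sum_congr rfl fun b _ => ?_
  cases N.step p b a with
  | none => rfl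
  | some q =>
    simp only [Option.elim_some]
    rw [sum_map_toList_flatMap]
    refine Finset.sum_congr rfl fun U' _ => ?_
    by_cases h : demand q.1 U' = U <;> simp [h]

/-- The output of a run that continues a history. -/
noncomputable def runOutput (h : List (ChoiceLabel P A B R))
    (q : List (ChoiceLabel P A B R) × (P × B × Pending R)) : List O :=
  expandAll N.labelAssignment (q.1.reverse ++ h) (N.finalString q.2)

omit [Fintype B] in
theorem runOutput_nil : N.runOutput [] =
    fun q => expandAll N.labelAssignment q.1.reverse (N.finalString q.2) :=
  funext fun q => by rw [runOutput, List.append_nil]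

omit [Fintype B] in
theorem runOutput_append (h : List (ChoiceLabel P A B R)) (o : Option (ChoiceLabel P A B R))
    (q : List (ChoiceLabel P A B R) × (P × B × Pending R)) :
    N.runOutput h (o.toList ++ q.1, q.2) = N.runOutput (o.toList ++ h) q := by
  cases o <;> simp [runOutput]

omit [Fintype B] in
theorem runOutput_final {p : P} {b : B} {s : List (R ⊕ O)} (hs : N.final p b = some s)
    (κ : Pending R) (h : List (ChoiceLabel P A B R)) :
    N.runOutput h ([], (p, b, κ)) = instantiate (κ.val N.labelAssignment h) s := by
  simp [runOutput, finalString, hs, Pending.expandAll_substitute_toTotal]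

variable {N}

omit [Fintype B] in
theorem Copyless.val_advance (hN : N.Copyless) {p : P} {b : B} {a : A}
    {q : (R → List (R ⊕ O)) × P} (hq : N.step p b a = some q) (κ : Pending R)
    (h : List (ChoiceLabel P A B R)) {U : Finset R} {r : R} (hr : r ∈ U) :
    let t := Pending.advance (κ.comp q.1 U) (p, b, a, U, κ)
    t.2.val N.labelAssignment (t.1.toList ++ h) r =
      instantiate (κ.val N.labelAssignment h) (q.1 r) := by
  have hl : κ.comp q.1 U = N.labelAssignment (p, b, a, U, κ) := by
    simp [ChoiceTransducer.labelAssignment, hq]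
  rw [← Pending.expandAll_comp κ h q.1 hr, hl]
  exact Pending.val_advance (hN.labelAssignment _) h r

theorem Copyless.liveOutputs_eq (hN : N.Copyless) (D : List A) (p : P) (U : Finset R)
    (κ : Pending R) (h : List (ChoiceLabel P A B R)) :
    N.liveOutputs p U (κ.val N.labelAssignment h) D =
      (N.layered.runs (p, U, κ) D).map (N.runOutput h) := by
  induction D generalizing p U κ h with
  | nil =>
    rw [runs_layered_nil, ← Multiset.coe_mapAddMonoidHom, map_sum]
    refine Finset.sum_congr rfl fun b _ => ?_
    cases hb : N.final p b with
    | none => rfl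
    | some s =>
      simp only [Option.elim_some]
      split_ifs
      · simp [N.runOutput_final hb]
      · rfl
  | cons a D ih =>
    rw [runs_layered_cons, ← Multiset.coe_mapAddMonoidHom, map_sum]
    refine Finset.sum_congr rfl fun b _ => ?_
    cases hb : N.step p b a with
    | none => rfl
    | some q =>
      simp only [Option.elim_some, map_sum]
      refine Finset.sum_congr rfl fun U' _ => ?_
      split_ifs
      · rw [Multiset.coe_mapAddMonoidHom, Multiset.map_map]
        simp only [Function.comp_def, runOutput_append]
        exact (N.liveOutputs_congr D fun r hr => (hN.val_advance hb κ h hr).symm).trans (ih ..)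
      · rfl

theorem Copyless.length_le_length_runOutput (hN : N.Copyless) {D : List A} {p : P} {U : Finset R}
    {κ : Pending R} {q : List (ChoiceLabel P A B R) × (P × B × Pending R)}
    (hq : q ∈ N.layered.runs (p, U, κ) D) (h : List (ChoiceLabel P A B R)) :
    ∑ r ∈ U, (κ.val N.labelAssignment h r).length + q.1.length ≤ (N.runOutput h q).length := by
  induction D generalizing p U κ q h with
  | nil =>
    obtain ⟨b, -, hb⟩ := Multiset.mem_sum.1 (N.runs_layered_nil p U κ ▸ hq)
    cases hs : N.final p b with
    | none => simp [hs] at hb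
    | some s =>
      simp only [hs, Option.elim_some] at hb
      split_ifs at hb with hU
      · obtain rfl := Multiset.mem_singleton.1 hb
        rw [N.runOutput_final hs, ← hU]
        exact Nat.le_of_add_right_le (sum_regs_add_letters_le _ s)
      · simp at hb
  | cons a D ih =>
    obtain ⟨b, -, hb⟩ := Multiset.mem_sum.1 (N.runs_layered_cons p U κ a D ▸ hq)
    cases ht : N.step p b a with
    | none => simp [ht] at hb
    | some t =>
      rw [ht, Option.elim_some] at hb
      obtain ⟨U', -, hU'⟩ := Multiset.mem_sum.1 hb
      split_ifs at hU' with hU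
      · obtain ⟨q', hq', rfl⟩ := Multiset.mem_map.1 hU'
        have hrest := ih hq' ((Pending.advance (κ.comp t.1 U') (p, b, a, U', κ)).1.toList ++ h)
        rw [Finset.sum_congr rfl fun r hr => congrArg List.length (hN.val_advance ht κ h hr)]
          at hrest
        have hdemand := sum_demand_add_letters_le (κ.val N.labelAssignment h) t.1 U'
        have hlabel := κ.length_advance_comp_le t.1 U' (p, b, a, U', κ)
        rw [hU] at hdemand
        rw [runOutput_append, List.length_append]
        omega
      · simp at hU'

end ChoiceTransducer

theorem admitsLinearEnumeration_outputs {P A B R O : Type*} [Finite P] [Finite A] [Fintype B]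
    {N : ChoiceTransducer P A B R O} [Fintype R] (hN : N.Copyless) (p₀ : P) :
    AdmitsLinearEnumeration (N.outputs p₀ fun _ => []) := by
  have key := admitsLinearEnumeration_runs (φ := N.finalString) N.layered
    ((Finset.univ : Finset (Finset R)).toList.map fun U => (p₀, U, .one)) hN.labelAssignment
    fun D q hq => ?_
  · convert key using 2 with D
    rw [N.outputs_eq_sum_liveOutputs, List.map_map, Finset.sum_map_toList,
      ← Multiset.coe_mapAddMonoidHom, map_sum]
    refine Finset.sum_congr rfl fun U _ => ?_
    have hone : Pending.one.val N.labelAssignment [] = fun _ => [] :=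
      funext fun r => Pending.val_one _ _ r
    simpa [hone, ChoiceTransducer.runOutput_nil] using hN.liveOutputs_eq D p₀ U .one []
  · simp only [List.map_map, Finset.sum_map_toList, Multiset.mem_sum] at hq
    obtain ⟨U, -, hq⟩ := hq
    simpa [ChoiceTransducer.runOutput_nil] using
      (Nat.le_add_left ..).trans (hN.length_le_length_runOutput hq [])

end Choices

/-! ### Regular expressions denote regular languages -/

section Regular

open Computability

variable {S : Type*}

theorem isRegular_of_finite {L : Language S} (hL : Set.Finite (α := List S) L) :
    L.IsRegular := by
  have suffixes : {y : List S | ∃ z ∈ L, y <:+ z}.Finite := by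
    refine (hL.biUnion fun z _ => List.finite_toSet z.tails).subset ?_
    rintro y ⟨z, hz, hy⟩
    exact Set.mem_biUnion hz ((List.mem_tails ..).2 hy)
  refine .of_finite_range_leftQuotient (suffixes.finite_subsets.subset ?_)
  rintro _ ⟨x, rfl⟩ y hy
  exact ⟨x ++ y, hy, List.suffix_append x y⟩

theorem leftQuotient_mul (L M : Language S) (x : List S) :
    (L * M).leftQuotient x =
      L.leftQuotient x * M + sSup (M.leftQuotient '' {v | ∃ u ∈ L, u ++ v = x}) := by
  ext z
  rw [Language.mem_leftQuotient, Language.mem_mul, Language.mem_add, Language.mem_mul]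
  constructor
  · rintro ⟨a, ha, b, hb, h⟩
    rcases List.append_eq_append_iff.1 h with ⟨c, rfl, rfl⟩ | ⟨c, rfl, rfl⟩
    · exact .inr ⟨_, ⟨c, ⟨a, ha, rfl⟩, rfl⟩, hb⟩
    · exact .inl ⟨c, ha, b, hb, rfl⟩
  · rintro (⟨a, ha, b, hb, rfl⟩ | ⟨_, ⟨v, ⟨u, hu, rfl⟩, rfl⟩, hz⟩)
    · exact ⟨x ++ a, ha, b, hb, List.append_assoc ..⟩
    · exact ⟨u, hu, v ++ z, hz, (List.append_assoc ..).symm⟩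

theorem isRegular_mul {L M : Language S} (hL : L.IsRegular) (hM : M.IsRegular) :
    (L * M).IsRegular := by
  refine .of_finite_range_leftQuotient (((hL.finite_range_leftQuotient.prod
    hM.finite_range_leftQuotient.finite_subsets).image fun p => p.1 * M + sSup p.2).subset ?_)
  rintro _ ⟨x, rfl⟩
  exact ⟨(_, _ '' _), ⟨⟨x, rfl⟩, Set.image_subset_range ..⟩, (leftQuotient_mul L M x).symm⟩

theorem leftQuotient_kstar (L : Language S) {x : List S} (hx : x ≠ []) :
    (L∗).leftQuotient x = sSup (L.leftQuotient '' {v | ∃ u ∈ L∗, u ++ v = x}) * L∗ := by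
  ext z
  rw [Language.mem_leftQuotient, Language.mem_mul]
  constructor
  · rw [Language.mem_kstar]
    rintro ⟨l, hl, h⟩
    induction l generalizing x with
    | nil => simp_all
    | cons y l ih =>
      rw [List.forall_mem_cons] at h
      rcases List.append_eq_append_iff.1 hl with ⟨c, rfl, rfl⟩ | ⟨c, rfl, hc⟩
      · exact ⟨c, ⟨_, ⟨x, ⟨[], Language.nil_mem_kstar L, rfl⟩, rfl⟩, h.1⟩, _,
          Language.join_mem_kstar h.2, rfl⟩
      rcases eq_or_ne c [] with rfl | hc'
      · exact ⟨[], ⟨_, ⟨y, ⟨[], Language.nil_mem_kstar L, by simp⟩, rfl⟩,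
          (Language.mem_leftQuotient ..).2 ((List.append_nil y).symm ▸ h.1)⟩, _,
          Language.join_mem_kstar h.2, hc⟩
      · obtain ⟨a, ⟨_, ⟨v, ⟨u, hu, rfl⟩, rfl⟩, ha⟩, b, hb, rfl⟩ := ih hc' hc.symm h.2
        exact ⟨a, ⟨_, ⟨v, ⟨y ++ u, mul_kstar_le_kstar (a := L) (Language.append_mem_mul h.1 hu),
          List.append_assoc ..⟩, rfl⟩, ha⟩, b, hb, rfl⟩
  · rintro ⟨a, ⟨_, ⟨v, ⟨u, hu, rfl⟩, rfl⟩, ha⟩, b, hb, rfl⟩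
    have h : u ++ ((v ++ a) ++ b) ∈ L∗ * (L * L∗) :=
      Language.append_mem_mul hu (Language.append_mem_mul ha hb)
    have hle : L∗ * (L * L∗) ≤ L∗ :=
      (mul_le_mul_right mul_kstar_le_kstar _).trans (kstar_mul_kstar L).le
    rw [show (u ++ v) ++ (a ++ b) = u ++ ((v ++ a) ++ b) by simp only [List.append_assoc]]
    exact hle h

theorem isRegular_kstar {L : Language S} (hL : L.IsRegular) : (L∗).IsRegular := by
  refine .of_finite_range_leftQuotient
    (((hL.finite_range_leftQuotient.finite_subsets.image fun s => sSup s * L∗).insert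
      (L∗)).subset ?_)
  rintro _ ⟨x, rfl⟩
  rcases eq_or_ne x [] with rfl | hx
  · exact .inl rfl
  · exact .inr ⟨_, Set.image_subset_range .., (leftQuotient_kstar L hx).symm⟩

theorem MExpr.isRegular_lang {A X : Type*} (R : MExpr A X) : R.lang.IsRegular := by
  have letter {B : Type _} (b : B) : (letterLang b).IsRegular :=
    isRegular_of_finite (Set.finite_singleton [b])
  induction R with
  | eps => exact isRegular_of_finite (Set.finite_singleton [])
  | sym a => exact letter _
  | cat R R' ih ih' => exact isRegular_mul ih ih'
  | alt R R' ih ih' => exact ih.add ih'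
  | star R ih => exact isRegular_kstar ih
  | bind x R ih => exact isRegular_mul (isRegular_mul (letter _) ih) (letter _)

end Regular

/-! ### Balanced words -/

section Balance

variable {A X : Type*} {x : X} {w u v : List (RefSym A X)} {s : RefSym A X} {i j : ℕ}

open Classical in
/-- One step of the automaton that remembers whether the variable `x` is open; it is stuck if the
brackets of `x` do not alternate. -/
noncomputable def trackStep (x : X) (p : Bool) (s : RefSym A X) : Option Bool :=
  if s = Sum.inr (.opn x) then (if p then none else some true)
  else if s = Sum.inr (.cls x) then (if p then some false else none)
  else some p

/-- The run over `w` of the automaton that remembers whether the variable `x` is open. -/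
noncomputable def track (x : X) (p : Bool) (w : List (RefSym A X)) : Option Bool :=
  w.foldlM (trackStep x) p

/-- The brackets of every variable alternate, beginning with an opening one and ending with a
closing one. -/
def Balanced (w : List (RefSym A X)) : Prop := ∀ x, track x false w = some false

/-- A word that may be the prefix of a balanced one. -/
def PrefixBalanced (w : List (RefSym A X)) : Prop := ∀ x, (track x false w).isSome

theorem trackStep_of_ne (h₁ : s ≠ Sum.inr (.opn x)) (h₂ : s ≠ Sum.inr (.cls x)) (p : Bool) :
    trackStep x p s = some p := by
  rw [trackStep, if_neg h₁, if_neg h₂]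

theorem track_append (x : X) (p : Bool) (u v : List (RefSym A X)) :
    track x p (u ++ v) = (track x p u).bind fun q => track x q v :=
  List.foldlM_append

theorem track_nil (x : X) (p : Bool) : track x p ([] : List (RefSym A X)) = some p := rfl

theorem track_cons (x : X) (p : Bool) (s : RefSym A X) (w : List (RefSym A X)) :
    track x p (s :: w) = (trackStep x p s).bind fun q => track x q w :=
  List.foldlM_cons

theorem track_singleton (x : X) (p : Bool) (s : RefSym A X) :
    track x p [s] = trackStep x p s := by
  simp [track]

theorem track_flatten (x : X) (p : Bool) (l : List (List (RefSym A X)))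
    (h : ∀ y ∈ l, track x p y = some p) : track x p l.flatten = some p := by
  induction l with
  | nil => rfl
  | cons y l ih =>
    rw [List.forall_mem_cons] at h
    rw [List.flatten_cons, track_append, h.1, Option.bind_some, ih h.2]

theorem MExpr.track_of_notMem {R : MExpr A X} (hx : x ∉ R.vars) (p : Bool) :
    ∀ w ∈ R.lang, track x p w = some p := by
  induction R with
  | eps => rintro w rfl; rfl
  | sym a =>
    rintro w rfl
    rw [track_singleton, trackStep_of_ne Sum.inl_ne_inr Sum.inl_ne_inr]
  | cat R R' ih ih' =>
    rw [MExpr.vars, Set.mem_union, not_or] at hx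
    rintro _ ⟨u, hu, v, hv, rfl⟩
    exact (track_append ..).trans (by rw [ih hx.1 u hu, Option.bind_some, ih' hx.2 v hv])
  | alt R R' ih ih' =>
    rw [MExpr.vars, Set.mem_union, not_or] at hx
    rintro w (hw | hw)
    exacts [ih hx.1 w hw, ih' hx.2 w hw]
  | star R ih =>
    intro w hw
    obtain ⟨l, rfl, h⟩ := Language.mem_kstar.1 hw
    exact track_flatten x p l fun y hy => ih hx y (h y hy)
  | bind y R ih =>
    rw [MExpr.vars, Set.mem_insert_iff, not_or] at hx
    rintro _ ⟨_, ⟨_, rfl, v, hv, rfl⟩, _, rfl, rfl⟩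
    simp [track_nil, track_cons, track_append, trackStep, Ne.symm hx.1, ih hx.2 v hv]

theorem MExpr.balanced_of_wellFormed {R : MExpr A X} (hR : R.WellFormed) :
    ∀ w ∈ R.lang, Balanced w := by
  intro w hw x
  induction R generalizing w with
  | eps => rcases hw with rfl; rfl
  | sym a =>
    rcases hw with rfl
    rw [track_singleton, trackStep_of_ne Sum.inl_ne_inr Sum.inl_ne_inr]
  | cat R R' ih ih' =>
    obtain ⟨u, hu, v, hv, rfl⟩ := hw
    exact (track_append ..).trans (by rw [ih hR.1 u hu, Option.bind_some, ih' hR.2 v hv])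
  | alt R R' ih ih' => exact hw.elim (ih hR.1 w) (ih' hR.2 w)
  | star R ih =>
    obtain ⟨l, rfl, h⟩ := Language.mem_kstar.1 hw
    exact track_flatten x _ l fun y hy => ih hR y (h y hy)
  | bind y R ih =>
    obtain ⟨_, ⟨_, rfl, v, hv, rfl⟩, _, rfl, rfl⟩ := hw
    rcases eq_or_ne y x with rfl | h
    · simp [track_nil, track_cons, track_append, trackStep, MExpr.track_of_notMem hR.1 true v hv]
    · simp [track_nil, track_cons, track_append, trackStep, h, ih hR.2 v hv]

theorem PrefixBalanced.of_append (h : PrefixBalanced (u ++ v)) : PrefixBalanced u := by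
  intro x
  have := h x
  rw [track_append] at this
  exact Option.isSome_of_isSome_bind this

theorem Balanced.prefixBalanced (h : Balanced w) : PrefixBalanced w :=
  fun x => by simp [h x]

/-! ### The spans opened and closed by a prefix of a word -/

/-- The variable `x` has been opened at position `i` and has not been closed yet. -/
def OpenAt (w : List (RefSym A X)) (x : X) (i : ℕ) : Prop :=
  ∃ u v : List (RefSym A X), w = u ++ Sum.inr (.opn x) :: v ∧
    Sum.inr (.opn x) ∉ v ∧ Sum.inr (.cls x) ∉ v ∧ i = (doc u).length + 1

theorem snoc_eq_append_cons {S : Type*} {w u v : List S} {s a : S} :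
    w ++ [s] = u ++ a :: v ↔ (s = a ∧ w = u ∧ v = []) ∨ ∃ v', v = v' ++ [s] ∧ w = u ++ a :: v' := by
  rcases List.eq_nil_or_concat v with rfl | ⟨v, b, rfl⟩
  · simp [and_comm]
  · rw [List.concat_eq_append, show u ++ a :: (v ++ [b]) = (u ++ a :: v) ++ [b] by simp]
    simp only [List.append_singleton_inj]
    aesop

theorem openAt_snoc : OpenAt (w ++ [s]) x i ↔
    (s = Sum.inr (.opn x) ∧ i = (doc w).length + 1) ∨
      (s ≠ Sum.inr (.opn x) ∧ s ≠ Sum.inr (.cls x) ∧ OpenAt w x i) := by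
  simp only [OpenAt, snoc_eq_append_cons]
  constructor
  · rintro ⟨u, v, ⟨rfl, rfl, rfl⟩ | ⟨v, rfl, rfl⟩, ho, hc, rfl⟩
    · exact .inl ⟨rfl, rfl⟩
    · simp only [List.mem_append, List.mem_singleton, not_or] at ho hc
      exact .inr ⟨Ne.symm ho.2, Ne.symm hc.2, u, v, rfl, ho.1, hc.1, rfl⟩
  · rintro (⟨rfl, rfl⟩ | ⟨ho', hc', u, v, rfl, ho, hc, rfl⟩)
    · exact ⟨w, [], .inl ⟨rfl, rfl, rfl⟩, List.not_mem_nil, List.not_mem_nil, rfl⟩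
    · exact ⟨u, v ++ [s], .inr ⟨v, rfl, rfl⟩, by simp [ho, ho'.symm], by simp [hc, hc'.symm], rfl⟩

theorem mem_tupleOf_snoc : (i, j) ∈ tupleOf (w ++ [s]) x ↔
    (i, j) ∈ tupleOf w x ∨ (s = Sum.inr (.cls x) ∧ OpenAt w x i ∧ j = (doc w).length + 1) := by
  simp only [tupleOf, OpenAt, Set.mem_ofPred_eq, Prod.mk.injEq]
  simp only [← List.cons_append, ← List.append_assoc, snoc_eq_append_cons]
  constructor
  · rintro ⟨u, v, z, ⟨rfl, rfl, rfl⟩ | ⟨z, rfl, rfl⟩, ho, hc, rfl, rfl⟩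
    · exact .inr ⟨rfl, ⟨u, v, rfl, ho, hc, rfl⟩, by simp [doc_append, doc_cons_inr]⟩
    · exact .inl ⟨u, v, z, rfl, ho, hc, rfl, rfl⟩
  · rintro (⟨u, v, z, rfl, ho, hc, rfl, rfl⟩ | ⟨rfl, ⟨u, v, rfl, ho, hc, rfl⟩, rfl⟩)
    · exact ⟨u, v, z ++ [s], .inr ⟨z, rfl, rfl⟩, ho, hc, rfl, rfl⟩
    · exact ⟨u, v, [], .inl ⟨rfl, rfl, rfl⟩, ho, hc, rfl, by simp [doc_append, doc_cons_inr]⟩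

theorem OpenAt.le (h : OpenAt w x i) : i ≤ (doc w).length + 1 := by
  obtain ⟨u, v, rfl, -, -, rfl⟩ := h
  simp [doc_append]

theorem not_openAt_nil : ¬ OpenAt ([] : List (RefSym A X)) x i := by
  simp [OpenAt]

theorem OpenAt.unique (hi : OpenAt w x i) (hj : OpenAt w x j) : i = j := by
  induction w using List.reverseRecOn with
  | nil => exact (not_openAt_nil hi).elim
  | append_singleton w s ih =>
    rw [openAt_snoc] at hi hj
    grind

theorem exists_openAt_iff {p : Bool} (h : track x false w = some p) :
    (∃ i, OpenAt w x i) ↔ p = true := by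
  induction w using List.reverseRecOn generalizing p with
  | nil =>
    rw [← Option.some.inj h]
    simp [not_openAt_nil]
  | append_singleton w s ih =>
    rw [track_append] at h
    obtain ⟨q, hq, h⟩ := Option.bind_eq_some_iff.1 h
    rw [track_singleton, trackStep] at h
    simp only [openAt_snoc, exists_or, exists_and_left, exists_eq, and_true, ih hq]
    grind

theorem Balanced.not_openAt (h : Balanced w) : ¬ OpenAt w x i :=
  fun hi => Bool.false_ne_true ((exists_openAt_iff (h x)).1 ⟨i, hi⟩)

theorem PrefixBalanced.not_openAt (h : PrefixBalanced (w ++ [Sum.inr (.opn x)])) :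
    ¬ OpenAt w x i := by
  intro hi
  obtain ⟨q, hq⟩ := Option.isSome_iff_exists.1 (h.of_append x)
  have := h x
  simp [track_append, hq, track_singleton, trackStep, (exists_openAt_iff hq).1 ⟨i, hi⟩] at this

theorem PrefixBalanced.exists_openAt (h : PrefixBalanced (w ++ [Sum.inr (.cls x)])) :
    ∃ i, OpenAt w x i := by
  obtain ⟨q, hq⟩ := Option.isSome_iff_exists.1 (h.of_append x)
  have := h x
  simp only [track_append, hq, Option.bind_some, track_singleton, trackStep] at this
  exact (exists_openAt_iff hq).2 (by grind)

end Balance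

/-! ### Multispan-tuples as sequences of flags -/

section Flags

variable {A X : Type*} {x : X} {w v : List (RefSym A X)} {s : RefSym A X} {i j : ℕ}

/-- The brackets at one position of a document: for every variable, whether a nonempty span ends
there, whether there is an empty span, and whether a nonempty span starts there. -/
abbrev Flags (X : Type*) := X → Prop × Prop × Prop

/-- The flags of the tuple `t` at position `i`. -/
def flagsAt (t : X → Set Span) (i : ℕ) : Flags X := fun x =>
  (∃ j, j ≠ i ∧ (j, i) ∈ t x, (i, i) ∈ t x, ∃ j, j ≠ i ∧ (i, j) ∈ t x)

/-- The flags at position `i` of the tuple described by a prefix of a word; a variable that is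
still open counts as the start of a nonempty span. -/
def prefixFlags (w : List (RefSym A X)) (i : ℕ) : Flags X := fun x =>
  (∃ j, j ≠ i ∧ (j, i) ∈ tupleOf w x, (i, i) ∈ tupleOf w x,
    (∃ j, j ≠ i ∧ (i, j) ∈ tupleOf w x) ∨ OpenAt w x i)

/-- The flags of no bracket. -/
def noFlags : Flags X := fun _ => (False, False, False)

open Classical in
/-- The flags of a position after one more bracket has been read there. A closing bracket ends an
empty span if the start flag is set, and a span that started further left otherwise. -/
noncomputable def flagsSnoc (f : Flags X) : Bracket X → Flags X
  | .opn x => update f x ((f x).1, (f x).2.1, True)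
  | .cls x => update f x ((f x).1 ∨ ¬ (f x).2.2, (f x).2.1 ∨ (f x).2.2, False)

/-- The flags of the positions of a word, when `f` are the flags of the brackets that have already
been read at the first position. -/
noncomputable def wordFlags : Flags X → List (RefSym A X) → List (Flags X)
  | f, [] => [f]
  | f, Sum.inl _ :: w => f :: wordFlags noFlags w
  | f, Sum.inr b :: w => wordFlags (flagsSnoc f b) w

/-- The flags of the positions `i, …, i + n`. -/
def flagList (F : ℕ → Flags X) (i n : ℕ) : List (Flags X) := (List.range' i (n + 1)).map F

theorem doc_snoc_inl (w : List (RefSym A X)) (a : A) : doc (w ++ [Sum.inl a]) = doc w ++ [a] :=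
  doc_append ..

theorem doc_snoc_inr (w : List (RefSym A X)) (b : Bracket X) : doc (w ++ [Sum.inr b]) = doc w := by
  rw [doc_append, doc_cons_inr]
  exact List.append_nil _

theorem le_of_mem_tupleOf (h : (i, j) ∈ tupleOf w x) : 1 ≤ i ∧ i ≤ j ∧ j ≤ (doc w).length + 1 :=
  (isMultispanTuple_tupleOf w x).1 _ h

theorem prefixFlags_of_balanced (h : Balanced w) (i : ℕ) :
    prefixFlags w i = flagsAt (tupleOf w) i := by
  funext x
  simp only [prefixFlags, flagsAt, h.not_openAt, or_false]

theorem prefixFlags_nil (i : ℕ) : prefixFlags ([] : List (RefSym A X)) i = noFlags := by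
  funext x
  simp [prefixFlags, noFlags, tupleOf, not_openAt_nil]

theorem prefixFlags_of_lt (hi : (doc w).length + 1 < i) : prefixFlags w i = noFlags := by
  have no_end {x j} : (j, i) ∉ tupleOf w x := fun h => by grind [le_of_mem_tupleOf h]
  have no_start {x j} : (i, j) ∉ tupleOf w x := fun h => by grind [le_of_mem_tupleOf h]
  have not_open {x} : ¬ OpenAt w x i := fun h => hi.not_ge h.le
  funext x
  simp [prefixFlags, noFlags, no_end, no_start, not_open]

theorem prefixFlags_snoc_of_ne (h₁ : s ≠ Sum.inr (.opn x)) (h₂ : s ≠ Sum.inr (.cls x)) (i : ℕ) :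
    prefixFlags (w ++ [s]) i x = prefixFlags w i x := by
  simp [prefixFlags, mem_tupleOf_snoc, openAt_snoc, h₁, h₂]

theorem prefixFlags_snoc_inl (w : List (RefSym A X)) (a : A) (i : ℕ) :
    prefixFlags (w ++ [Sum.inl a]) i = prefixFlags w i :=
  funext fun _ => prefixFlags_snoc_of_ne Sum.inl_ne_inr Sum.inl_ne_inr i

theorem prefixFlags_snoc_of_lt (h : PrefixBalanced (w ++ [s])) (hi : i < (doc w).length + 1) :
    prefixFlags (w ++ [s]) i = prefixFlags w i := by
  funext x
  by_cases h₁ : s = Sum.inr (.opn x)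
  · subst h₁
    simp [prefixFlags, mem_tupleOf_snoc, openAt_snoc, h.not_openAt, hi.ne]
  by_cases h₂ : s = Sum.inr (.cls x)
  · subst h₂
    simp [prefixFlags, mem_tupleOf_snoc, openAt_snoc, hi.ne, and_or_left, exists_or]
    grind
  · exact prefixFlags_snoc_of_ne h₁ h₂ i

theorem prefixFlags_append_of_lt (h : PrefixBalanced (w ++ v)) (hi : i < (doc w).length + 1) :
    prefixFlags (w ++ v) i = prefixFlags w i := by
  induction v using List.reverseRecOn with
  | nil => rw [List.append_nil]
  | append_singleton v s ih =>
    rw [← List.append_assoc] at h ⊢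
    rw [prefixFlags_snoc_of_lt h (by rw [doc_append, List.length_append]; omega), ih h.of_append]

open Classical in
theorem prefixFlags_snoc_opn (w : List (RefSym A X)) (x : X) :
    prefixFlags (w ++ [Sum.inr (.opn x)]) ((doc w).length + 1) =
      flagsSnoc (prefixFlags w ((doc w).length + 1)) (.opn x) := by
  funext y
  rcases eq_or_ne y x with rfl | hy
  · simp [flagsSnoc, prefixFlags, mem_tupleOf_snoc, openAt_snoc]
  · rw [flagsSnoc, update_of_ne hy]
    exact prefixFlags_snoc_of_ne (by simpa using hy.symm) (by simp) _

open Classical in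
theorem prefixFlags_snoc_cls (h : PrefixBalanced (w ++ [Sum.inr (.cls x)])) :
    prefixFlags (w ++ [Sum.inr (.cls x)]) ((doc w).length + 1) =
      flagsSnoc (prefixFlags w ((doc w).length + 1)) (.cls x) := by
  funext y
  rcases eq_or_ne y x with rfl | hy
  · obtain ⟨i, hi⟩ := h.exists_openAt
    have open_iff (j) : OpenAt w y j ↔ j = i := ⟨fun hj => hj.unique hi, fun e => e ▸ hi⟩
    have no_start : ¬ ∃ j, j ≠ (doc w).length + 1 ∧ ((doc w).length + 1, j) ∈ tupleOf w y :=
      fun ⟨j, hj, h⟩ => by grind [le_of_mem_tupleOf h]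
    have no_loop (j) : ¬ (j ≠ (doc w).length + 1 ∧ (doc w).length + 1 = i ∧
        j = (doc w).length + 1) := fun h => h.1 h.2.2
    simp only [flagsSnoc, prefixFlags, update_self, mem_tupleOf_snoc, openAt_snoc, open_iff,
      true_and, and_true, and_or_left, exists_or, exists_eq_right, no_start, no_loop,
      ne_eq, not_true_eq_false, reduceCtorEq, false_and, and_false, or_false, false_or,
      Sum.inr.injEq, eq_comm (a := i)]
  · rw [flagsSnoc, update_of_ne hy]
    exact prefixFlags_snoc_of_ne (by simp) (by simpa using hy.symm) _

theorem prefixFlags_snoc_inr {b : Bracket X} (h : PrefixBalanced (w ++ [Sum.inr b])) :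
    prefixFlags (w ++ [Sum.inr b]) ((doc w).length + 1) =
      flagsSnoc (prefixFlags w ((doc w).length + 1)) b := by
  cases b with
  | opn x => exact prefixFlags_snoc_opn w x
  | cls x => exact prefixFlags_snoc_cls h

theorem flagList_succ (F : ℕ → Flags X) (i n : ℕ) :
    flagList F i (n + 1) = F i :: flagList F (i + 1) n := rfl

theorem wordFlags_prefixFlags (h : PrefixBalanced (w ++ v)) :
    wordFlags (prefixFlags w ((doc w).length + 1)) v =
      flagList (prefixFlags (w ++ v)) ((doc w).length + 1) (doc v).length := by
  induction v generalizing w with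
  | nil => simp [wordFlags, flagList, doc]
  | cons s v ih =>
    rw [List.append_cons] at h ⊢
    have key := ih h
    cases s with
    | inl a =>
      have first_eq : prefixFlags (w ++ [Sum.inl a] ++ v) ((doc w).length + 1) =
          prefixFlags w ((doc w).length + 1) := by
        rw [prefixFlags_append_of_lt h (by simp [doc_snoc_inl]), prefixFlags_snoc_inl]
      rw [doc_snoc_inl, List.length_append, List.length_singleton, prefixFlags_snoc_inl,
        prefixFlags_of_lt (Nat.lt_succ_self _)] at key
      rw [wordFlags, key, ← first_eq]
      rfl
    | inr b =>
      rw [doc_snoc_inr, prefixFlags_snoc_inr h.of_append] at key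
      rw [wordFlags, key, doc_cons_inr]

theorem Balanced.wordFlags_eq (h : Balanced w) :
    wordFlags noFlags w = flagList (flagsAt (tupleOf w)) 1 (doc w).length := by
  have := wordFlags_prefixFlags (w := []) h.prefixBalanced
  rwa [prefixFlags_nil, List.nil_append, funext (prefixFlags_of_balanced h)] at this

theorem subset_of_flagsAt_eq {D : List A} {t t' : X → Set Span} (ht : IsMultispanTuple D t)
    (ht' : IsMultispanTuple D t')
    (h : ∀ i, 1 ≤ i → i ≤ D.length + 1 → flagsAt t i = flagsAt t' i) (x : X) : t x ⊆ t' x := by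
  simp only [funext_iff, flagsAt, Prod.mk.injEq, eq_iff_iff] at h
  rintro ⟨i, j⟩ hij
  obtain ⟨hi : 1 ≤ i, hle : i ≤ j, hj : j ≤ D.length + 1⟩ := (ht x).1 _ hij
  rcases eq_or_ne i j with rfl | hne
  · exact (h i hi hj x).2.1.1 hij
  -- In `t'` some span starts at `i`; ending left of `j` it would be followed in `t` by another
  -- end inside `[i, j⟩`, and ending right of `j` it would overlap the span of `t'` ending at `j`.
  obtain ⟨j', hj'i, hij'⟩ := (h i hi (hle.trans hj) x).2.2.1 ⟨j, hne.symm, hij⟩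
  obtain ⟨-, hle' : i ≤ j', hj' : j' ≤ D.length + 1⟩ := (ht' x).1 _ hij'
  obtain ⟨k, hkj, hk⟩ := (h j (hi.trans hle) hj x).1.1 ⟨i, hne, hij⟩
  obtain ⟨l, hlj, hl⟩ := (h j' (hi.trans hle') hj' x).1.2 ⟨i, hj'i.symm, hij'⟩
  have hkle : k ≤ j := ((ht' x).1 _ hk).2.1
  have hlle : l ≤ j' := ((ht x).1 _ hl).2.1
  rcases eq_or_ne j j' with rfl | e
  · exact hij'
  have disjoint' : j' ≤ k ∨ j ≤ i := (ht' x).2 hij' hk (by simp [e.symm])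
  have disjoint : j ≤ l ∨ j' ≤ i := (ht x).2 hij hl (by simp [e])
  omega

theorem eq_of_flagList_eq {D : List A} {t t' : X → Set Span} (ht : IsMultispanTuple D t)
    (ht' : IsMultispanTuple D t')
    (h : flagList (flagsAt t) 1 D.length = flagList (flagsAt t') 1 D.length) : t = t' := by
  have flags_eq (i) (h₁ : 1 ≤ i) (h₂ : i ≤ D.length + 1) : flagsAt t i = flagsAt t' i :=
    List.map_inj_left.1 h i (List.mem_range'_1.2 (by omega))
  funext x
  exact (subset_of_flagsAt_eq ht ht' flags_eq x).antisymm
    (subset_of_flagsAt_eq ht' ht (fun i h₁ h₂ => (flags_eq i h₁ h₂).symm) x)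

/-! ### The words that encode sequences of flags -/

variable [Fintype X] [LinearOrder X]

open Classical in
/-- The brackets that are described by the flags of one position. -/
noncomputable def flagWord (f : Flags X) : List (RefSym A X) :=
  ((Finset.univ : Finset X).sort (· ≤ ·)).flatMap fun x =>
    (if (f x).1 then [Sum.inr (.cls x)] else []) ++
    (if (f x).2.1 then [Sum.inr (.opn x), Sum.inr (.cls x)] else []) ++
    (if (f x).2.2 then [Sum.inr (.opn x)] else [])

/-- The word that encodes a document together with a sequence of flags, one for each position;
when the lengths do not match, the rest of the longer list is ignored. -/
noncomputable def encodeFlags : List (Flags X) → List A → List (RefSym A X)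
  | [], _ => []
  | f :: _, [] => flagWord f
  | f :: fs, a :: D => flagWord f ++ Sum.inl a :: encodeFlags fs D

theorem block_eq (t : X → Set Span) (i : ℕ) :
    (block t i : List (RefSym A X)) = flagWord (flagsAt t i) := rfl

theorem nrefFrom_eq (t : X → Set Span) (i : ℕ) (D : List A) :
    nrefFrom t i D = encodeFlags (flagList (flagsAt t) i D.length) D := by
  induction D generalizing i with
  | nil => exact block_eq t i
  | cons a D ih => rw [nrefFrom, List.length_cons, flagList_succ, encodeFlags, ih, block_eq]

end Flags

/-! ### Reading the flags with an automaton -/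

section SubsetAutomaton

variable {A X Q : Type*}

theorem doc_map_inr_append (u : List (Bracket X)) (w : List (RefSym A X)) :
    doc (u.map Sum.inr ++ w) = doc w := by
  induction u with
  | nil => rfl
  | cons _ _ ih => exact ih

theorem wordFlags_map_inr_append (u : List (Bracket X)) (w : List (RefSym A X)) (f : Flags X) :
    wordFlags f (u.map Sum.inr ++ w) = wordFlags (u.foldl flagsSnoc f) w := by
  induction u generalizing f with
  | nil => rfl
  | cons b _ ih => exact ih _

theorem exists_eq_map_inr_append (w : List (RefSym A X)) :
    ∃ (u : List (Bracket X)) (v : List (RefSym A X)), w = u.map Sum.inr ++ v ∧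
      (v = [] ∨ ∃ a v', v = Sum.inl a :: v') := by
  induction w with
  | nil => exact ⟨[], [], rfl, .inl rfl⟩
  | cons s w ih =>
    cases s with
    | inl a => exact ⟨[], _, rfl, .inr ⟨a, w, rfl⟩⟩
    | inr b =>
      obtain ⟨u, v, rfl, hv⟩ := ih
      exact ⟨b :: u, v, rfl, hv⟩

variable (M : DFA (RefSym A X) Q)

/-- The states that can be reached from `S` by brackets with the given flags. -/
def readFlags (S : Set Q) (f : Flags X) : Set Q :=
  {q' | ∃ q ∈ S, ∃ u : List (Bracket X),
    q' = M.evalFrom q (u.map Sum.inr) ∧ u.foldl flagsSnoc noFlags = f}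

/-- Some word with the given document and the given flags is accepted from a state in `S`. -/
def AcceptsFlags (S : Set Q) (D : List A) (fs : List (Flags X)) : Prop :=
  ∃ q ∈ S, ∃ w, wordFlags noFlags w = fs ∧ doc w = D ∧ M.evalFrom q w ∈ M.accept

theorem acceptsFlags_nil (S : Set Q) (f : Flags X) :
    AcceptsFlags M S [] [f] ↔ ∃ q ∈ readFlags M S f, q ∈ M.accept := by
  constructor
  · rintro ⟨q, hq, w, hf, hd, ha⟩
    obtain ⟨u, v, rfl, rfl | ⟨a, v', rfl⟩⟩ := exists_eq_map_inr_append w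
    · rw [wordFlags_map_inr_append, wordFlags, List.cons.injEq] at hf
      rw [List.append_nil] at ha
      exact ⟨_, ⟨q, hq, u, rfl, hf.1⟩, ha⟩
    · rw [doc_map_inr_append] at hd
      cases hd
  · rintro ⟨_, ⟨q, hq, u, rfl, rfl⟩, ha⟩
    exact ⟨q, hq, u.map Sum.inr ++ [], wordFlags_map_inr_append .., doc_map_inr_append ..,
      by rwa [List.append_nil]⟩

theorem acceptsFlags_cons (S : Set Q) (a : A) (D : List A) (f : Flags X) (fs : List (Flags X)) :
    AcceptsFlags M S (a :: D) (f :: fs) ↔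
      AcceptsFlags M ((fun q => M.step q (Sum.inl a)) '' readFlags M S f) D fs := by
  constructor
  · rintro ⟨q, hq, w, hf, hd, ha⟩
    obtain ⟨u, v, rfl, rfl | ⟨a', v', rfl⟩⟩ := exists_eq_map_inr_append w
    · rw [doc_map_inr_append] at hd
      cases hd
    · rw [wordFlags_map_inr_append, wordFlags, List.cons.injEq] at hf
      rw [doc_map_inr_append] at hd
      obtain ⟨rfl, rfl⟩ : a' = a ∧ doc v' = D := List.cons.inj hd
      rw [DFA.evalFrom_of_append] at ha
      exact ⟨_, ⟨_, ⟨q, hq, u, rfl, hf.1⟩, rfl⟩, v', hf.2, rfl, ha⟩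
  · rintro ⟨_, ⟨_, ⟨q, hq, u, rfl, rfl⟩, rfl⟩, w, rfl, rfl, ha⟩
    exact ⟨q, hq, u.map Sum.inr ++ Sum.inl a :: w, wordFlags_map_inr_append ..,
      doc_map_inr_append .., by rwa [DFA.evalFrom_of_append]⟩

theorem acceptsFlags_iff (hM : ∀ w ∈ M.accepts, Balanced w) (D : List A) (fs : List (Flags X)) :
    AcceptsFlags M {M.start} D fs ↔
      ∃ t ∈ (Multispanner.ofLanguage M.accepts).rel D, flagList (flagsAt t) 1 D.length = fs := by
  constructor
  · rintro ⟨_, rfl, w, rfl, rfl, hw⟩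
    exact ⟨_, ⟨w, hw, rfl, rfl⟩, (hM w hw).wordFlags_eq.symm⟩
  · rintro ⟨_, ⟨w, hw, rfl, rfl⟩, rfl⟩
    exact ⟨_, rfl, w, (hM w hw).wordFlags_eq, rfl, hw⟩

end SubsetAutomaton

/-! ### Totalization of streaming string transducers -/

section Totalization

variable {R O : Type*}

open Classical in
/-- The restriction of a total valuation to the registers in `U`. -/
noncomputable def mask (U : Set R) (ν : R → List O) : Valuation R O :=
  fun r => if r ∈ U then some (ν r) else none

open Classical in
theorem eval_mask (U : Set R) (ν : R → List O) (s : List (R ⊕ O)) :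
    (mask U ν).eval s = if ∀ r ∈ regs s, r ∈ U then some (instantiate ν s) else none := by
  induction s with
  | nil => simp [Valuation.eval]
  | cons y s ih =>
    rcases y with r | o
    · by_cases hr : r ∈ U <;> by_cases hs : ∀ r ∈ regs s, r ∈ U <;>
        simp [Valuation.eval, ih, mask, hr, hs]
    · rw [Valuation.eval, ih, apply_ite (Option.map _), regs_cons_inr]
      rfl

/-- The registers that are defined after an assignment if those in `U` are defined before. -/
def definedRegs (σ : Assignment R O) (U : Set R) : Set R :=
  {r | ∃ s, σ r = some s ∧ ∀ r' ∈ regs s, r' ∈ U}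

open Classical in
theorem mask_comp (σ : Assignment R O) (U : Set R) (ν : R → List O) :
    (mask U ν).comp σ = mask (definedRegs σ U) fun r => instantiate ν ((σ r).getD []) := by
  funext r
  cases h : σ r with
  | none => simp [Valuation.comp, mask, definedRegs, h]
  | some s =>
    rw [Valuation.comp, h, Option.bind_some, eval_mask, mask]
    simp [definedRegs, h]

open Classical in
theorem count_inl_eq_count_regs (s : List (R ⊕ O)) (r : R) :
    s.count (.inl r) = (regs s).count r := by
  induction s with
  | nil => rfl
  | cons y s ih =>
    rw [List.count_cons, ih]
    cases y with
    | inl r' => rw [regs_cons_inl, List.count_cons]; rfl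
    | inr o => rfl

theorem Assignment.Copyless.copylessTotal [Fintype R] {σ : Assignment R O} (h : σ.Copyless) :
    CopylessTotal fun r => (σ r).getD [] := fun r => by
  simpa only [count_inl_eq_count_regs] using h r

open Classical in
theorem copylessTotal_inl [Fintype R] : CopylessTotal fun r : R => [(.inl r : R ⊕ O)] :=
  fun r => by simp [List.count_cons]

end Totalization

namespace DSST

variable {B O : Type*} (M : DSST B O)

/-- A transition with a total assignment; the set that is added to the state consists of the
registers that are defined. -/
def totalStep (p : M.Q × Set M.R) (b : B) :
    Option ((M.R → List (M.R ⊕ O)) × (M.Q × Set M.R)) :=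
  (M.δ p.1 b).map fun t => (fun r => (t.1 r).getD [], t.2, definedRegs t.1 p.2)

/-- The run over a word with total assignments, which are composed to a single one. -/
def totalRun : M.Q × Set M.R → List B → Option ((M.R → List (M.R ⊕ O)) × (M.Q × Set M.R))
  | p, [] => some (fun r => [.inl r], p)
  | p, b :: w => (M.totalStep p b).bind fun t =>
      (totalRun t.2 w).map fun t' => (fun r => substitute t.1 (t'.1 r), t'.2)

attribute [local instance] DSST.finR in
theorem copylessTotal_totalRun {w : List B} {p : M.Q × Set M.R} {t}
    (h : M.totalRun p w = some t) : CopylessTotal t.1 := by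
  induction w generalizing p t with
  | nil =>
    cases h
    exact copylessTotal_inl
  | cons b w ih =>
    obtain ⟨t₁, h₁, h⟩ := Option.bind_eq_some_iff.1 h
    obtain ⟨t₂, h₂, rfl⟩ := Option.map_eq_some_iff.1 h
    obtain ⟨⟨σ, q⟩, hδ, rfl⟩ := Option.map_eq_some_iff.1 h₁
    exact (M.copyless _ _ _ _ hδ).copylessTotal.substitute (ih h₂)

theorem run_mask (w : List B) (p : M.Q × Set M.R) (ν : M.R → List O) :
    M.run p.1 (mask p.2 ν) w =
      (M.totalRun p w).map fun t => (t.2.1, mask t.2.2 fun r => instantiate ν (t.1 r)) := by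
  induction w generalizing p ν with
  | nil => simp [run, totalRun]
  | cons b w ih =>
    rw [run, totalRun, totalStep]
    cases M.δ p.1 b with
    | none => rfl
    | some t =>
      rw [Option.bind_some, Option.map_some, Option.bind_some, mask_comp,
        ih (t.2, definedRegs t.1 p.2), Option.map_map]
      simp only [Function.comp_def, instantiate_substitute]

theorem run_append (u v : List B) (q : M.Q) (ν : Valuation M.R O) :
    M.run q ν (u ++ v) = (M.run q ν u).bind fun p => M.run p.1 p.2 v := by
  induction u generalizing q ν with
  | nil => rfl
  | cons b u ih =>
    simp only [List.cons_append, run]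
    cases M.δ q b with
    | none => rfl
    | some t => exact ih _ _

end DSST

/-! ### Linear extract-transform programs as transducers with choices -/

section ListsOfLength

variable (B : Type*) [Fintype B]

/-- The bag of the lists of length `n`, each of which occurs once. -/
noncomputable def listsOfLength : ℕ → Multiset (List B)
  | 0 => {[]}
  | n + 1 => Finset.univ.val.bind fun b => (listsOfLength n).map (List.cons b)

variable {B}

theorem mem_listsOfLength {n : ℕ} {l : List B} : l ∈ listsOfLength B n ↔ l.length = n := by
  induction n generalizing l with
  | zero => simp [listsOfLength]
  | succ n ih => cases l <;> simp [listsOfLength, ih]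

theorem nodup_listsOfLength (n : ℕ) : (listsOfLength B n).Nodup := by
  induction n with
  | zero => exact Multiset.nodup_singleton []
  | succ n ih =>
    refine Multiset.nodup_bind.2 ⟨fun b _ => ih.map List.cons_injective, ?_⟩
    refine Finset.univ.nodup.pairwise fun b _ b' _ hne => Multiset.disjoint_left.2 ?_
    rintro _ hl hl'
    obtain ⟨l, -, rfl⟩ := Multiset.mem_map.1 hl
    obtain ⟨l', -, h⟩ := Multiset.mem_map.1 hl'
    exact hne (List.cons.inj h).1.symm

end ListsOfLength

theorem filterMap_bind_eq_elim {α β γ : Type*} (s : Multiset α) (o : Option β)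
    (g : β → α → Option γ) :
    s.filterMap (fun x => o.bind fun y => g y x) = o.elim 0 fun y => s.filterMap (g y) := by
  cases o with
  | none => exact Multiset.eq_zero_of_forall_notMem fun z hz => by simp at hz
  | some y => rfl

section Programs

attribute [local instance] DSST.finQ DSST.finR

variable {A X O Q : Type*} [Fintype X] [LinearOrder X]
  (N : DFA (RefSym A X) Q) (M : DSST (RefSym A X) O)

open Classical in
/-- The transducer that chooses the flags of all positions and simulates `M` on the word that they
encode. Besides the state of `M` and the set of its registers that are defined, it keeps track of
the states of `N` that can be reached by a word with the chosen flags, because several words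
describe the same tuple. -/
noncomputable def programTransducer :
    ChoiceTransducer (Set Q × M.Q × Set M.R) A (Flags X) M.R O where
  step p f a := (M.totalRun p.2 (flagWord f ++ [.inl a])).map fun t =>
    (t.1, (fun q => N.step q (.inl a)) '' readFlags N p.1 f, t.2)
  final p f :=
    if ∃ q ∈ readFlags N p.1 f, q ∈ N.accept then
      (M.totalRun p.2 (flagWord f)).bind fun t => (M.F t.2.1).bind fun s =>
        if ∀ r ∈ regs s, r ∈ t.2.2 then some (substitute t.1 s) else none
    else none

theorem programTransducer_copyless : (programTransducer N M).Copyless := by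
  intro p f a q hq
  obtain ⟨t, ht, rfl⟩ := Option.map_eq_some_iff.1 hq
  exact M.copylessTotal_totalRun ht

open Classical in
/-- The output of `M` on the word encoded by the flags `fs` on `D`, provided that `N` accepts these
flags; both are started in the configuration given by `p` and `ν`. -/
noncomputable def programOutput (p : Set Q × M.Q × Set M.R) (ν : M.R → List O) (D : List A)
    (fs : List (Flags X)) : Option (List O) :=
  if AcceptsFlags N p.1 D fs then
    (M.run p.2.1 (mask p.2.2 ν) (encodeFlags fs D)).bind fun c => (M.F c.1).bind c.2.eval
  else none

open Classical in
theorem programOutput_nil (p : Set Q × M.Q × Set M.R) (ν : M.R → List O) (f : Flags X) :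
    programOutput N M p ν [] [f] = ((programTransducer N M).final p f).map (instantiate ν) := by
  simp only [programOutput, acceptsFlags_nil, encodeFlags, programTransducer, M.run_mask]
  split_ifs
  · cases M.totalRun p.2 (flagWord f) with
    | none => rfl
    | some t =>
      simp only [Option.map_some, Option.bind_some]
      cases M.F t.2.1 with
      | none => rfl
      | some s =>
        simp only [Option.bind_some, eval_mask]
        split_ifs <;> simp [instantiate_substitute]
  · rfl

open Classical in
theorem programOutput_cons (p : Set Q × M.Q × Set M.R) (ν : M.R → List O) (a : A) (D : List A)
    (f : Flags X) (fs : List (Flags X)) :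
    programOutput N M p ν (a :: D) (f :: fs) =
      ((programTransducer N M).step p f a).bind fun q =>
        programOutput N M q.2 (fun r => instantiate ν (q.1 r)) D fs := by
  simp only [programOutput, acceptsFlags_cons, encodeFlags, programTransducer]
  rw [List.append_cons, M.run_append, M.run_mask]
  cases M.totalRun p.2 (flagWord f ++ [.inl a]) with
  | none => exact ite_self none
  | some t => rfl

theorem outputs_programTransducer (p : Set Q × M.Q × Set M.R) (ν : M.R → List O) (D : List A) :
    (programTransducer N M).outputs p ν D =
      (listsOfLength (Flags X) (D.length + 1)).filterMap (programOutput N M p ν D) := by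
  induction D generalizing p ν with
  | nil =>
    rw [ChoiceTransducer.outputs, listsOfLength, Multiset.filterMap_bind]
    refine congrArg Multiset.sum (Multiset.map_congr rfl fun f _ => ?_)
    rw [List.length_nil, listsOfLength, Multiset.map_singleton]
    have hf := programOutput_nil N M p ν f
    cases h : (programTransducer N M).final p f with
    | none => exact (Multiset.filterMap_cons_none [f] 0 (hf.trans (by rw [h]; rfl))).symm
    | some s => exact (Multiset.filterMap_cons_some _ [f] 0 (hf.trans (by rw [h]; rfl))).symm
  | cons a D ih =>
    rw [ChoiceTransducer.outputs, List.length_cons, listsOfLength, Multiset.filterMap_bind]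
    refine congrArg Multiset.sum (Multiset.map_congr rfl fun f _ => ?_)
    rw [Multiset.filterMap_map]
    simp only [Function.comp_def, programOutput_cons, filterMap_bind_eq_elim, ih]

open Classical in
theorem filter_acceptsFlags_listsOfLength (hN : ∀ w ∈ N.accepts, Balanced w) (D : List A) :
    (listsOfLength (Flags X) (D.length + 1)).filter (AcceptsFlags N {N.start} D) =
      ((Multispanner.ofLanguage N.accepts).finite D).toFinset.val.map
        fun t => flagList (flagsAt t) 1 D.length := by
  refine (Multiset.Nodup.ext ((nodup_listsOfLength _).filter _) ?_).2 fun fs => ?_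
  · refine Multiset.Nodup.map_on (fun t ht t' ht' h => ?_) (Finset.nodup _)
    rw [Finset.mem_val, Set.Finite.mem_toFinset] at ht ht'
    exact eq_of_flagList_eq (Multispanner.valid _ D t ht) (Multispanner.valid _ D t' ht') h
  · rw [Multiset.mem_filter, mem_listsOfLength, acceptsFlags_iff N hN, Multiset.mem_map]
    simp only [Finset.mem_val, Set.Finite.mem_toFinset, and_iff_right_iff_imp]
    rintro ⟨t, -, rfl⟩
    simp [flagList]

theorem outputBag_eq_outputs (hN : ∀ w ∈ N.accepts, Balanced w) (D : List A) :
    outputBag (Multispanner.ofLanguage N.accepts) M.fn D =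
      (programTransducer N M).outputs ({N.start}, M.q₀, Set.univ) (fun _ => []) D := by
  classical
  have hmask : (mask Set.univ fun _ => [] : Valuation M.R O) = fun _ => some [] := by
    funext r
    simp [mask]
  have hout : programOutput N M ({N.start}, M.q₀, Set.univ) (fun _ => []) D = fun fs =>
      (Option.guard (AcceptsFlags N {N.start} D) fs).bind fun fs => M.fn (encodeFlags fs D) := by
    funext fs
    by_cases h : AcceptsFlags N {N.start} D fs <;>
      simp [programOutput, Option.guard, h, hmask, DSST.fn]
  rw [outputs_programTransducer, hout, ← Multiset.filterMap_filterMap,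
    Multiset.filterMap_eq_filter, filter_acceptsFlags_listsOfLength N hN, Multiset.filterMap_map]
  simp only [outputBag, nref, nrefFrom_eq, Function.comp_def]

theorem admitsLinearEnumeration_outputBag_fn [Finite A] [Finite Q]
    (hN : ∀ w ∈ N.accepts, Balanced w) :
    AdmitsLinearEnumeration (outputBag (Multispanner.ofLanguage N.accepts) M.fn) := by
  rw [funext (outputBag_eq_outputs N M hN)]
  exact admitsLinearEnumeration_outputs (programTransducer_copyless N M) _

end Programs

end ET

theorem theorem3_general {A X O : Type*} [Finite A] [Fintype X] [LinearOrder X]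
    {L : Language (ET.RefSym A X)} {T : List (ET.RefSym A X) → Option (List O)}
    (hL : L.IsRegular) (hbal : ∀ w ∈ L, ET.Balanced w) (hT : ET.IsLinearPolyregular T) :
    ET.AdmitsLinearEnumeration (ET.outputBag (ET.Multispanner.ofLanguage L) T) := by
  obtain ⟨Q, _, N, rfl⟩ := hL
  obtain ⟨M, hM⟩ := hT
  obtain rfl : T = M.fn := funext hM
  exact ET.admitsLinearEnumeration_outputBag_fn N M hbal

theorem theorem3 {A X O : Type*} [Fintype A] [Fintype X] [LinearOrder X] [Fintype O]
    (E : ET.Multispanner A X) (T : List (ET.RefSym A X) → Option (List O))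
    (hET : ET.IsLinearET E T) :
    ET.AdmitsLinearEnumeration (ET.outputBag E T) := by
  obtain ⟨⟨R, hR, rfl⟩, hT⟩ := hET
  exact theorem3_general R.isRegular_lang (ET.MExpr.balanced_of_wellFormed hR) hT
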